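/- **Setting.** Let $k$ be a field of characteristic zero and let $\mathbf C$ be a $k$-linear abelian braided monoidal category with small colimits and exact filtered colimits, whose tensor product is $k$-bilinear and, in each variable, exact and compatible with small colimits. The braiding gives an action of the braid group $B_n$ on $X^{\otimes n}$ for every object $X$; call $X$ *finitely braided* if for every $n$ this action factors through a finite quotient of $B_n$. **The Woronowicz operad.** Let $\widehat{\mathrm{BrAss}}(n)=\varprojlim_Q k[Q]$, the limit over the finite quotients $Q$ of $B_n$, with the operadic composition given by cabling of braids. Let $S_n=\sum_{\tau}\tilde\tau\in k[B_n]$ be the quantum symmetrizer, the sum over the symmetric group on $n$ letters of the positive lifts $\tilde\tau\in B_n$ of minimal length. Put $\mathfrak W(n)=\{x\in\widehat{\mathrm{BrAss}}(n): S_nx=0\}$, $\mathfrak W_*(n)=\mathfrak W(n)$ for $n\ne1$, and $\mathfrak W_*(1)=k$. A *$\mathfrak W_*$-algebra* is an object $L$ with $k$-linear maps $\mathfrak W_*(n)\to\mathrm{Hom}(L^{\otimes n},L)$, each factoring through the image of $\mathfrak W_*(n)$ in some $k[Q]$, which are compatible with the unit, the braid group actions and operadic composition. A finitely braided algebra (monoid)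 $A$ in $\mathbf C$ is a $\mathfrak W_*$-algebra: elements of $\widehat{\mathrm{BrAss}}(n)$ act on $A^{\otimes n}$ through a finite quotient of $B_n$, and one then multiplies. For a finitely braided $\mathfrak W_*$-algebra $L$, the *enveloping algebra* $U_{\mathfrak W_*}(L)$ is the quotient of the tensor algebra $T(L)$ by the two-sided ideal generated by the differences between $x\cdot(l_1\otimes\cdots\otimes l_n)\in L^{\otimes n}$ and $x(l_1,\dots,l_n)\in L$, for $x\in\mathfrak W_*(n)$. It carries the augmentation $\epsilon$ that vanishes on $L$. **Hopf algebras.** For a Hopf algebra $A$ in $\mathbf C$ let $P(A)\subseteq A$ be the kernel of $\Delta-\mathrm{id}\otimes1-1\otimes\mathrm{id}$; $A$ is *primitively generated* if no proper subalgebra of $A$ contains $P(A)$. If $A$ is finitely braided, $P_{\mathfrak W_*}(A)$ denotes the smallest subobject of $A$ that contains $P(A)$ and is closed under the operations of $\mathfrak W_*$. **Hopf $\mathfrak W_*$-algebras.** A *Hopf $\mathfrak W_*$-algebra* is here a finitely braided $\mathfrak W_*$-algebra $L$ such that $U=U_{\mathfrak W_*}(L)$ is finitely braided and $L\to U$ is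 a monomorphism, together with a diagonal: a morphism of $\mathfrak W_*$-algebras $\delta:L\to U\otimes U$ with values in the $\mathfrak W_*$-subalgebra generated by $L\otimes1$ and $1\otimes L$, whose extension to an algebra map $U\to U\otimes U$ is coassociative on $L$, and counital on $L$ with respect to $\epsilon$. It is *primitively generated* if no proper $\mathfrak W_*$-subalgebra of $L$ contains the kernel of $l\mapsto\delta(l)-l\otimes1-1\otimes l$. Morphisms are the morphisms of $\mathfrak W_*$-algebras compatible with the diagonals. **Theorem.** 1. Let $A$ be a primitively generated, finitely braided Hopf algebra in $\mathbf C$. Then $P_{\mathfrak W_*}(A)$ exists and the algebra map $\mu:U_{\mathfrak W_*}(P_{\mathfrak W_*}(A))\to A$ extending the inclusion of $P_{\mathfrak W_*}(A)$ is an isomorphism of algebras. 2. $P_{\mathfrak W_*}$ and $U_{\mathfrak W_*}$ are mutually inverse equivalences between the category of primitively generated, finitely braided Hopf algebras in $\mathbf C$ and the category of primitively generated Hopf $\mathfrak W_*$-algebras in $\mathbf C$. Here $P_{\mathfrak W_*}(A)$ carries the diagonal that $\mu\otimes\mu$ carries to the restriction of $\Delta_A$; $U_{\mathfrak W_*}(L)$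 carries the bialgebra structure whose comultiplication extends $\delta$ and whose counit is $\epsilon$; on morphisms the functors are restriction and the induced map of enveloping algebras. The natural isomorphisms are $\mu:U_{\mathfrak W_*}(P_{\mathfrak W_*}(A))\to A$, now an isomorphism of Hopf algebras, and the map $L\to P_{\mathfrak W_*}(U_{\mathfrak W_*}(L))$ induced by $L\to U_{\mathfrak W_*}(L)$. -/

import Mathlib

open CategoryTheory MonoidalCategory Limits

set_option linter.unusedSectionVars false

universe w v u

namespace BraidedHopf

/-- The defining relations of the braid group on `n` strands, with generators
`σ_0, …, σ_{n-2}`. -/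
def braidRels (n : ℕ) : Set (FreeGroup (Fin (n - 1))) :=
  {r | ∃ i j : Fin (n - 1), (i : ℕ) + 1 = j ∧
      r = .of i * .of j * .of i * (.of j * .of i * .of j)⁻¹} ∪
  {r | ∃ i j : Fin (n - 1), (i : ℕ) + 1 < j ∧
      r = .of i * .of j * (.of j * .of i)⁻¹}

/-- The braid group `B_n`. -/
abbrev Braid (n : ℕ) : Type := PresentedGroup (braidRels n)

/-- The generator `σ_i` of `B_n` (`0 ≤ i`, `i + 1 < n`), braiding the strands in positions
`i` and `i + 1`. -/
def Braid.s (n i : ℕ) : Braid n :=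
  if h : i < n - 1 then PresentedGroup.of ⟨i, h⟩ else 1

/-- A sequence in a group satisfying the braid relations of `B_n`. -/
structure IsBraidSeq {G : Type*} [Group G] (n : ℕ) (f : ℕ → G) : Prop where
  braid : ∀ i, i + 2 < n → f i * f (i + 1) * f i = f (i + 1) * f i * f (i + 1)
  far : ∀ i j, i + 1 < j → j + 1 < n → f i * f j = f j * f i

/-- The homomorphism from the braid group determined by the images of the generators. -/
def Braid.lift {G : Type*} [Group G] {n : ℕ} (f : ℕ → G) (hf : IsBraidSeq n f) :
    Braid n →* G :=
  PresentedGroup.toGroup (f := fun i : Fin (n - 1) => f i) (by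
    rintro r (⟨i, j, hij, rfl⟩ | ⟨i, j, hij, rfl⟩)
    · have := hf.braid i (by omega)
      simp only [map_mul, map_inv, FreeGroup.lift_apply_of, ← hij]
      rw [this, mul_inv_cancel]
    · have := hf.far i j hij (by omega)
      simp only [map_mul, map_inv, FreeGroup.lift_apply_of]
      rw [this, mul_inv_cancel])

theorem Braid.lift_s {G : Type*} [Group G] {n : ℕ} (f : ℕ → G) (hf : IsBraidSeq n f)
    (i : ℕ) (hi : i + 1 < n) : Braid.lift f hf (Braid.s n i) = f i := by
  have h : i < n - 1 := by omega
  simp [Braid.lift, Braid.s, h]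

theorem Braid.isBraidSeq_s (n : ℕ) : IsBraidSeq n (Braid.s n) where
  braid i hi := by
    have h1 : i < n - 1 := by omega
    have h2 : i + 1 < n - 1 := by omega
    simp only [Braid.s, h1, h2, dif_pos]
    have : PresentedGroup.mk (braidRels n)
        (.of ⟨i, h1⟩ * .of ⟨i + 1, h2⟩ * .of ⟨i, h1⟩ *
          (.of ⟨i + 1, h2⟩ * .of ⟨i, h1⟩ * .of ⟨i + 1, h2⟩)⁻¹) = 1 :=
      PresentedGroup.one_of_mem (Or.inl ⟨_, _, rfl, rfl⟩)
    rw [map_mul, map_inv, mul_inv_eq_one] at this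
    simp only [map_mul] at this
    exact this
  far i j hij hj := by
    have h1 : i < n - 1 := by omega
    have h2 : j < n - 1 := by omega
    simp only [Braid.s, h1, h2, dif_pos]
    have : PresentedGroup.mk (braidRels n)
        (.of ⟨i, h1⟩ * .of ⟨j, h2⟩ * (.of ⟨j, h2⟩ * .of ⟨i, h1⟩)⁻¹) = 1 :=
      PresentedGroup.one_of_mem (Or.inr ⟨_, _, hij, rfl⟩)
    rw [map_mul, map_inv, mul_inv_eq_one] at this
    simp only [map_mul] at this
    exact this

theorem IsBraidSeq.map {G H : Type*} [Group G] [Group H] {n : ℕ} {f : ℕ → G}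
    (hf : IsBraidSeq n f) (φ : G →* H) : IsBraidSeq n (fun i => φ (f i)) where
  braid i hi := by simp only [← map_mul, hf.braid i hi]
  far i j hij hj := by simp only [← map_mul, hf.far i j hij hj]

/-! ### Matsumoto section and the quantum symmetrizer -/

/-- A word of minimal length in the transpositions `(i, i+1)` representing `τ`, read as a product
of permutations: if `j = τ 0`, then `τ = s_{j-1} ⋯ s_1 s_0 · τ'` with `τ'` fixing `0`, the length
of `τ` being `j` plus that of `τ'`. -/
def reducedWord : (n : ℕ) → Equiv.Perm (Fin n) → List ℕ
  | 0, _ => []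
  | n + 1, τ =>
    (List.range (τ 0 : ℕ)).reverse ++
      (reducedWord n (Equiv.Perm.decomposeFin (Fin.cycleRange (τ 0) * τ)).2).map (· + 1)

/-- The Matsumoto section `S_n → B_n`. -/
def matsumoto {n : ℕ} (τ : Equiv.Perm (Fin n)) : Braid n :=
  ((reducedWord n τ).map (Braid.s n)).prod

/-- The quantum symmetrizer `∑_τ τ̃` in the group algebra of `B_n`. -/
noncomputable def quantumSymmetrizer (k : Type*) [Field k] (n : ℕ) : MonoidAlgebra k (Braid n) :=
  ∑ τ : Equiv.Perm (Fin n), MonoidAlgebra.of k (Braid n) (matsumoto τ)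

/-! ### Cabling -/

section Cabling

variable {G : Type*} [Group G]

/-- `f j * f (j+1) * ⋯ * f (j+n-1)`. -/
def ascProd (f : ℕ → G) (j : ℕ) : ℕ → G
  | 0 => 1
  | n + 1 => ascProd f j n * f (j + n)

/-- `f (j+n-1) * ⋯ * f (j+1) * f j`. -/
def descProd (f : ℕ → G) (j : ℕ) : ℕ → G
  | 0 => 1
  | n + 1 => f (j + n) * descProd f j n

/-- The braid obtained from `σ_j` when the strand starting in position `i` is replaced by `n`
parallel strands, where `f` lists the generators. -/
def cableGen (f : ℕ → G) (n j i : ℕ) : G :=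
  if i < j then f (j + n - 1)
  else if i = j then ascProd f j n
  else if i = j + 1 then descProd f j n
  else f j

theorem commute_ascProd {f : ℕ → G} {N : ℕ} (hf : IsBraidSeq N f) (j n l : ℕ)
    (h : (l + 1 < j ∧ j + n < N) ∨ (j + n < l ∧ l + 1 < N)) :
    Commute (f l) (ascProd f j n) := by
  induction n with
  | zero => exact Commute.one_right _
  | succ n ih =>
    refine Commute.mul_right (ih (by omega)) ?_
    rcases h with h | h
    · exact hf.far _ _ (by omega) (by omega)
    · exact (hf.far _ _ (by omega) (by omega)).symm

theorem commute_descProd {f : ℕ → G} {N : ℕ} (hf : IsBraidSeq N f) (j n l : ℕ)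
    (h : (l + 1 < j ∧ j + n < N) ∨ (j + n < l ∧ l + 1 < N)) :
    Commute (f l) (descProd f j n) := by
  induction n with
  | zero => exact Commute.one_right _
  | succ n ih =>
    refine Commute.mul_right ?_ (ih (by omega))
    rcases h with h | h
    · exact hf.far _ _ (by omega) (by omega)
    · exact (hf.far _ _ (by omega) (by omega)).symm

theorem asc_asc {f : ℕ → G} {N : ℕ} (hf : IsBraidSeq N f) (j n : ℕ) (h : j + n + 1 < N) :
    f j * ascProd f (j + 1) n * ascProd f j n = ascProd f (j + 1) n * ascProd f j n * f (j + n) := by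
  induction n with
  | zero => simp [ascProd]
  | succ n ih =>
    have e : j + 1 + n = j + n + 1 := by omega
    have c : Commute (f (j + n + 1)) (ascProd f j n) :=
      commute_ascProd hf j n _ (Or.inr ⟨by omega, by omega⟩)
    have b := hf.braid (j + n) (by omega)
    simp only [ascProd, e, ← add_assoc]
    calc f j * (ascProd f (j + 1) n * f (j + n + 1)) * (ascProd f j n * f (j + n))
        = f j * ascProd f (j + 1) n * (f (j + n + 1) * ascProd f j n) * f (j + n) := by
          simp only [mul_assoc]
      _ = f j * ascProd f (j + 1) n * ascProd f j n * (f (j + n + 1) * f (j + n)) := by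
          rw [c.eq]; simp only [mul_assoc]
      _ = ascProd f (j + 1) n * ascProd f j n * (f (j + n) * f (j + n + 1) * f (j + n)) := by
          rw [ih (by omega)]; simp only [mul_assoc]
      _ = ascProd f (j + 1) n * (ascProd f j n * f (j + n + 1)) * (f (j + n) * f (j + n + 1)) := by
          rw [b]; simp only [mul_assoc]
      _ = _ := by rw [← c.eq]; simp only [mul_assoc]

theorem desc_desc {f : ℕ → G} {N : ℕ} (hf : IsBraidSeq N f) (j n : ℕ) (h : j + n + 1 < N) :
    descProd f j n * descProd f (j + 1) n * f j =
      f (j + n) * descProd f j n * descProd f (j + 1) n := by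
  induction n with
  | zero => simp [descProd]
  | succ n ih =>
    have e : j + 1 + n = j + n + 1 := by omega
    have c : Commute (f (j + n + 1)) (descProd f j n) :=
      commute_descProd hf j n _ (Or.inr ⟨by omega, by omega⟩)
    have b := hf.braid (j + n) (by omega)
    simp only [descProd, e, ← add_assoc]
    calc f (j + n) * descProd f j n * (f (j + n + 1) * descProd f (j + 1) n) * f j
        = f (j + n) * (descProd f j n * f (j + n + 1)) * (descProd f (j + 1) n * f j) := by
          simp only [mul_assoc]
      _ = f (j + n) * f (j + n + 1) * (descProd f j n * descProd f (j + 1) n * f j) := by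
          rw [← c.eq]; simp only [mul_assoc]
      _ = (f (j + n) * f (j + n + 1) * f (j + n)) * descProd f j n * descProd f (j + 1) n := by
          rw [ih (by omega)]; simp only [mul_assoc]
      _ = f (j + n + 1) * f (j + n) * (f (j + n + 1) * descProd f j n) * descProd f (j + 1) n := by
          rw [b]; simp only [mul_assoc]
      _ = _ := by rw [c.eq]; simp only [mul_assoc]

theorem asc_desc {f : ℕ → G} {N : ℕ} (hf : IsBraidSeq N f) (j n : ℕ) (h : j + n + 1 < N) :
    ascProd f j n * f (j + n) * descProd f j n =
      descProd f (j + 1) n * f j * ascProd f (j + 1) n := by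
  induction n with
  | zero => simp [descProd, ascProd]
  | succ n ih =>
    have e : j + 1 + n = j + n + 1 := by omega
    have c : Commute (f (j + n + 1)) (descProd f j n) :=
      commute_descProd hf j n _ (Or.inr ⟨by omega, by omega⟩)
    have c' : Commute (f (j + n + 1)) (ascProd f j n) :=
      commute_ascProd hf j n _ (Or.inr ⟨by omega, by omega⟩)
    have b := hf.braid (j + n) (by omega)
    simp only [descProd, ascProd, e, ← add_assoc]
    calc ascProd f j n * f (j + n) * f (j + n + 1) * (f (j + n) * descProd f j n)
        = ascProd f j n * (f (j + n) * f (j + n + 1) * f (j + n)) * descProd f j n := by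
          simp only [mul_assoc]
      _ = (ascProd f j n * f (j + n + 1)) * f (j + n) * (f (j + n + 1) * descProd f j n) := by
          rw [b]; simp only [mul_assoc]
      _ = f (j + n + 1) * (ascProd f j n * f (j + n) * descProd f j n) * f (j + n + 1) := by
          rw [c.eq, ← c'.eq]; simp only [mul_assoc]
      _ = _ := by rw [ih (by omega)]; simp only [mul_assoc]

/-- The position reached from position `i` under the transposition of `j` and `j + 1`. -/
def swapPos (j i : ℕ) : ℕ := if i = j then j + 1 else if i = j + 1 then j else i

theorem swapPos_swapPos (j i : ℕ) : swapPos j (swapPos j i) = i := by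
  unfold swapPos; split_ifs <;> omega

theorem swapPos_lt {m j i : ℕ} (hj : j + 1 < m) (hi : i < m) : swapPos j i < m := by
  unfold swapPos; split_ifs <;> omega

theorem swapPos_left (j : ℕ) : swapPos j j = j + 1 := if_pos rfl

theorem swapPos_right (j : ℕ) : swapPos j (j + 1) = j := by simp [swapPos]

theorem swapPos_of_ne {j i : ℕ} (h : i ≠ j) (h' : i ≠ j + 1) : swapPos j i = i := by
  rw [swapPos, if_neg h, if_neg h']

theorem cableGen_lt (f : ℕ → G) (n : ℕ) {j i : ℕ} (h : i < j) :
    cableGen f n j i = f (j + n - 1) := if_pos h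

theorem cableGen_left (f : ℕ → G) (n j : ℕ) : cableGen f n j j = ascProd f j n := by
  simp [cableGen]

theorem cableGen_right (f : ℕ → G) (n j : ℕ) : cableGen f n j (j + 1) = descProd f j n := by
  simp [cableGen]

theorem cableGen_gt (f : ℕ → G) (n : ℕ) {j i : ℕ} (h : j + 1 < i) :
    cableGen f n j i = f j := by
  rw [cableGen, if_neg (by omega), if_neg (by omega), if_neg (by omega)]

theorem cableGen_braid {f : ℕ → G} {m n N : ℕ} (hf : IsBraidSeq N f) (hN : m + n = N + 1)
    (j i : ℕ) (hj : j + 2 < m) (hi : i < m) :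
    cableGen f n j (swapPos (j + 1) (swapPos j i)) *
        (cableGen f n (j + 1) (swapPos j i) * cableGen f n j i) =
      cableGen f n (j + 1) (swapPos j (swapPos (j + 1) i)) *
        (cableGen f n j (swapPos (j + 1) i) * cableGen f n (j + 1) i) := by
  have e : j + 1 + n - 1 = j + n := by omega
  have hb : j + n + 1 < N := by omega
  rcases lt_trichotomy i j with h | h | h
  · have e' : j + n = j + n - 1 + 1 := by omega
    rw [swapPos_of_ne (j := j) (i := i) (by omega) (by omega),
      swapPos_of_ne (j := j + 1) (i := i) (by omega) (by omega),
      swapPos_of_ne (j := j) (i := i) (by omega) (by omega),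
      cableGen_lt f n h, cableGen_lt f n (j := j + 1) (by omega), e]
    have := hf.braid (j + n - 1) (by omega)
    rw [← e'] at this
    simpa only [mul_assoc] using this
  · subst h
    have := asc_asc hf i n hb
    rw [swapPos_left, swapPos_left, swapPos_of_ne (j := i + 1) (i := i) (by omega) (by omega),
      swapPos_left, cableGen_gt f n (j := i) (i := i + 1 + 1) (by omega), cableGen_left,
      cableGen_left, cableGen_lt f n (j := i + 1) (i := i) (by omega), e,
      ← mul_assoc, ← mul_assoc, this]
  · rcases Nat.lt_or_ge i (j + 2) with h' | h'
    · obtain rfl : i = j + 1 := by omega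
      have := asc_desc hf j n hb
      rw [swapPos_right, swapPos_left, swapPos_of_ne (j := j + 1) (i := j) (by omega) (by omega),
        swapPos_of_ne (j := j) (i := j + 1 + 1) (by omega) (by omega),
        cableGen_left, cableGen_right, cableGen_right, cableGen_left,
        cableGen_lt f n (j := j + 1) (i := j) (by omega),
        cableGen_gt f n (j := j) (i := j + 1 + 1) (by omega), e, ← mul_assoc, ← mul_assoc, this]
    · rcases Nat.lt_or_ge i (j + 3) with h'' | h''
      · obtain rfl : i = j + 1 + 1 := by omega
        have := desc_desc hf j n hb
        rw [swapPos_right, swapPos_right, swapPos_of_ne (j := j) (i := j + 1 + 1) (by omega)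
          (by omega), swapPos_right, cableGen_right, cableGen_right,
          cableGen_gt f n (j := j) (i := j + 1 + 1) (by omega),
          cableGen_lt f n (j := j + 1) (i := j) (by omega), e, ← mul_assoc, ← mul_assoc, this]
      · rw [swapPos_of_ne (j := j) (i := i) (by omega) (by omega),
          swapPos_of_ne (j := j + 1) (i := i) (by omega) (by omega),
          swapPos_of_ne (j := j) (i := i) (by omega) (by omega),
          cableGen_gt f n (j := j) (i := i) (by omega),
          cableGen_gt f n (j := j + 1) (i := i) (by omega)]
        have := hf.braid j (by omega)
        simpa only [mul_assoc] using this

theorem cableGen_far {f : ℕ → G} {m n N : ℕ} (hf : IsBraidSeq N f) (hN : m + n = N + 1)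
    (j l i : ℕ) (hjl : j + 1 < l) (hl : l + 1 < m) (hi : i < m) :
    cableGen f n j (swapPos l i) * cableGen f n l i =
      cableGen f n l (swapPos j i) * cableGen f n j i := by
  have key : cableGen f n j (swapPos l i) = cableGen f n j i := by
    unfold swapPos cableGen; split_ifs <;> first | rfl | omega
  have key' : cableGen f n l (swapPos j i) = cableGen f n l i := by
    unfold swapPos cableGen; split_ifs <;> first | rfl | omega
  rw [key, key']
  simp only [cableGen]
  split_ifs <;> first
    | omega
    | exact hf.far _ _ (by omega) (by omega)
    | exact (commute_ascProd hf j n _ (Or.inr ⟨by omega, by omega⟩)).symm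
    | exact (commute_descProd hf j n _ (Or.inr ⟨by omega, by omega⟩)).symm
    | exact commute_ascProd hf l n _ (Or.inl ⟨by omega, by omega⟩)
    | exact commute_descProd hf l n _ (Or.inl ⟨by omega, by omega⟩)

/-- The action of the generator `σ_j` of `B_m` on pairs consisting of a position of the strand to
be cabled and an element of `G`. -/
def cablePerm (f : ℕ → G) (m n j : ℕ) : Equiv.Perm (Fin m × G) :=
  if h : j + 1 < m then
    { toFun := fun p => (⟨swapPos j p.1, swapPos_lt h p.1.2⟩, cableGen f n j p.1 * p.2)
      invFun := fun p => (⟨swapPos j p.1, swapPos_lt h p.1.2⟩,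
        (cableGen f n j (swapPos j p.1))⁻¹ * p.2)
      left_inv := fun p => by ext <;> simp [swapPos_swapPos]
      right_inv := fun p => by ext <;> simp [swapPos_swapPos] }
  else 1

theorem cablePerm_apply (f : ℕ → G) {m : ℕ} (n : ℕ) {j : ℕ} (h : j + 1 < m) (p : Fin m × G) :
    cablePerm f m n j p =
      (⟨swapPos j p.1, swapPos_lt h p.1.2⟩, cableGen f n j p.1 * p.2) := by
  rw [cablePerm, dif_pos h]; rfl

theorem isBraidSeq_cablePerm {f : ℕ → G} {m n N : ℕ} (hf : IsBraidSeq N f)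
    (hN : m + n = N + 1) : IsBraidSeq m (cablePerm f m n) where
  braid j hj := by
    have h1 : j + 1 < m := by omega
    have h2 : j + 1 + 1 < m := by omega
    refine Equiv.ext fun ⟨i, g⟩ => ?_
    simp only [Equiv.Perm.mul_apply, cablePerm_apply f n h1, cablePerm_apply f n h2]
    refine Prod.ext (Fin.ext ?_) ?_
    · simp only [swapPos]
      split_ifs <;> omega
    · have := cableGen_braid hf hN j i hj i.2
      simp only [← mul_assoc] at this ⊢
      rw [this]
  far j l hjl hl := by
    have h1 : j + 1 < m := by omega
    refine Equiv.ext fun ⟨i, g⟩ => ?_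
    simp only [Equiv.Perm.mul_apply, cablePerm_apply f n h1, cablePerm_apply f n hl]
    refine Prod.ext (Fin.ext ?_) ?_
    · simp only [swapPos]
      split_ifs <;> omega
    · have := cableGen_far hf hN j l i hjl hl i.2
      simp only [← mul_assoc]
      rw [this]

/-- The action of `B_m` on pairs of a position of a strand and an element of `G`: if `G = B_N` with
`N = m + n - 1`, then `γ` sends `(i, g)` to `(γ(i), γ_i g)`, where `γ(i)` is the position in which
the strand of `γ` starting at `i` ends, and `γ_i` is obtained from `γ` by replacing that strand by
`n` parallel ones. -/
def cableHom (f : ℕ → G) (m n N : ℕ) (hf : IsBraidSeq N f) (hN : m + n = N + 1) :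
    Braid m →* Equiv.Perm (Fin m × G) :=
  Braid.lift (cablePerm f m n) (isBraidSeq_cablePerm hf hN)

theorem isBraidSeq_shift {f : ℕ → G} {a n N : ℕ} (hf : IsBraidSeq N f) (h : a + n ≤ N) :
    IsBraidSeq n (fun t => f (a + t)) where
  braid i hi := hf.braid (a + i) (by omega)
  far i j hij hj := hf.far _ _ (by omega) (by omega)

/-- The homomorphism placing a braid on `n` strands on the strands in positions
`a, …, a + n - 1`. -/
def shiftHom (f : ℕ → G) (a n N : ℕ) (hf : IsBraidSeq N f) (h : a + n ≤ N) : Braid n →* G :=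
  Braid.lift (fun t => f (a + t)) (isBraidSeq_shift hf h)

end Cabling

section Completion

variable (k : Type*) [Field k]

/-- The finite index normal subgroups of `B_n`, i.e. the kernels of its finite quotients. -/
structure Level (n : ℕ) where
  /-- The subgroup. -/
  N : Subgroup (Braid n)
  normal : N.Normal
  finiteIndex : N.FiniteIndex

attribute [instance] Level.normal Level.finiteIndex

/-- The group algebra of the finite quotient `B_n / N`. -/
abbrev LevelAlg {n : ℕ} (N : Level n) : Type _ := MonoidAlgebra k (Braid n ⧸ N.N)

/-- The projection `k[B_n / N] → k[B_n / N']` for `N ≤ N'`. -/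
noncomputable def transition {n : ℕ} {N N' : Level n} (h : N.N ≤ N'.N) :
    LevelAlg k N →ₐ[k] LevelAlg k N' :=
  MonoidAlgebra.mapDomainAlgHom k k (QuotientGroup.map N.N N'.N (MonoidHom.id _) h)

/-- The projection `k[B_n] → k[B_n / N]`. -/
noncomputable def toLevel {n : ℕ} (N : Level n) :
    MonoidAlgebra k (Braid n) →ₐ[k] LevelAlg k N :=
  MonoidAlgebra.mapDomainAlgHom k k (QuotientGroup.mk' N.N)

theorem transition_toLevel {n : ℕ} {N N' : Level n} (h : N.N ≤ N'.N)
    (x : MonoidAlgebra k (Braid n)) : transition k h (toLevel k N x) = toLevel k N' x := by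
  have : (transition k h).comp (toLevel k N) = toLevel k N' := by
    rw [transition, toLevel, toLevel, ← MonoidAlgebra.mapDomainAlgHom_comp]
    rfl
  exact congrArg (fun φ => φ x) this

/-- The `n`-ary operations of the profinite braided associative operad: the inverse limit of the
group algebras `k[Q]` over the finite quotients `Q` of `B_n`. It is a strict inverse system; a
morphism from the corresponding pro-object to a vector space is a linear map on the limit which
factors through some level. -/
noncomputable def BrAssHat (n : ℕ) : Subalgebra k (∀ N : Level n, LevelAlg k N) where
  carrier := {x | ∀ (N N' : Level n) (h : N.N ≤ N'.N), transition k h (x N) = x N'}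
  mul_mem' := fun hx hy N N' h => by
    simp only [Pi.mul_apply, map_mul, hx N N' h, hy N N' h]
  add_mem' := fun hx hy N N' h => by
    simp only [Pi.add_apply, map_add, hx N N' h, hy N N' h]
  algebraMap_mem' := fun r N N' h => by
    simp only [Pi.algebraMap_apply, AlgHom.commutes]

/-- The image in the completion of an element of `k[B_n]`. -/
noncomputable def toHat (n : ℕ) (x : MonoidAlgebra k (Braid n)) : BrAssHat k n :=
  ⟨fun N => toLevel k N x, fun _ _ h => transition_toLevel k h x⟩

/-- The Woronowicz ideal: `𝔚(n)` is the kernel of left multiplication by the quantum symmetrizer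
on the profinite braided associative operad. -/
noncomputable def Wor (n : ℕ) : Submodule k (BrAssHat k n) :=
  LinearMap.ker (LinearMap.mulLeft k (toHat k n (quantumSymmetrizer k n)))

/-- The unital operad `𝔚_*`, with `𝔚_*(n) = 𝔚(n)` for `n ≠ 1` and `𝔚_*(1) = k`, which is all of
the operations of arity `1`, as `B_1` is trivial. -/
noncomputable def WorStar (n : ℕ) : Submodule k (BrAssHat k n) :=
  if n = 1 then ⊤ else Wor k n

theorem one_mem_WorStar : (1 : BrAssHat k 1) ∈ WorStar k 1 := by
  simp [WorStar]

section Composition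

variable {a b n : ℕ} (R : Level (a + n + b))

theorem isBraidSeq_level {N : ℕ} (R : Level N) :
    IsBraidSeq N (fun i => (QuotientGroup.mk' R.N (Braid.s N i))) :=
  (Braid.isBraidSeq_s N).map _

/-- Cabling on the strand with `a` strands to its left, with values in a finite quotient. -/
def cableLevelHom :
    Braid (a + 1 + b) →* Equiv.Perm (Fin (a + 1 + b) × (Braid (a + n + b) ⧸ R.N)) :=
  cableHom _ (a + 1 + b) n (a + n + b) (isBraidSeq_level R) (by omega)

/-- Insertion of a braid on the strands in positions `a, …, a + n - 1`, with values in a finite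
quotient. -/
def shiftLevelHom : Braid n →* (Braid (a + n + b) ⧸ R.N) :=
  shiftHom _ a n (a + n + b) (isBraidSeq_level R) (by omega)

instance finite_level {N : ℕ} (R : Level N) : Finite (Braid N ⧸ R.N) :=
  inferInstance

/-- A level of `B_{a+1+b}` on which cabling is well defined modulo `R`. -/
def outerLevel : Level (a + 1 + b) where
  N := (cableLevelHom R).ker
  normal := inferInstance
  finiteIndex := inferInstance

/-- A level of `B_n` on which insertion is well defined modulo `R`. -/
def innerLevel : Level n where
  N := (shiftLevelHom R).ker
  normal := inferInstance
  finiteIndex := inferInstance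

/-- The composition `γ ∘_{a+1} ρ` of braids, where `γ` has `a + 1 + b` strands and `ρ` has `n`
strands, between finite quotients: the strand of `γ` starting in position `a` is replaced by `n`
parallel strands, and `ρ` is inserted at the start. -/
noncomputable def cableLevel (p : Braid (a + 1 + b) ⧸ (outerLevel R).N)
    (q : Braid n ⧸ (innerLevel R).N) : Braid (a + n + b) ⧸ R.N :=
  ((QuotientGroup.kerLift (cableLevelHom R) p) (⟨a, by omega⟩, 1)).2 *
    QuotientGroup.kerLift (shiftLevelHom R) q

/-- The bilinear extension of the composition of braids to group algebras of finite quotients. -/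
noncomputable def compLevel (x : LevelAlg k (outerLevel R)) (y : LevelAlg k (innerLevel R)) :
    LevelAlg k R :=
  x.coeff.sum fun p r => y.coeff.sum fun q t =>
    (r * t) • MonoidAlgebra.of k (Braid (a + n + b) ⧸ R.N) (cableLevel R p q)

end Composition

variable {k} in
/-- `z` is the operadic composition `x ∘_{a+1} y`. -/
def IsComp {a b n : ℕ} (x : BrAssHat k (a + 1 + b)) (y : BrAssHat k n)
    (z : BrAssHat k (a + n + b)) : Prop :=
  ∀ R : Level (a + n + b),
    z.1 R = compLevel k R (x.1 (outerLevel R)) (y.1 (innerLevel R))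

end Completion

open MonObj ComonObj

section Powers

variable {C : Type u} [Category.{v} C] [MonoidalCategory C]

/-- The tensor power `X^{⊗ n}`, bracketed to the left, starting with the unit object. -/
@[reducible] def tpow (X : C) : ℕ → C
  | 0 => 𝟙_ C
  | n + 1 => tpow X n ⊗ X

/-- The tensor power of a morphism. -/
def tpowMap {X Y : C} (f : X ⟶ Y) : ∀ n, tpow X n ⟶ tpow Y n
  | 0 => 𝟙 (𝟙_ C)
  | n + 1 => tpowMap f n ⊗ₘ f

theorem tpowMap_id (X : C) : ∀ n, tpowMap (𝟙 X) n = 𝟙 (tpow X n)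
  | 0 => rfl
  | n + 1 => by
    rw [tpowMap, tpowMap_id X n]
    exact id_tensorHom_id _ _

theorem tpowMap_comp {X Y Z : C} (f : X ⟶ Y) (g : Y ⟶ Z) :
    ∀ n, tpowMap (f ≫ g) n = tpowMap f n ≫ tpowMap g n
  | 0 => (Category.id_comp _).symm
  | n + 1 => by
    rw [tpowMap, tpowMap_comp f g n]
    exact (tensorHom_comp_tensorHom _ _ _ _).symm

/-- Concatenation `X^{⊗ a} ⊗ X^{⊗ n} ≅ X^{⊗ (a + n)}`. -/
def catIso (X : C) (a : ℕ) : ∀ n, tpow X a ⊗ tpow X n ≅ tpow X (a + n)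
  | 0 => ρ_ (tpow X a)
  | n + 1 => (α_ (tpow X a) (tpow X n) X).symm ≪≫ whiskerRightIso (catIso X a n) X

/-- Apply an `n`-ary operation `g` to the factors in positions `a, …, a + n - 1`. -/
def insertAt {X : C} (a : ℕ) {n : ℕ} (g : tpow X n ⟶ X) :
    ∀ b, tpow X (a + n + b) ⟶ tpow X (a + 1 + b)
  | 0 => (catIso X a n).inv ≫ tpow X a ◁ g
  | b + 1 => insertAt a g b ▷ X

/-- The iterated multiplication of a monoid. -/
def mulN (A : C) [MonObj A] : ∀ n, tpow A n ⟶ A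
  | 0 => η
  | n + 1 => mulN A n ▷ A ≫ μ

theorem mulN_naturality {A B : C} [MonObj A] [MonObj B] (f : A ⟶ B) [IsMonHom f] :
    ∀ n, mulN A n ≫ f = tpowMap f n ≫ mulN B n
  | 0 => by
    rw [mulN, tpowMap, mulN, IsMonHom.one_hom]
    exact (Category.id_comp _).symm
  | n + 1 => by
    rw [mulN, tpowMap, mulN, Category.assoc, IsMonHom.mul_hom, ← tensorHom_id,
      ← Category.assoc, tensorHom_comp_tensorHom, mulN_naturality f n, ← tensorHom_id,
      ← Category.assoc]
    erw [tensorHom_comp_tensorHom]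
    simp

theorem inv_aux {X Y : C} {a : X ≅ X} {b : Y ≅ Y} {f : X ⟶ Y} (h : a.hom ≫ f = f ≫ b.hom) :
    a.inv ≫ f = f ≫ b.inv := by
  rw [Iso.inv_comp_eq, ← Category.assoc, h, Category.assoc, Iso.hom_inv_id, Category.comp_id]

theorem far_aux {P X : C} (g : P ⟶ P) (h : X ⊗ X ⟶ X ⊗ X) :
    ((α_ P X X).hom ≫ P ◁ h ≫ (α_ P X X).inv) ≫ g ▷ X ▷ X =
      g ▷ X ▷ X ≫ (α_ P X X).hom ≫ P ◁ h ≫ (α_ P X X).inv := by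
  rw [Category.assoc, Category.assoc, ← associator_inv_naturality_left,
    whisker_exchange_assoc, associator_naturality_left_assoc]

end Powers

section BraidAction

variable {C : Type u} [Category.{v} C] [MonoidalCategory C] [BraidedCategory C]

/-- The braiding of the factors of `X^{⊗ n}` in positions `i` and `i + 1`. -/
def braidGen (X : C) : ∀ n, ℕ → (tpow X n ≅ tpow X n)
  | 0, _ => Iso.refl _
  | 1, _ => Iso.refl _
  | n + 2, i =>
    if i = n then
      α_ (tpow X n) X X ≪≫ whiskerLeftIso (tpow X n) (β_ X X) ≪≫ (α_ (tpow X n) X X).symm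
    else whiskerRightIso (braidGen X (n + 1) i) X

theorem braidGen_last (X : C) (n : ℕ) : (braidGen X (n + 2) n).hom =
    (α_ (tpow X n) X X).hom ≫ tpow X n ◁ (β_ X X).hom ≫ (α_ (tpow X n) X X).inv := by
  simp [braidGen, tpow]

theorem braidGen_ne (X : C) (n i : ℕ) (h : i ≠ n) : (braidGen X (n + 2) i).hom =
    (braidGen X (n + 1) i).hom ▷ X := by
  rw [braidGen, if_neg h, whiskerRightIso_hom]

theorem braidGen_naturality {X Y : C} (f : X ⟶ Y) :
    ∀ n i, (braidGen X n i).hom ≫ tpowMap f n = tpowMap f n ≫ (braidGen Y n i).hom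
  | 0, _ => (Category.id_comp _).trans (Category.comp_id _).symm
  | 1, _ => (Category.id_comp _).trans (Category.comp_id _).symm
  | n + 2, i => by
    by_cases h : i = n
    · subst h
      rw [braidGen_last, braidGen_last]
      simp only [tpowMap]
      have := BraidedCategory.braiding_naturality f f
      rw [Category.assoc, Category.assoc, ← associator_inv_naturality,
        associator_naturality_assoc, ← id_tensorHom, ← id_tensorHom,
        tensorHom_comp_tensorHom_assoc, tensorHom_comp_tensorHom_assoc, ← this,
        Category.id_comp, Category.comp_id]
    · rw [braidGen_ne _ _ _ h, braidGen_ne _ _ _ h]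
      have ih := braidGen_naturality f (n + 1) i
      change _ ▷ X ≫ (tpowMap f (n + 1) ⊗ₘ f) = (tpowMap f (n + 1) ⊗ₘ f) ≫ _ ▷ Y
      rw [← tensorHom_id, ← tensorHom_id, tensorHom_comp_tensorHom, tensorHom_comp_tensorHom, ih]
      simp

theorem braid_aux (X P : C) :
    (((α_ P X X).hom ≫ P ◁ (β_ X X).hom ≫ (α_ P X X).inv) ▷ X) ≫
      ((α_ (P ⊗ X) X X).hom ≫ (P ⊗ X) ◁ (β_ X X).hom ≫ (α_ (P ⊗ X) X X).inv) ≫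
      (((α_ P X X).hom ≫ P ◁ (β_ X X).hom ≫ (α_ P X X).inv) ▷ X) =
    ((α_ (P ⊗ X) X X).hom ≫ (P ⊗ X) ◁ (β_ X X).hom ≫ (α_ (P ⊗ X) X X).inv) ≫
      (((α_ P X X).hom ≫ P ◁ (β_ X X).hom ≫ (α_ P X X).inv) ▷ X) ≫
      ((α_ (P ⊗ X) X X).hom ≫ (P ⊗ X) ◁ (β_ X X).hom ≫ (α_ (P ⊗ X) X X).inv) := by
  have h := BraidedCategory.yang_baxter' X X X
  have h' := congrArg (fun t => (α_ (P ⊗ X) X X).hom ≫ (α_ P X (X ⊗ X)).hom ≫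
    P ◁ (α_ X X X).inv ≫ (P ◁ t) ≫ P ◁ (α_ X X X).hom ≫ (α_ P X (X ⊗ X)).inv ≫
      (α_ (P ⊗ X) X X).inv) h
  convert! h' using 1
  · monoidal
  · monoidal

theorem isBraidSeq_braidGen (X : C) :
    ∀ n, IsBraidSeq (G := Aut (tpow X n)) n (braidGen X n)
  | 0 => ⟨fun i h => by omega, fun i j h h' => by omega⟩
  | 1 => ⟨fun i h => by omega, fun i j h h' => by omega⟩
  | n + 2 => by
    have ih := isBraidSeq_braidGen X (n + 1)
    constructor
    · intro i hi
      refine Iso.ext ?_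
      change (braidGen X (n + 2) i).hom ≫ (braidGen X (n + 2) (i + 1)).hom ≫
          (braidGen X (n + 2) i).hom =
        (braidGen X (n + 2) (i + 1)).hom ≫ (braidGen X (n + 2) i).hom ≫
          (braidGen X (n + 2) (i + 1)).hom
      by_cases h : i + 1 = n
      · subst h
        rw [braidGen_last, braidGen_ne _ _ _ (by omega), braidGen_last]
        exact braid_aux X _
      · have : (braidGen X (n + 1) i).hom ≫ (braidGen X (n + 1) (i + 1)).hom ≫
          (braidGen X (n + 1) i).hom = (braidGen X (n + 1) (i + 1)).hom ≫
          (braidGen X (n + 1) i).hom ≫ (braidGen X (n + 1) (i + 1)).hom :=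
          congrArg Iso.hom (ih.braid i (by omega))
        rw [braidGen_ne _ _ _ (by omega), braidGen_ne _ _ _ h]
        simp only [← comp_whiskerRight, this]
    · intro i j h h'
      refine Iso.ext ?_
      change (braidGen X (n + 2) j).hom ≫ (braidGen X (n + 2) i).hom =
        (braidGen X (n + 2) i).hom ≫ (braidGen X (n + 2) j).hom
      by_cases hj : j = n
      · subst hj
        obtain ⟨m, rfl⟩ : ∃ m, j = m + 1 := ⟨j - 1, by omega⟩
        rw [braidGen_last, braidGen_ne _ _ _ (by omega), braidGen_ne _ _ _ (by omega)]
        exact far_aux _ _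
      · have : (braidGen X (n + 1) j).hom ≫ (braidGen X (n + 1) i).hom =
          (braidGen X (n + 1) i).hom ≫ (braidGen X (n + 1) j).hom :=
          congrArg Iso.hom (ih.far i j h (by omega))
        rw [braidGen_ne _ _ _ hj, braidGen_ne _ _ _ (by omega)]
        simp only [← comp_whiskerRight, this]

/-- The action of the braid group `B_n` on `X^{⊗ n}`. -/
def braidAct (X : C) (n : ℕ) : Braid n →* Aut (tpow X n) :=
  Braid.lift (G := Aut (tpow X n)) (braidGen X n) (isBraidSeq_braidGen X n)

theorem braidAct_naturality {X Y : C} (f : X ⟶ Y) (n : ℕ) (g : Braid n) :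
    (braidAct X n g).hom ≫ tpowMap f n = tpowMap f n ≫ (braidAct Y n g).hom := by
  induction g using PresentedGroup.induction_on with | _ z => ?_
  have hgen : ∀ i : Fin (n - 1), ∀ Z : C,
      braidAct Z n (PresentedGroup.mk (braidRels n) (.of i)) = braidGen Z n i := fun i Z => by
    have h : PresentedGroup.mk (braidRels n) (.of i) = Braid.s n i := by
      simp [Braid.s, PresentedGroup.of]
    rw [h]
    exact Braid.lift_s (G := Aut (tpow Z n)) _ _ _ (by omega)
  induction z using FreeGroup.induction_on with
  | C1 =>
    rw [map_one, map_one, map_one]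
    exact (Category.id_comp _).trans (Category.comp_id _).symm
  | of i => rw [hgen, hgen, braidGen_naturality]
  | inv_of i h =>
    rw [map_inv, map_inv, map_inv]
    change (braidAct X n (PresentedGroup.mk (braidRels n) (.of i))).inv ≫ _ =
      _ ≫ (braidAct Y n (PresentedGroup.mk (braidRels n) (.of i))).inv
    exact inv_aux h
  | mul x y hx hy =>
    rw [map_mul, map_mul, map_mul]
    change ((braidAct X n _).hom ≫ (braidAct X n _).hom) ≫ _ =
      _ ≫ ((braidAct Y n _).hom ≫ (braidAct Y n _).hom)
    rw [Category.assoc, hx, ← Category.assoc, hy, Category.assoc]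

/-- `X` is finitely braided if every action of `B_n` on `X^{⊗ n}` factors through a finite
quotient. -/
def FinitelyBraided (X : C) : Prop :=
  ∀ n, (braidAct X n).ker.FiniteIndex

end BraidAction

section HatAct

variable (k : Type w) [Field k] {C : Type u} [Category.{v} C] [Preadditive C] [Linear k C]
  [MonoidalCategory C] [BraidedCategory C]

/-- The kernel of the action of `B_n` on `X^{⊗ n}`, for a finitely braided `X`. -/
def kerLevel {X : C} {n : ℕ} (h : (braidAct X n).ker.FiniteIndex) : Level n where
  N := (braidAct X n).ker
  normal := inferInstance
  finiteIndex := h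

/-- The action of the group algebra of a quotient of `B_n` through which `B_n` acts. -/
noncomputable def levelAct (X : C) {n : ℕ} (N : Level n) (h : N.N ≤ (braidAct X n).ker) :
    LevelAlg k N →ₐ[k] End (tpow X n) :=
  MonoidAlgebra.lift k (End (tpow X n)) (Braid n ⧸ N.N)
    ((Aut.toEnd (tpow X n)).comp (QuotientGroup.lift N.N (braidAct X n) h))

open Classical in
/-- The action of the profinite completion of `k[B_n]` on `X^{⊗ n}`, for a finitely braided `X`
(and zero otherwise). -/
noncomputable def hatAct (X : C) (n : ℕ) : BrAssHat k n →ₗ[k] (tpow X n ⟶ tpow X n) :=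
  if h : (braidAct X n).ker.FiniteIndex then
    ((levelAct k X (kerLevel h) (le_refl (braidAct X n).ker)).toLinearMap.comp
      (LinearMap.proj (kerLevel h))).comp (BrAssHat k n).val.toLinearMap
  else 0

variable {k}

theorem levelAct_of (X : C) {n : ℕ} (N : Level n) (h : N.N ≤ (braidAct X n).ker) (g : Braid n) :
    levelAct k X N h (MonoidAlgebra.of k _ (QuotientGroup.mk' N.N g)) = (braidAct X n g).hom := by
  simp [levelAct]
  rfl

theorem levelAct_transition (X : C) {n : ℕ} {N N' : Level n} (h : N'.N ≤ (braidAct X n).ker)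
    (hN : N.N ≤ N'.N) (x : LevelAlg k N) :
    levelAct k X N' h (transition k hN x) = levelAct k X N (hN.trans h) x := by
  have : (levelAct k X N' h).comp (transition k hN) = levelAct k X N (hN.trans h) := by
    refine MonoidAlgebra.algHom_ext (fun g => ?_) (Subsingleton.elim _ _)
    obtain ⟨g, rfl⟩ := QuotientGroup.mk'_surjective N.N g
    have h1 := levelAct_of (k := k) X N (hN.trans h) g
    have h2 := levelAct_of (k := k) X N' h g
    rw [MonoidAlgebra.of_apply] at h1 h2
    rw [h1, ← h2]
    simp [transition]
    rfl
  exact congrArg (fun φ => φ x) this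

theorem hatAct_eq (X : C) {n : ℕ} (N : Level n) (h : N.N ≤ (braidAct X n).ker)
    (x : BrAssHat k n) : hatAct k X n x = levelAct k X N h (x.1 N) := by
  have hfin : (braidAct X n).ker.FiniteIndex := Subgroup.finiteIndex_of_le h
  rw [hatAct, dif_pos hfin]
  change levelAct k X (kerLevel hfin) (le_refl (braidAct X n).ker) (x.1 (kerLevel hfin)) = _
  rw [← x.2 N (kerLevel hfin) h]
  exact levelAct_transition X _ _ _

theorem hatAct_naturality {X Y : C} (hX : FinitelyBraided X) (hY : FinitelyBraided Y)
    (f : X ⟶ Y) (n : ℕ) (x : BrAssHat k n) :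
    hatAct k X n x ≫ tpowMap f n = tpowMap f n ≫ hatAct k Y n x := by
  have := hX n
  have := hY n
  let N : Level n :=
    { N := (braidAct X n).ker ⊓ (braidAct Y n).ker
      normal := inferInstance
      finiteIndex := inferInstance }
  rw [hatAct_eq X N inf_le_left, hatAct_eq Y N inf_le_right]
  induction x.1 N using MonoidAlgebra.induction_on with
  | of g =>
    obtain ⟨g, rfl⟩ := QuotientGroup.mk'_surjective N.N g
    rw [levelAct_of, levelAct_of, braidAct_naturality]
  | add a b ha hb => rw [map_add, map_add, Preadditive.add_comp, Preadditive.comp_add, ha, hb]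
  | smul r a ha => rw [map_smul, map_smul, Linear.smul_comp, Linear.comp_smul, ha]

end HatAct

section Preservation

variable {C : Type u} [Category.{v} C] [MonoidalCategory C] [BraidedCategory C]

instance tensorRight_preservesColimitsOfShape {J : Type*} [Category J] (X : C)
    [PreservesColimitsOfShape J (tensorLeft X)] :
    PreservesColimitsOfShape J (tensorRight X) :=
  preservesColimitsOfShape_of_natIso (BraidedCategory.tensorLeftIsoTensorRight X)

instance tensorRight_preservesFiniteColimits (X : C) [PreservesFiniteColimits (tensorLeft X)] :
    PreservesFiniteColimits (tensorRight X) :=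
  preservesFiniteColimits_of_natIso (BraidedCategory.tensorLeftIsoTensorRight X)

instance tensorRight_preservesFiniteLimits (X : C) [PreservesFiniteLimits (tensorLeft X)] :
    PreservesFiniteLimits (tensorRight X) :=
  preservesFiniteLimits_of_natIso (BraidedCategory.tensorLeftIsoTensorRight X)

instance epi_whiskerLeft (X : C) {Y Z : C} (f : Y ⟶ Z) [Epi f]
    [PreservesFiniteColimits (tensorLeft X)] : Epi (X ◁ f) :=
  inferInstanceAs (Epi ((tensorLeft X).map f))

instance epi_whiskerRight (X : C) {Y Z : C} (f : Y ⟶ Z) [Epi f]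
    [PreservesFiniteColimits (tensorLeft X)] : Epi (f ▷ X) :=
  inferInstanceAs (Epi ((tensorRight X).map f))

instance epi_tensorHom [∀ X : C, PreservesFiniteColimits (tensorLeft X)] {X Y X' Y' : C}
    (f : X ⟶ Y) (g : X' ⟶ Y') [Epi f] [Epi g] : Epi (f ⊗ₘ g) := by
  rw [MonoidalCategory.tensorHom_def]
  infer_instance

instance mono_whiskerLeft (X : C) {Y Z : C} (f : Y ⟶ Z) [Mono f]
    [PreservesFiniteLimits (tensorLeft X)] : Mono (X ◁ f) :=
  inferInstanceAs (Mono ((tensorLeft X).map f))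

instance mono_whiskerRight (X : C) {Y Z : C} (f : Y ⟶ Z) [Mono f]
    [PreservesFiniteLimits (tensorLeft X)] : Mono (f ▷ X) :=
  inferInstanceAs (Mono ((tensorRight X).map f))

theorem mono_tpowMap [∀ X : C, PreservesFiniteLimits (tensorLeft X)] {X Y : C} (f : X ⟶ Y)
    [Mono f] : ∀ n, Mono (tpowMap f n)
  | 0 => inferInstanceAs (Mono (𝟙 _))
  | n + 1 => by
    have := mono_tpowMap f n
    rw [tpowMap, MonoidalCategory.tensorHom_def]
    infer_instance

/-- A subobject of a finitely braided object is finitely braided. -/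
theorem FinitelyBraided.of_mono [∀ X : C, PreservesFiniteLimits (tensorLeft X)] {X Y : C}
    (hY : FinitelyBraided Y) (f : X ⟶ Y) [Mono f] : FinitelyBraided X := fun n => by
  have := hY n
  have := mono_tpowMap f n
  refine Subgroup.finiteIndex_of_le (H := (braidAct Y n).ker) fun g hg => ?_
  rw [MonoidHom.mem_ker] at hg ⊢
  have h := braidAct_naturality f n g
  rw [hg] at h
  refine Iso.ext ((cancel_mono (tpowMap f n)).1 ?_)
  rw [h]
  exact (Category.comp_id _).trans (Category.id_comp _).symm

end Preservation

/-! ### Quotients of monoids by two-sided ideals -/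

section Quotient

variable {C : Type u} [Category.{v} C] [Abelian C] [MonoidalCategory C] [MonoidalPreadditive C]
  [BraidedCategory C] [∀ X : C, PreservesFiniteColimits (tensorLeft X)]

/-- The map `T ⊗ G ⊗ T ⟶ T` whose image is the two-sided ideal generated by `R : G ⟶ T`. -/
def idealMap {T G : C} [MonObj T] (R : G ⟶ T) : (T ⊗ G) ⊗ T ⟶ T :=
  ((T ◁ R) ≫ μ) ▷ T ≫ μ

/-- The quotient of a monoid by the two-sided ideal generated by `R : G ⟶ T`. -/
noncomputable def quot {T G : C} [MonObj T] (R : G ⟶ T) : C := cokernel (idealMap R)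

namespace quot

variable {T G : C} [MonObj T] (R : G ⟶ T)

/-- The projection to the quotient. -/
noncomputable def π : T ⟶ quot R := cokernel.π (idealMap R)

instance π_epi : Epi (π R) := inferInstanceAs (Epi (cokernel.π (idealMap R)))

theorem ideal_π : idealMap R ≫ π R = 0 := cokernel.condition _

theorem rel_π : R ≫ π R = 0 := by
  have : R = ((ρ_ G).inv ≫ G ◁ η ≫ (λ_ G).inv ▷ T ≫ (η ▷ G) ▷ T) ≫ idealMap R := by
    have h : η ▷ G ≫ T ◁ R ≫ μ = (λ_ G).hom ≫ R := by
      rw [← whisker_exchange_assoc, MonObj.one_mul, leftUnitor_naturality]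
    rw [idealMap]
    simp only [Category.assoc, ← comp_whiskerRight_assoc]
    rw [h, Iso.inv_hom_id_assoc, whisker_exchange_assoc, MonObj.mul_one, rightUnitor_naturality,
      Iso.inv_hom_id_assoc]
  have h2 := congrArg (· ≫ π R) this
  simp only [Category.assoc] at h2
  rw [h2, ideal_π]
  simp

theorem left_ideal : T ◁ idealMap R ≫ μ ≫ π R = 0 := by
  have : T ◁ idealMap R ≫ μ =
      ((α_ T (T ⊗ G) T).inv ≫ ((α_ T T G).inv ≫ (μ ▷ G)) ▷ T) ≫ idealMap R := by
    simp [idealMap, MonObj.mul_assoc]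
    rw [associator_naturality_left_assoc, ← whisker_exchange_assoc, ← whisker_exchange_assoc,
      MonObj.mul_assoc]
    simp
  rw [← Category.assoc, this, Category.assoc, ideal_π, comp_zero]

theorem right_ideal : idealMap R ▷ T ≫ μ ≫ π R = 0 := by
  have : idealMap R ▷ T ≫ μ = ((α_ (T ⊗ G) T T).hom ≫ (T ⊗ G) ◁ μ) ≫ idealMap R := by
    rw [idealMap, comp_whiskerRight, Category.assoc, MonObj.mul_assoc, Category.assoc,
      whisker_exchange_assoc, associator_naturality_left_assoc]
  rw [← Category.assoc, this, Category.assoc, ideal_π, comp_zero]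

/-- The action of `T` on the quotient. -/
noncomputable def act : T ⊗ quot R ⟶ quot R :=
  (CokernelCofork.IsColimit.desc'
    (isColimitOfHasCokernelOfPreservesColimit (tensorLeft T) (idealMap R)) (μ ≫ π R)
    (left_ideal R)).1

theorem act_π : T ◁ π R ≫ act R = μ ≫ π R :=
  (CokernelCofork.IsColimit.desc'
    (isColimitOfHasCokernelOfPreservesColimit (tensorLeft T) (idealMap R)) (μ ≫ π R)
    (left_ideal R)).2

theorem ideal_act : idealMap R ▷ quot R ≫ act R = 0 := by
  rw [← cancel_epi (_ ◁ π R), comp_zero, whisker_exchange_assoc, act_π, right_ideal]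

/-- The multiplication of the quotient. -/
noncomputable def mul : quot R ⊗ quot R ⟶ quot R :=
  (CokernelCofork.IsColimit.desc'
    (isColimitOfHasCokernelOfPreservesColimit (tensorRight (quot R)) (idealMap R)) (act R)
    (ideal_act R)).1

theorem mul_act : π R ▷ quot R ≫ mul R = act R :=
  (CokernelCofork.IsColimit.desc'
    (isColimitOfHasCokernelOfPreservesColimit (tensorRight (quot R)) (idealMap R)) (act R)
    (ideal_act R)).2

theorem π_mul : (π R ⊗ₘ π R) ≫ mul R = μ ≫ π R := by
  rw [tensorHom_def', Category.assoc, mul_act, act_π]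

noncomputable instance instMonObj : MonObj (quot R) where
  one := η ≫ π R
  mul := mul R
  one_mul := by
    rw [← cancel_epi (𝟙_ C ◁ π R), comp_whiskerRight, Category.assoc, mul_act,
      whisker_exchange_assoc, act_π, ← Category.assoc, MonObj.one_mul, leftUnitor_naturality]
  mul_one := by
    rw [← cancel_epi (π R ▷ 𝟙_ C), ← whisker_exchange_assoc, mul_act, whiskerLeft_comp,
      Category.assoc, act_π, ← Category.assoc, MonObj.mul_one, rightUnitor_naturality]
  mul_assoc := by
    rw [← cancel_epi ((π R ⊗ₘ π R) ⊗ₘ π R)]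
    have h1 : ((π R ⊗ₘ π R) ⊗ₘ π R) ≫ mul R ▷ quot R ≫ mul R = μ ▷ T ≫ μ ≫ π R := by
      rw [← tensorHom_id, tensorHom_comp_tensorHom_assoc, π_mul, Category.comp_id,
        ← Category.id_comp (π R), ← tensorHom_comp_tensorHom, Category.id_comp, tensorHom_id,
        Category.assoc, π_mul]
    have h2 : (π R ⊗ₘ (π R ⊗ₘ π R)) ≫ quot R ◁ mul R ≫ mul R = T ◁ μ ≫ μ ≫ π R := by
      rw [← id_tensorHom, tensorHom_comp_tensorHom_assoc, π_mul, Category.comp_id,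
        ← Category.id_comp (π R), ← tensorHom_comp_tensorHom, Category.id_comp, id_tensorHom,
        Category.assoc, π_mul]
    rw [h1, associator_naturality_assoc, h2, MonObj.mul_assoc_assoc]

instance π_isMonHom : IsMonHom (π R) where
  one_hom := rfl
  mul_hom := (π_mul R).symm

variable {B : C} [MonObj B] (f : T ⟶ B) [IsMonHom f]

/-- The map from the quotient induced by a morphism of monoids. -/
noncomputable def desc (hf : R ≫ f = 0) : quot R ⟶ B :=
  cokernel.desc (idealMap R) f (by
    have h : (T ◁ R ≫ μ) ≫ f = 0 := by
      rw [Category.assoc, IsMonHom.mul_hom, MonoidalCategory.tensorHom_def', Category.assoc,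
        ← Category.assoc, ← whiskerLeft_comp, hf, MonoidalPreadditive.whiskerLeft_zero, zero_comp]
    rw [idealMap, Category.assoc, IsMonHom.mul_hom, MonoidalCategory.tensorHom_def,
      Category.assoc, ← Category.assoc, ← comp_whiskerRight, h,
      MonoidalPreadditive.zero_whiskerRight, zero_comp])

theorem π_desc (hf : R ≫ f = 0) : π R ≫ desc R f hf = f := cokernel.π_desc _ _ _

instance desc_isMonHom (hf : R ≫ f = 0) : IsMonHom (desc R f hf) where
  one_hom := by
    change (η ≫ π R) ≫ _ = _
    rw [Category.assoc, π_desc, IsMonHom.one_hom]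
  mul_hom := by
    change mul R ≫ _ = _
    rw [← cancel_epi (π R ⊗ₘ π R), ← Category.assoc, π_mul, Category.assoc, π_desc,
      tensorHom_comp_tensorHom_assoc, π_desc, IsMonHom.mul_hom]

end quot

end Quotient

/-! ### The tensor algebra -/

section CatIso

variable {C : Type u} [Category.{v} C] [MonoidalCategory C]

theorem eqToHom_succ (X : C) {m n : ℕ} (h : m = n) (h' : m + 1 = n + 1) :
    eqToHom (congrArg (tpow X) h') = eqToHom (congrArg (tpow X) h) ▷ X := by
  subst h
  rw [eqToHom_refl, eqToHom_refl]
  exact (id_whiskerRight _ _).symm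

theorem catIso_succ (X : C) (a n : ℕ) : (catIso X a (n + 1)).hom =
    (α_ (tpow X a) (tpow X n) X).inv ≫ (catIso X a n).hom ▷ X := rfl

theorem catIso_zero (X : C) (a : ℕ) : (catIso X a 0).hom = (ρ_ (tpow X a)).hom := rfl

theorem catIso_zero_left (X : C) : ∀ n, (catIso X 0 n).hom =
    (λ_ (tpow X n)).hom ≫ eqToHom (congrArg (tpow X) (Nat.zero_add n).symm)
  | 0 => by
    rw [eqToHom_refl, Category.comp_id]
    exact unitors_equal.symm
  | n + 1 => by
    rw [catIso_succ, catIso_zero_left X n, comp_whiskerRight,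
      eqToHom_succ X (Nat.zero_add n).symm (Nat.zero_add (n + 1)).symm]
    simp

theorem catIso_assoc (X : C) (a b : ℕ) : ∀ c,
    (catIso X a b).hom ▷ tpow X c ≫ (catIso X (a + b) c).hom =
      (α_ _ _ _).hom ≫ tpow X a ◁ (catIso X b c).hom ≫ (catIso X a (b + c)).hom ≫
        eqToHom (congrArg (tpow X) (Nat.add_assoc a b c).symm)
  | 0 => by
    rw [eqToHom_refl, Category.comp_id, catIso_zero, catIso_zero]
    simp
  | c + 1 => by
    have ih := catIso_assoc X a b c
    rw [eqToHom_succ X (Nat.add_assoc a b c).symm (Nat.add_assoc a b (c + 1)).symm]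
    change _ ▷ (_ ⊗ X) ≫ (α_ (tpow X (a + b)) (tpow X c) X).inv ≫ _ ▷ X = _ ≫
      _ ◁ ((α_ (tpow X b) (tpow X c) X).inv ≫ _ ▷ X) ≫
        ((α_ (tpow X a) (tpow X (b + c)) X).inv ≫ (catIso X a (b + c)).hom ▷ X) ≫ _
    have h2 := congrArg (fun t => (α_ _ _ X).inv ≫ t ▷ X) ih
    simp only [comp_whiskerRight] at h2
    rw [associator_inv_naturality_left_assoc, h2]
    simp

theorem catIso_tpowMap {X A : C} (f : X ⟶ A) (n : ℕ) : ∀ m, (catIso X n m).hom ≫ tpowMap f (n + m) =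
    (tpowMap f n ⊗ₘ tpowMap f m) ≫ (catIso A n m).hom
  | 0 => by
    change (ρ_ (tpow X n)).hom ≫ tpowMap f n = (tpowMap f n ⊗ₘ 𝟙 (𝟙_ C)) ≫ (ρ_ (tpow A n)).hom
    rw [tensorHom_id, rightUnitor_naturality]
  | m + 1 => by
    have ih := catIso_tpowMap f n m
    rw [catIso_succ, catIso_succ]
    change (_ ≫ _ ▷ X) ≫ (tpowMap f (n + m) ⊗ₘ f) = (_ ⊗ₘ (tpowMap f m ⊗ₘ f)) ≫ _
    rw [Category.assoc, ← tensorHom_id, tensorHom_comp_tensorHom, ih,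
      associator_inv_naturality_assoc, ← tensorHom_id, tensorHom_comp_tensorHom]
    simp

theorem mulN_catIso (A : C) [MonObj A] (a : ℕ) : ∀ n,
    (catIso A a n).hom ≫ mulN A (a + n) = (mulN A a ⊗ₘ mulN A n) ≫ μ
  | 0 => by
    change (ρ_ (tpow A a)).hom ≫ mulN A a = (mulN A a ⊗ₘ η) ≫ μ
    rw [MonoidalCategory.tensorHom_def, Category.assoc, MonObj.mul_one, rightUnitor_naturality]
  | n + 1 => by
    have ih := mulN_catIso A a n
    rw [catIso_succ]
    change (_ ≫ _ ▷ A) ≫ mulN A (a + n) ▷ A ≫ μ = (_ ⊗ₘ (mulN A n ▷ A ≫ μ)) ≫ μ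
    rw [Category.assoc, ← comp_whiskerRight_assoc, ih]
    simp [tensorHom_def', MonObj.mul_assoc]
    rw [← associator_inv_naturality_left_assoc, Iso.inv_hom_id_assoc, ← whisker_exchange_assoc]

end CatIso

section TensorAlgebra

variable {C : Type u} [Category.{v} C] [MonoidalCategory C] [BraidedCategory C]
  [HasColimitsOfSize.{w, w} C] [∀ X : C, PreservesColimitsOfSize.{w, w} (tensorLeft X)]

/-- The tensor algebra `⨁ X^{⊗ n}`. -/
noncomputable def tensorAlg (X : C) : C := ∐ fun n : ULift.{w} ℕ => tpow X n.down

namespace tensorAlg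

variable (X : C)

/-- The inclusion of a tensor power. -/
noncomputable def inc (n : ℕ) : tpow X n ⟶ tensorAlg.{w} X :=
  Sigma.ι (fun n : ULift.{w} ℕ => tpow X n.down) ⟨n⟩

variable {X} in
/-- A map out of the tensor algebra given by its restrictions to the tensor powers. -/
noncomputable def desc {Z : C} (f : ∀ n, tpow X n ⟶ Z) : tensorAlg.{w} X ⟶ Z :=
  Sigma.desc fun n => f n.down

variable {X} in
theorem inc_desc {Z : C} (f : ∀ n, tpow X n ⟶ Z) (n : ℕ) : inc.{w} X n ≫ desc f = f n :=
  Sigma.ι_desc _ _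

variable {X} in
theorem hom_ext {Z : C} {f g : tensorAlg.{w} X ⟶ Z} (h : ∀ n, inc X n ≫ f = inc X n ≫ g) :
    f = g :=
  Sigma.hom_ext _ _ fun n => h n.down

/-- `T(X) ⊗ Y` is the coproduct of the objects `X^{⊗ n} ⊗ Y`. -/
noncomputable def isColimitRight (Y : C) : IsColimit (Cofan.mk (tensorAlg.{w} X ⊗ Y)
    fun n : ULift.{w} ℕ => inc X n.down ▷ Y) :=
  isColimitCofanMkObjOfIsColimit (tensorRight Y) _ _
    (coproductIsCoproduct fun n : ULift.{w} ℕ => tpow X n.down)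

/-- `Y ⊗ T(X)` is the coproduct of the objects `Y ⊗ X^{⊗ n}`. -/
noncomputable def isColimitLeft (Y : C) : IsColimit (Cofan.mk (Y ⊗ tensorAlg.{w} X)
    fun n : ULift.{w} ℕ => Y ◁ inc X n.down) :=
  isColimitCofanMkObjOfIsColimit (tensorLeft Y) _ _
    (coproductIsCoproduct fun n : ULift.{w} ℕ => tpow X n.down)

variable {X} in
theorem hom_ext_right {Y Z : C} {f g : tensorAlg.{w} X ⊗ Y ⟶ Z}
    (h : ∀ n, inc X n ▷ Y ≫ f = inc X n ▷ Y ≫ g) : f = g :=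
  Cofan.IsColimit.hom_ext (isColimitRight X Y) _ _ fun n => h n.down

variable {X} in
theorem hom_ext_left {Y Z : C} {f g : Y ⊗ tensorAlg.{w} X ⟶ Z}
    (h : ∀ n, Y ◁ inc X n ≫ f = Y ◁ inc X n ≫ g) : f = g :=
  Cofan.IsColimit.hom_ext (isColimitLeft X Y) _ _ fun n => h n.down

variable {X} in
theorem hom_ext₂ {Z : C} {f g : tensorAlg.{w} X ⊗ tensorAlg.{w} X ⟶ Z}
    (h : ∀ n m, (inc X n ⊗ₘ inc X m) ≫ f = (inc X n ⊗ₘ inc X m) ≫ g) : f = g :=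
  hom_ext_left fun m => hom_ext_right fun n => by
    have := h n m
    rwa [MonoidalCategory.tensorHom_def, Category.assoc, Category.assoc] at this

variable {X} in
theorem hom_ext₃ {Z : C} {f g : (tensorAlg.{w} X ⊗ tensorAlg.{w} X) ⊗ tensorAlg.{w} X ⟶ Z}
    (h : ∀ n m p, ((inc X n ⊗ₘ inc X m) ⊗ₘ inc X p) ≫ f =
      ((inc X n ⊗ₘ inc X m) ⊗ₘ inc X p) ≫ g) : f = g :=
  hom_ext_left fun p =>
    Cofan.IsColimit.hom_ext (isColimitCofanMkObjOfIsColimit (tensorRight (tpow X p)) _ _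
      (isColimitRight X (tensorAlg.{w} X))) _ _ fun n =>
    Cofan.IsColimit.hom_ext (isColimitCofanMkObjOfIsColimit (tensorRight (tpow X p)) _ _
      (isColimitLeft X (tpow X n.down))) _ _ fun m => by
    have := h n.down m.down p
    rw [MonoidalCategory.tensorHom_def, MonoidalCategory.tensorHom_def',
      comp_whiskerRight] at this
    simp only [Category.assoc] at this
    exact this

/-- Multiplication by a tensor power from the right. -/
noncomputable def mulRight (m : ℕ) : tensorAlg.{w} X ⊗ tpow X m ⟶ tensorAlg.{w} X :=
  Cofan.IsColimit.desc (isColimitRight X (tpow X m)) fun n => (catIso X n.down m).hom ≫ inc X _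

theorem inc_mulRight (n m : ℕ) :
    inc.{w} X n ▷ tpow X m ≫ mulRight X m = (catIso X n m).hom ≫ inc X (n + m) :=
  Cofan.IsColimit.fac (isColimitRight X (tpow X m)) _ ⟨n⟩

/-- The multiplication of the tensor algebra, by concatenation. -/
noncomputable def mul : tensorAlg.{w} X ⊗ tensorAlg.{w} X ⟶ tensorAlg.{w} X :=
  Cofan.IsColimit.desc (isColimitLeft X (tensorAlg.{w} X)) fun m => mulRight X m.down

theorem inc_mul' (m : ℕ) : tensorAlg.{w} X ◁ inc.{w} X m ≫ mul X = mulRight X m :=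
  Cofan.IsColimit.fac (isColimitLeft X (tensorAlg.{w} X)) _ ⟨m⟩

theorem inc_mul (n m : ℕ) :
    (inc.{w} X n ⊗ₘ inc.{w} X m) ≫ mul X = (catIso X n m).hom ≫ inc X (n + m) := by
  rw [MonoidalCategory.tensorHom_def, Category.assoc, inc_mul', inc_mulRight]

theorem eqToHom_inc {m n : ℕ} (h : m = n) :
    eqToHom (congrArg (tpow X) h) ≫ inc.{w} X n = inc X m := by
  subst h
  exact Category.id_comp _

noncomputable instance instMonObj : MonObj (tensorAlg.{w} X) where
  one := inc X 0
  mul := mul X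
  one_mul := by
    refine hom_ext_left fun n => ?_
    have h := inc_mul.{w} X 0 n
    rw [catIso_zero_left, Category.assoc, eqToHom_inc X (Nat.zero_add n).symm, MonoidalCategory.tensorHom_def,
      Category.assoc] at h
    rw [whisker_exchange_assoc, h, leftUnitor_naturality]
  mul_one := by
    refine hom_ext_right fun n => ?_
    have h := inc_mul.{w} X n 0
    rw [catIso_zero, MonoidalCategory.tensorHom_def, Category.assoc] at h
    rw [rightUnitor_naturality]
    exact h
  mul_assoc := by
    refine hom_ext₃ fun a b c => ?_
    have h1 : ((inc X a ⊗ₘ inc X b) ⊗ₘ inc X c) ≫ mul X ▷ tensorAlg.{w} X ≫ mul X =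
        (catIso X a b).hom ▷ tpow X c ≫ (catIso X (a + b) c).hom ≫ inc X (a + b + c) := by
      rw [← tensorHom_id, tensorHom_comp_tensorHom_assoc, inc_mul, Category.comp_id,
        ← Category.id_comp (inc X c), ← tensorHom_comp_tensorHom, tensorHom_id,
        Category.assoc, inc_mul]
    have h2 : (inc X a ⊗ₘ (inc X b ⊗ₘ inc X c)) ≫ tensorAlg.{w} X ◁ mul X ≫ mul X =
        tpow X a ◁ (catIso X b c).hom ≫ (catIso X a (b + c)).hom ≫ inc X (a + (b + c)) := by
      rw [← id_tensorHom, tensorHom_comp_tensorHom_assoc, inc_mul, Category.comp_id,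
        ← Category.id_comp (inc X a), ← tensorHom_comp_tensorHom, id_tensorHom,
        Category.assoc, inc_mul]
    rw [h1, associator_naturality_assoc, h2, ← Category.assoc, catIso_assoc]
    simp only [Category.assoc]
    rw [eqToHom_inc X (Nat.add_assoc a b c).symm]

variable {X} {A : C} [MonObj A] (f : X ⟶ A)

/-- The morphism of monoids extending `f`. -/
noncomputable def lift : tensorAlg.{w} X ⟶ A := desc fun n => tpowMap f n ≫ mulN A n

theorem inc_lift (n : ℕ) : inc.{w} X n ≫ lift f = tpowMap f n ≫ mulN A n := inc_desc _ _

instance lift_isMonHom : IsMonHom (lift.{w} f) where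
  one_hom := by
    change inc X 0 ≫ _ = _
    rw [inc_lift]
    exact Category.id_comp _
  mul_hom := by
    refine hom_ext₂ fun n m => ?_
    change _ ≫ mul X ≫ _ = _
    rw [← Category.assoc, inc_mul, Category.assoc, inc_lift, ← Category.assoc,
      catIso_tpowMap, Category.assoc, mulN_catIso, tensorHom_comp_tensorHom_assoc,
      tensorHom_comp_tensorHom_assoc, inc_lift, inc_lift]

/-- The generators. -/
noncomputable def gen (X : C) : X ⟶ tensorAlg.{w} X := (λ_ X).inv ≫ inc X 1

theorem gen_lift : gen.{w} X ≫ lift f = f := by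
  rw [gen, Category.assoc, inc_lift, Iso.inv_comp_eq]
  change (𝟙 _ ⊗ₘ f) ≫ η ▷ A ≫ μ = _
  rw [MonObj.one_mul, id_tensorHom, leftUnitor_naturality]

theorem tpowMap_gen (X : C) : ∀ n, tpowMap (gen.{w} X) n ≫ mulN (tensorAlg.{w} X) n = inc X n
  | 0 => Category.id_comp _
  | n + 1 => by
    have ih := tpowMap_gen X n
    change (tpowMap (gen.{w} X) n ⊗ₘ gen X) ≫ mulN _ n ▷ _ ≫ μ = _
    rw [← tensorHom_id, tensorHom_comp_tensorHom_assoc, ih, Category.comp_id, gen]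
    have h := inc_mul.{w} X n 1
    have h3 : (inc X n ⊗ₘ (λ_ X).inv ≫ inc X 1) =
        tpow X n ◁ (λ_ X).inv ≫ (inc.{w} X n ⊗ₘ inc X 1) := by
      rw [← id_tensorHom, tensorHom_comp_tensorHom, Category.id_comp]
    rw [h3, Category.assoc]
    change _ ≫ _ ≫ mul X = _
    rw [h, catIso_succ, catIso_zero]
    simp

theorem monHom_ext {g h : tensorAlg.{w} X ⟶ A} [IsMonHom g] [IsMonHom h]
    (H : gen X ≫ g = gen X ≫ h) : g = h :=
  hom_ext fun n => by
    rw [← tpowMap_gen, Category.assoc, Category.assoc, mulN_naturality, mulN_naturality,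
      ← Category.assoc, ← Category.assoc, ← tpowMap_comp, ← tpowMap_comp, H]

end tensorAlg

end TensorAlgebra

/-! ### Algebras over the Woronowicz operad -/

section Algebras

variable (k : Type w) [Field k] {C : Type u} [Category.{v} C] [Preadditive C] [Linear k C]
  [MonoidalCategory C]

/-- Families of operations on `X` indexed by the operations of `𝔚_*`. -/
abbrev Ops (X : C) := ∀ n : ℕ, WorStar k n →ₗ[k] (tpow X n ⟶ X)

variable {k} in
/-- A subobject is closed under a family of operations. -/
def IsClosedUnder {X : C} (op : Ops k X) (S : Subobject X) :
    Prop :=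
  ∀ n (x : WorStar k n), S.Factors (tpowMap S.arrow n ≫ op n x)

variable {k} in
/-- The restriction of a family of operations to a closed subobject. -/
noncomputable def restrictOps {X : C} (op : Ops k X)
    (S : Subobject X) (h : IsClosedUnder op S) : Ops k (S : C) := fun n =>
  { toFun := fun x => S.factorThru _ (h n x)
    map_add' := fun x y => by
      rw [← cancel_mono S.arrow, Preadditive.add_comp]
      simp
    map_smul' := fun r x => by
      rw [← cancel_mono S.arrow, Linear.smul_comp]
      simp }

variable [BraidedCategory C]

/-- The operations of `𝔚_*` on a finitely braided monoid: act by braids, then multiply. -/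
noncomputable def worOps (B : C) [MonObj B] : Ops k B := fun n =>
  ((Linear.rightComp k (tpow B n) (mulN B n)).comp (hatAct k B n)).comp (WorStar k n).subtype

variable {k}

/-- The axioms of an algebra over `𝔚_*`: the structure maps are continuous (i.e. they are
morphisms out of a pro-object), unital, equivariant, and compatible with operadic composition. -/
structure IsWorAlg {X : C} (op : Ops k X) : Prop where
  continuous : ∀ n, ∃ N : Level n, ∀ x : WorStar k n, x.1.1 N = 0 → op n x = 0
  unit : op 1 ⟨1, one_mem_WorStar k⟩ = (λ_ X).hom
  equivariant : ∀ n (x y : WorStar k n) (g : Braid n),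
    y.1 = x.1 * toHat k n (MonoidAlgebra.of k (Braid n) g) →
      op n y = (braidAct X n g).hom ≫ op n x
  comp : ∀ a b n (x : WorStar k (a + 1 + b)) (y : WorStar k n) (z : WorStar k (a + n + b)),
    IsComp x.1 y.1 z.1 → op _ z = insertAt a (op n y) b ≫ op _ x

/-- A morphism `f : X ⟶ B` from a finitely braided object with operations to a monoid which
carries the operations on `X` to those of `B`. -/
def IsWorHom {X B : C} [MonObj B] (op : Ops k X) (f : X ⟶ B) : Prop :=
  ∀ n (x : WorStar k n), op n x ≫ f = hatAct k X n x.1 ≫ tpowMap f n ≫ mulN B n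

theorem IsWorHom.comp {X B B' : C} [MonObj B] [MonObj B'] {op : Ops k X} {f : X ⟶ B}
    (hf : IsWorHom op f) (g : B ⟶ B') [IsMonHom g] : IsWorHom op (f ≫ g) := fun n x => by
  rw [← Category.assoc, hf n x, tpowMap_comp, Category.assoc, Category.assoc, Category.assoc,
    mulN_naturality]

theorem IsWorHom.precomp {X Y B : C} [MonObj B] {op : Ops k X} {op' : Ops k Y} {f : Y ⟶ B}
    (hf : IsWorHom op' f) (hX : FinitelyBraided X) (hY : FinitelyBraided Y) (g : X ⟶ Y)
    (hg : ∀ n (x : WorStar k n), op n x ≫ g = tpowMap g n ≫ op' n x) :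
    IsWorHom op (g ≫ f) := fun n x => by
  rw [← Category.assoc, hg n x, Category.assoc, hf n x, tpowMap_comp, ← Category.assoc,
    ← hatAct_naturality hX hY]
  simp only [Category.assoc]

/-- The inclusion of a closed subobject of a finitely braided monoid. -/
theorem isWorHom_arrow [∀ X : C, PreservesFiniteLimits (tensorLeft X)] {B : C} [MonObj B]
    (hB : FinitelyBraided B) (S : Subobject B) (h : IsClosedUnder (worOps k B) S) :
    IsWorHom (restrictOps (worOps k B) S h) S.arrow := fun n x => by
  have hS := hB.of_mono S.arrow
  rw [← Category.assoc, hatAct_naturality hS hB, Category.assoc]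
  exact S.factorThru_arrow _ (h n x)

end Algebras

/-! ### Enveloping algebras -/

section Enveloping

variable {k : Type w} [Field k] {C : Type u} [Category.{v} C] [Abelian C] [Linear k C]
  [MonoidalCategory C] [MonoidalPreadditive C] [BraidedCategory C]
  [HasColimitsOfSize.{w, w} C] [∀ X : C, PreservesColimitsOfSize.{w, w} (tensorLeft X)]
  [∀ X : C, PreservesFiniteColimits (tensorLeft X)]

/-- The relations of the enveloping algebra: the difference, for each operation `x`, of `x`
computed in the tensor algebra and the value of the operation in `L`. -/
noncomputable def envRel {L : C} (op : Ops k L) :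
    (∐ fun i : (Σ n, WorStar k n) => tpow L i.1) ⟶ tensorAlg.{w} L :=
  Sigma.desc fun i => hatAct k L i.1 i.2.1 ≫ tensorAlg.inc L i.1 - op i.1 i.2 ≫ tensorAlg.gen L

theorem rel_aux {P L T B : C} {a : P ⟶ P} {b : P ⟶ L} {i : P ⟶ T} {g : L ⟶ T} {l : T ⟶ B}
    {m : P ⟶ B} {f : L ⟶ B} (h₁ : i ≫ l = m) (h₂ : g ≫ l = f) (h : b ≫ f = a ≫ m) :
    (a ≫ i - b ≫ g) ≫ l = 0 := by
  rw [Preadditive.sub_comp, Category.assoc, Category.assoc, h₁, h₂, h, sub_self]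

theorem ι_envRel {L : C} (op : Ops k L) (i : Σ n, WorStar k n) :
    Sigma.ι (fun i : (Σ n, WorStar k n) => tpow L i.1) i ≫ envRel op =
      hatAct k L i.1 i.2.1 ≫ tensorAlg.inc L i.1 - op i.1 i.2 ≫ tensorAlg.gen L :=
  Sigma.ι_desc _ _

/-- The universal enveloping algebra of a finitely braided `𝔚_*`-algebra: the quotient of the
tensor algebra by the two-sided ideal generated by the relations. -/
noncomputable abbrev Env {L : C} (op : Ops k L) : C := quot (envRel op)

namespace Env

/-- The universal map. -/
noncomputable def incl {L : C} (op : Ops k L) : L ⟶ Env op :=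
  tensorAlg.gen L ≫ quot.π (envRel op)

theorem incl_isWorHom {L : C} (op : Ops k L) : IsWorHom op (incl op) := fun n x => by
  have h : (hatAct k L n x.1 ≫ tensorAlg.inc L n - op n x ≫ tensorAlg.gen L) ≫
      quot.π (envRel op) = 0 := by
    have h1 := congrArg (Sigma.ι (fun i : (Σ n, WorStar k n) => tpow L i.1) ⟨n, x⟩ ≫ ·)
      (quot.rel_π (envRel op))
    simp only [comp_zero] at h1
    rw [← Category.assoc, ι_envRel] at h1
    exact h1
  rw [Preadditive.sub_comp, sub_eq_zero, Category.assoc, Category.assoc] at h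
  rw [incl, tpowMap_comp, Category.assoc]
  refine h.symm.trans ?_
  rw [← tensorAlg.tpowMap_gen, Category.assoc]
  congr 2
  exact mulN_naturality _ _

theorem rel_lift {L : C} (op : Ops k L) {B : C} [MonObj B] (f : L ⟶ B) (hf : IsWorHom op f) :
    envRel op ≫ tensorAlg.lift f = 0 := by
  refine Sigma.hom_ext _ _ fun i => ?_
  have h1 := congrArg (· ≫ tensorAlg.lift f) (ι_envRel op i)
  exact ((Category.assoc _ _ _).symm.trans (h1.trans (rel_aux (tensorAlg.inc_lift f i.1)
    (tensorAlg.gen_lift f) (hf i.1 i.2)))).trans comp_zero.symm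

/-- The universal property of the enveloping algebra. -/
noncomputable def lift {L : C} (op : Ops k L) {B : C} [MonObj B] (f : L ⟶ B)
    (hf : IsWorHom op f) : Env op ⟶ B :=
  quot.desc (envRel op) (tensorAlg.lift f) (rel_lift op f hf)

instance lift_isMonHom {L : C} (op : Ops k L) {B : C} [MonObj B] (f : L ⟶ B)
    (hf : IsWorHom op f) : IsMonHom (lift op f hf) :=
  quot.desc_isMonHom _ _ _

theorem incl_lift {L : C} (op : Ops k L) {B : C} [MonObj B] (f : L ⟶ B)
    (hf : IsWorHom op f) : incl op ≫ lift op f hf = f := by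
  rw [incl, lift, Category.assoc, quot.π_desc, tensorAlg.gen_lift]

theorem hom_ext {L : C} (op : Ops k L) {B : C} [MonObj B] {f g : Env op ⟶ B} [IsMonHom f]
    [IsMonHom g] (h : incl op ≫ f = incl op ≫ g) : f = g := by
  have h1 : quot.π (envRel op) ≫ f = quot.π (envRel op) ≫ g := by
    refine tensorAlg.monHom_ext ?_
    simpa [incl] using h
  exact (cancel_epi (quot.π (envRel op))).1 h1

end Env

end Enveloping

/-! ### Primitively generated braided Hopf algebras -/

section Hopf

variable {C : Type u} [Category.{v} C] [Abelian C] [MonoidalCategory C] [BraidedCategory C]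

/-- For `i : L ⟶ U` and `δ : L ⟶ U ⊗ U`, the map `x ↦ δ x - x ⊗ 1 - 1 ⊗ x`. -/
def primDefect {L U : C} [MonObj U] (i : L ⟶ U) (δ : L ⟶ U ⊗ U) : L ⟶ U ⊗ U :=
  δ - i ≫ (ρ_ U).inv ≫ U ◁ η - i ≫ (λ_ U).inv ≫ η ▷ U

/-- The primitives of a bialgebra. -/
noncomputable def primitives (A : C) [BimonObj A] : Subobject A :=
  kernelSubobject (primDefect (𝟙 A) Δ[A])

/-- A bialgebra is primitively generated if it has no proper subalgebra containing all
primitives. -/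
def PrimitivelyGenerated (A : C) [BimonObj A] : Prop :=
  ∀ S : Subobject A, S.Factors η[A] → S.Factors ((S.arrow ⊗ₘ S.arrow) ≫ μ[A]) →
    primitives A ≤ S → S = ⊤

variable (C) in
/-- A primitively generated, finitely braided Hopf algebra in a braided category. -/
structure PGHopf where
  /-- The underlying object. -/
  X : C
  [hopf : HopfObj X]
  finitelyBraided : FinitelyBraided X
  primitivelyGenerated : PrimitivelyGenerated X

attribute [instance] PGHopf.hopf

namespace PGHopf

/-- Morphisms of Hopf algebras. -/
@[ext]
structure Hom (A B : PGHopf C) where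
  /-- The underlying morphism. -/
  hom : A.X ⟶ B.X
  [isBimonHom : IsBimonHom hom]

attribute [instance] Hom.isBimonHom

instance : Category (PGHopf C) where
  Hom := Hom
  id A := { hom := 𝟙 A.X, isBimonHom := { } }
  comp f g := { hom := f.hom ≫ g.hom, isBimonHom := { } }

end PGHopf

end Hopf

/-! ### Hopf `𝔚_*`-algebras -/

section WorHopf

variable (k : Type w) [Field k] (C : Type u) [Category.{v} C] [Abelian C] [Linear k C]
  [MonoidalCategory C] [MonoidalPreadditive C] [BraidedCategory C]
  [HasColimitsOfSize.{w, w} C] [∀ X : C, PreservesColimitsOfSize.{w, w} (tensorLeft X)]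
  [∀ X : C, PreservesFiniteColimits (tensorLeft X)]

variable {k C} in
theorem isWorHom_zero {L : C} (op : Ops k L) : IsWorHom op (0 : L ⟶ 𝟙_ C)
  | 0, x => by
    have hx : x = 0 := by
      have h : quantumSymmetrizer k 0 = 1 := by
        simp [quantumSymmetrizer, matsumoto, reducedWord, MonoidAlgebra.one_def]
      have h' : toHat k 0 1 = 1 := Subtype.ext (funext fun N => map_one (toLevel k N))
      have hx : x.1 ∈ Wor k 0 := by simpa [WorStar] using x.2
      rw [Wor, LinearMap.mem_ker, LinearMap.mulLeft_apply, h, h', _root_.one_mul] at hx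
      exact Subtype.ext hx
    subst hx
    simp
  | n + 1, x => by
    have : tpowMap (0 : L ⟶ 𝟙_ C) (n + 1) = 0 := by
      change tpowMap (0 : L ⟶ 𝟙_ C) n ⊗ₘ (0 : L ⟶ 𝟙_ C) = 0
      rw [MonoidalCategory.tensorHom_def, MonoidalPreadditive.whiskerLeft_zero, comp_zero]
    rw [this, comp_zero, zero_comp, comp_zero]

variable {k C} in
/-- The augmentation of the enveloping algebra. -/
noncomputable def Env.aug {L : C} (op : Ops k L) : Env op ⟶ 𝟙_ C :=
  Env.lift op 0 (isWorHom_zero op)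

/-- A primitively generated Hopf algebra over `𝔚_*`, finitely braided and with a finitely braided
enveloping algebra `U`. The diagonal takes values in the subalgebra generated by `L ⊗ 1 + 1 ⊗ L` in
`U ⊗ U`; the counit takes values in the zero object and so is not additional data. -/
structure WorHopf where
  /-- The underlying object. -/
  L : C
  /-- The operations. -/
  op : Ops k L
  finitelyBraided : FinitelyBraided L
  isWorAlg : IsWorAlg op
  env_finitelyBraided : FinitelyBraided (Env op)
  faithful : Mono (Env.incl op)
  /-- The diagonal. -/
  δ : L ⟶ Env op ⊗ Env op
  δ_isWorHom : IsWorHom op δ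
  δ_mem : ∀ S : Subobject (Env op ⊗ Env op), IsClosedUnder (worOps k (Env op ⊗ Env op)) S →
    S.Factors (Env.incl op ≫ (ρ_ (Env op)).inv ≫ Env op ◁ η) →
    S.Factors (Env.incl op ≫ (λ_ (Env op)).inv ≫ η ▷ Env op) → S.Factors δ
  coassoc : δ ≫ Env.lift op δ δ_isWorHom ▷ Env op ≫ (α_ _ _ _).hom =
    δ ≫ Env op ◁ Env.lift op δ δ_isWorHom
  counit_left : δ ≫ Env.aug op ▷ Env op = Env.incl op ≫ (λ_ (Env op)).inv
  counit_right : δ ≫ Env op ◁ Env.aug op = Env.incl op ≫ (ρ_ (Env op)).inv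
  primitivelyGenerated : ∀ S : Subobject L, IsClosedUnder op S →
    kernelSubobject (primDefect (Env.incl op) δ) ≤ S → S = ⊤

namespace WorHopf

variable {k C}

/-- The enveloping algebra. -/
noncomputable abbrev U (L : WorHopf k C) : C := Env L.op

/-- The diagonal of the enveloping algebra. -/
noncomputable def comul (L : WorHopf k C) : L.U ⟶ L.U ⊗ L.U := Env.lift L.op L.δ L.δ_isWorHom

/-- The morphism of enveloping algebras induced by a morphism of `𝔚_*`-algebras. -/
noncomputable def map {L M : WorHopf k C} (f : L.L ⟶ M.L)
    (hf : ∀ n (x : WorStar k n), L.op n x ≫ f = tpowMap f n ≫ M.op n x) : L.U ⟶ M.U :=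
  Env.lift L.op (f ≫ Env.incl M.op)
    ((Env.incl_isWorHom M.op).precomp L.finitelyBraided M.finitelyBraided f hf)

theorem map_id (L : WorHopf k C)
    (hf : ∀ n (x : WorStar k n), L.op n x ≫ 𝟙 L.L = tpowMap (𝟙 L.L) n ≫ L.op n x) :
    map (𝟙 L.L) hf = 𝟙 L.U := by
  have h : IsMonHom (map (𝟙 L.L) hf) := Env.lift_isMonHom _ _ _
  refine Env.hom_ext _ ?_
  rw [map, Env.incl_lift, Category.id_comp, Category.comp_id]

theorem map_comp {L M N : WorHopf k C} (f : L.L ⟶ M.L) (g : M.L ⟶ N.L)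
    (hf : ∀ n (x : WorStar k n), L.op n x ≫ f = tpowMap f n ≫ M.op n x)
    (hg : ∀ n (x : WorStar k n), M.op n x ≫ g = tpowMap g n ≫ N.op n x)
    (hfg : ∀ n (x : WorStar k n), L.op n x ≫ f ≫ g = tpowMap (f ≫ g) n ≫ N.op n x) :
    map (f ≫ g) hfg = map f hf ≫ map g hg := by
  have h : IsMonHom (map (f ≫ g) hfg) := Env.lift_isMonHom _ _ _
  have h : IsMonHom (map f hf) := Env.lift_isMonHom _ _ _
  have h : IsMonHom (map g hg) := Env.lift_isMonHom _ _ _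
  refine Env.hom_ext _ ?_
  rw [map, map, Env.incl_lift, ← Category.assoc, Env.incl_lift, Category.assoc, Category.assoc,
    map, Env.incl_lift]

/-- Morphisms preserve the operations and the diagonals. -/
@[ext]
structure Hom (L M : WorHopf k C) where
  /-- The underlying morphism. -/
  hom : L.L ⟶ M.L
  map_op : ∀ n (x : WorStar k n), L.op n x ≫ hom = tpowMap hom n ≫ M.op n x
  map_δ : L.δ ≫ (map hom map_op ⊗ₘ map hom map_op) = hom ≫ M.δ

attribute [instance] WorHopf.faithful

instance : Category (WorHopf k C) where
  Hom := Hom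
  id L :=
    { hom := 𝟙 L.L
      map_op := fun n x => by
        rw [tpowMap_id, Category.id_comp, Category.comp_id]
      map_δ := by
        rw [map_id]
        simp }
  comp f g :=
    { hom := f.hom ≫ g.hom
      map_op := fun n x => by
        rw [← Category.assoc, f.map_op, Category.assoc, g.map_op, tpowMap_comp, Category.assoc]
      map_δ := by
        rw [map_comp f.hom g.hom f.map_op g.map_op, ← tensorHom_comp_tensorHom, ← Category.assoc, f.map_δ, Category.assoc,
          g.map_δ, Category.assoc] }

/-- The morphism of enveloping algebras induced by a morphism of Hopf `𝔚_*`-algebras. -/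
noncomputable def envMap {L M : WorHopf k C} (f : L ⟶ M) : L.U ⟶ M.U := map f.hom f.map_op

end WorHopf

end WorHopf

/-! ### The Woronowicz algebra of a Hopf algebra -/

section PW

variable (k : Type w) [Field k] {C : Type u} [Category.{v} C] [Abelian C] [Linear k C]
  [MonoidalCategory C] [BraidedCategory C]

/-- `S` is the `𝔚_*`-subalgebra of the finitely braided bialgebra `A` generated by the
primitives. -/
def IsPW (A : C) [BimonObj A] (S : Subobject A) : Prop :=
  IsLeast {S : Subobject A | IsClosedUnder (worOps k A) S ∧ primitives A ≤ S} S

variable [MonoidalPreadditive C]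
  [HasColimitsOfSize.{w, w} C] [∀ X : C, PreservesColimitsOfSize.{w, w} (tensorLeft X)]
  [∀ X : C, PreservesFiniteColimits (tensorLeft X)]
  [∀ X : C, PreservesFiniteLimits (tensorLeft X)]

/-- The multiplication map from the enveloping algebra of a closed subobject `S` of `A`, i.e. the
morphism of monoids extending the inclusion of `S`. -/
noncomputable def envMul (A : C) [BimonObj A] (hA : FinitelyBraided A) (S : Subobject A)
    (hS : IsClosedUnder (worOps k A) S) : Env (restrictOps (worOps k A) S hS) ⟶ A :=
  Env.lift _ S.arrow (isWorHom_arrow hA S hS)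

end PW

end BraidedHopf

open scoped MonObj ComonObj

/-! The proof compares a finitely braided Hopf algebra with its quotient by the kernels of the
quantum symmetrizers.

In characteristic zero the group algebras `k[B_n / N]` of the finite quotients of the braid group
are von Neumann regular, and `k[B_n / N]` is a factor of the completed group algebra, cut out by a
central idempotent. Hence, if `B_n` acts on `X^{⊗ n}` through a finite quotient, some element of
`𝔚(n)` acts on `X^{⊗ n}` as an idempotent whose image is the kernel of the quantum symmetrizer
(`exists_wor_eq_one_sub`, `exists_hatAct_eq`). Operations of `𝔚_*` on a subobject `V` of an
algebra `A` therefore amount to restricting products of elements of `V` to the kernels of the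
quantum symmetrizers.

Let `A` be a bialgebra generated by a subobject `V` of primitives. The quantum symmetrizer factors
through its analogues for blocks of adjacent strands, so these kernels form an ideal of the tensor
algebra (`ideal_sym`); as it also factors through unshuffles (`qsym_mul_unshuffle`), the
quotient `symQuot v` of `A` by the image of this ideal is again a bialgebra, generated by the image
`K` of `V`, which consists of primitives and in which elements of `K^{⊗ n}` killed by the quantum
symmetrizer have product zero. For such a bialgebra the noncommutative binomial formula
`tpowMap_add_mulN` computes the comultiplication on products of elements of `K`. Comparing terms of
the highest degree in `K` gives, by induction on the length of the products, that

* a linear relation between products of elements of `K` holds only if each of its terms is killed by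
  the quantum symmetrizer (`comp_sym_of_sum_eq_zero`), and
* every primitive element of the quotient lies in `K` (`exists_eq_of_primitive`).

Let `symClosure v` be the inverse image of `K` in `A`. By the second point it contains `P(A)`. It is
closed under the operations because those of degree different from one vanish in the quotient, and
it is the smallest closed subobject containing `V` because its elements are sums of elements of `V`
and of values of operations on `V`; so it is `P_{𝔚_*}(A)` for `V = P(A)`
(`isPW_symClosure`). The map `U_{𝔚_*}(symClosure v) ⟶ A` is an epimorphism. If an element of its
source, written as a sum of products of elements of `V`, is mapped to zero, then the first point
shows that it dies modulo the kernels of the quantum symmetrizers, so it lies in the image of these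
kernels; but there it equals an element of `symClosure v`, on which the map is injective. So the map
is an isomorphism (`isIso_lift_arrow`).

Elements are generalized elements throughout, that is, morphisms from a varying object, which may
be replaced by a cover. Exactness of filtered colimits allows one to assume that a generalized
element of the tensor algebra is a finite sum of homogeneous ones (`tensorAlg.eq_zero_of_finite`).

Conversely, if `L` is a primitively generated Hopf `𝔚_*`-algebra, then `U_{𝔚_*}(L)` is a bialgebra
generated by the primitives of `L`. It has an antipode, because the geometric series for the
convolution inverse of the identity is finite on each product of primitives (`exists_antipode`), and
the previous results with `V` the primitives of `L` identify `L` with `P_{𝔚_*}(U_{𝔚_*}(L))`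
(`WorHopf.isPW_incl`). Both functors are then determined by their values on generators, which gives
the equivalence `WorHopf.equivalence`. -/

namespace BraidedHopf

/-! ### Factorizations of the quantum symmetrizer -/

section Factorizations

variable {R : Type*} [Ring R]

/-- The braid relations for a sequence in a monoid, restricted to the indices of the generators
of `B_n`. -/
structure BraidRel (n : ℕ) (f : ℕ → R) : Prop where
  braid : ∀ i, i + 2 < n → f i * f (i + 1) * f i = f (i + 1) * f i * f (i + 1)
  far : ∀ i j, i + 1 < j → j + 1 < n → Commute (f i) (f j)

/-- The ascending product `f i * f (i + 1) * ⋯ * f (i + n - 1)`. -/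
def asc (f : ℕ → R) (i : ℕ) : ℕ → R
  | 0 => 1
  | n + 1 => asc f i n * f (i + n)

/-- The descending product `f (i + n - 1) * ⋯ * f (i + 1) * f i`. -/
def desc (f : ℕ → R) (i : ℕ) : ℕ → R
  | 0 => 1
  | n + 1 => f (i + n) * desc f i n

/-- The sum of the descending products `f (i + j - 1) * ⋯ * f i` with `j ≤ n`. -/
def descSum (f : ℕ → R) (i : ℕ) : ℕ → R
  | 0 => 1
  | n + 1 => descSum f i n + desc f i (n + 1)

/-- The sum of the ascending products `f (i + m) * ⋯ * f (i + n - 1)` with `m ≤ n`. -/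
def ascSum (f : ℕ → R) (i : ℕ) : ℕ → R
  | 0 => 1
  | n + 1 => 1 + ascSum f i n * f (i + n)

/-- The quantum symmetrizer of the strands in positions `i, …, i + n - 1`, written recursively
as in the definition of `reducedWord`. -/
def qsym (f : ℕ → R) : ℕ → ℕ → R
  | _, 0 => 1
  | i, n + 1 => descSum f i n * qsym f (i + 1) n

/-- The sum of the lifts of the inverses of the `(i, j)`-shuffles, that is the `(i, j)` component
of the comultiplication of the tensor algebra. -/
def unshuffle (f : ℕ → R) : ℕ → ℕ → R
  | 0, _ => 1
  | _ + 1, 0 => 1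
  | i + 1, j + 1 => unshuffle f (i + 1) j + asc f i (j + 1) * unshuffle f i (j + 1)

variable {f : ℕ → R} {N : ℕ}

theorem commute_asc {x : R} {i n : ℕ} (h : ∀ l, i ≤ l → l < i + n → Commute x (f l)) :
    Commute x (asc f i n) := by
  induction n with
  | zero => exact Commute.one_right _
  | succ n ih =>
    exact (ih fun l h1 h2 => h l h1 (by omega)).mul_right (h _ (by omega) (by omega))

theorem commute_desc {x : R} {i n : ℕ} (h : ∀ l, i ≤ l → l < i + n → Commute x (f l)) :
    Commute x (desc f i n) := by
  induction n with
  | zero => exact Commute.one_right _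
  | succ n ih =>
    exact (h _ (by omega) (by omega)).mul_right (ih fun l h1 h2 => h l h1 (by omega))

theorem commute_descSum {x : R} {i n : ℕ} (h : ∀ l, i ≤ l → l < i + n → Commute x (f l)) :
    Commute x (descSum f i n) := by
  induction n with
  | zero => exact Commute.one_right _
  | succ n ih =>
    exact (ih fun l h1 h2 => h l h1 (by omega)).add_right (commute_desc h)

theorem commute_ascSum {x : R} {i n : ℕ} (h : ∀ l, i ≤ l → l < i + n → Commute x (f l)) :
    Commute x (ascSum f i n) := by
  induction n with
  | zero => exact Commute.one_right _
  | succ n ih =>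
    exact (Commute.one_right _).add_right
      ((ih fun l h1 h2 => h l h1 (by omega)).mul_right (h _ (by omega) (by omega)))

theorem commute_qsym {x : R} {i n : ℕ} (h : ∀ l, i ≤ l → l + 1 < i + n → Commute x (f l)) :
    Commute x (qsym f i n) := by
  induction n generalizing i with
  | zero => exact Commute.one_right _
  | succ n ih =>
    exact (commute_descSum fun l h1 h2 => h l h1 (by omega)).mul_right
      (ih fun l h1 h2 => h l (by omega) (by omega))

/-- Conjugation by a descending product lowers the index of a generator. -/
theorem desc_conj (hf : BraidRel N f) {i n l : ℕ} (hN : i + n < N) (hl : i ≤ l)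
    (hl' : l + 1 < i + n) : desc f i n * f (l + 1) = f l * desc f i n := by
  induction n with
  | zero => omega
  | succ n ih =>
    rcases Nat.lt_or_ge (l + 1) (i + n) with h | h
    · rw [desc, mul_assoc, ih (by omega) h, ← mul_assoc, ← mul_assoc,
        (hf.far l (i + n) (by omega) (by omega)).eq]
    · obtain ⟨n, rfl⟩ : ∃ m, n = m + 1 := ⟨n - 1, by omega⟩
      obtain rfl : l = i + n := by omega
      have c : Commute (f (i + n + 1)) (desc f i n) :=
        commute_desc fun t h1 h2 => (hf.far t _ (by omega) (by omega)).symm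
      have b := hf.braid (i + n) (by omega)
      simp only [desc, ← add_assoc]
      calc f (i + n + 1) * (f (i + n) * desc f i n) * f (i + n + 1)
          = f (i + n + 1) * f (i + n) * (desc f i n * f (i + n + 1)) := by simp only [mul_assoc]
        _ = (f (i + n + 1) * f (i + n) * f (i + n + 1)) * desc f i n := by
          rw [← c.eq]; simp only [mul_assoc]
        _ = _ := by rw [← b]; simp only [mul_assoc]

/-- Conjugation by an ascending product raises the index of a generator. -/
theorem asc_conj (hf : BraidRel N f) {i n l : ℕ} (hN : i + n < N) (hl : i ≤ l)
    (hl' : l + 1 < i + n) : f (l + 1) * asc f i n = asc f i n * f l := by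
  induction n with
  | zero => omega
  | succ n ih =>
    rcases Nat.lt_or_ge (l + 1) (i + n) with h | h
    · rw [asc, ← mul_assoc, ih (by omega) h, mul_assoc, mul_assoc,
        (hf.far l (i + n) (by omega) (by omega)).eq]
    · obtain ⟨n, rfl⟩ : ∃ m, n = m + 1 := ⟨n - 1, by omega⟩
      obtain rfl : l = i + n := by omega
      have c : Commute (f (i + n + 1)) (asc f i n) :=
        commute_asc fun t h1 h2 => (hf.far t _ (by omega) (by omega)).symm
      have b := hf.braid (i + n) (by omega)
      simp only [asc, ← add_assoc]
      calc f (i + n + 1) * (asc f i n * f (i + n) * f (i + n + 1))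
          = (f (i + n + 1) * asc f i n) * (f (i + n) * f (i + n + 1)) := by simp only [mul_assoc]
        _ = asc f i n * (f (i + n + 1) * f (i + n) * f (i + n + 1)) := by
          rw [c.eq]; simp only [mul_assoc]
        _ = _ := by rw [← b]; simp only [mul_assoc]

theorem desc_ascSum (hf : BraidRel N f) {i n m : ℕ} (hN : i + n < N) (hm : m < n) :
    desc f i n * ascSum f (i + 1) m = ascSum f i m * desc f i n := by
  induction m with
  | zero => simp [ascSum]
  | succ m ih =>
    have e : i + 1 + m = i + m + 1 := by omega
    rw [ascSum, ascSum, mul_add, add_mul, mul_one, one_mul, e, ← mul_assoc, ih (by omega),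
      mul_assoc, mul_assoc, desc_conj hf hN (by omega) (by omega)]

/-- Moving a block of strands past another strand shifts its quantum symmetrizer. -/
theorem asc_qsym (hf : BraidRel N f) {i n m a : ℕ} (hN : i + n < N) (ha : i ≤ a)
    (hm : a + m ≤ i + n) :
    qsym f (a + 1) m * asc f i n = asc f i n * qsym f a m := by
  have key : ∀ m a, i ≤ a → a + m < i + n →
      desc f (a + 1) m * asc f i n = asc f i n * desc f a m := by
    intro m
    induction m with
    | zero => intro a _ _; simp [desc]
    | succ m ih =>
      intro a h1 h2
      have e : a + 1 + m = a + m + 1 := by omega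
      rw [desc, desc, mul_assoc, ih a h1 (by omega), ← mul_assoc, e,
        asc_conj hf hN (by omega) (by omega), mul_assoc]
  have key' : ∀ m a, i ≤ a → a + m < i + n →
      descSum f (a + 1) m * asc f i n = asc f i n * descSum f a m := by
    intro m
    induction m with
    | zero => intro a _ _; simp [descSum]
    | succ m ih =>
      intro a h1 h2
      rw [descSum, descSum, add_mul, mul_add, ih a h1 (by omega), key _ a h1 h2]
  induction m generalizing a with
  | zero => simp [qsym]
  | succ m ih =>
    rw [qsym, qsym, mul_assoc, ih (by omega) (by omega), ← mul_assoc, key' _ a ha (by omega),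
      mul_assoc]

/-- The two ways of sorting a strand to the left and another one to the right agree. -/
theorem descSum_ascSum (hf : BraidRel N f) (i : ℕ) : ∀ m, i + m + 1 < N →
    descSum f i (m + 1) * ascSum f (i + 1) m = ascSum f i (m + 1) * descSum f i m
  | 0, _ => by simp [descSum, ascSum, desc]
  | m + 1, hN => by
    have ih := descSum_ascSum hf i m (by omega)
    have c : Commute (f (i + m + 1)) (descSum f i m) :=
      commute_descSum fun t h1 h2 => (hf.far t _ (by omega) (by omega)).symm
    have e : i + 1 + m = i + m + 1 := by omega
    have hd := desc_ascSum hf (i := i) (n := m + 1 + 1) (m := m + 1) (by omega) (by omega)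
    have h1 : descSum f i (m + 1) * ascSum f (i + 1) (m + 1) =
        descSum f i (m + 1) + ascSum f i (m + 1) * descSum f i m * f (i + m + 1) := by
      rw [ascSum, mul_add, mul_one, e, ← mul_assoc, ih]
    have h2 : ascSum f i (m + 1 + 1) * descSum f i (m + 1) =
        descSum f i (m + 1) + ascSum f i (m + 1) * (f (i + m + 1) * descSum f i m) +
          ascSum f i (m + 1) * desc f i (m + 1 + 1) := by
      have e3 : desc f i (m + 1 + 1) = f (i + m + 1) * desc f i (m + 1) := rfl
      rw [ascSum, add_mul, one_mul, e3, add_assoc, ← mul_add, ← mul_add, mul_assoc]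
      rfl
    rw [descSum, add_mul, hd, h1, h2, c.eq, mul_assoc]

/-- The quantum symmetrizer factors through the one of all strands but the last. -/
theorem qsym_succ (hf : BraidRel N f) : ∀ n i, i + n < N →
    qsym f i (n + 1) = ascSum f i n * qsym f i n
  | 0, i, _ => by simp [qsym, descSum, ascSum]
  | n + 1, i, hN => by
    have h1 := qsym_succ hf n (i + 1) (by omega)
    have h2 := descSum_ascSum hf i n (by omega)
    rw [qsym, h1, ← mul_assoc, h2, mul_assoc]
    rfl

/-- The sum of the ascending products, split according to whether the first generator has an index
bigger than `i + j` or not. -/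
theorem ascSum_add (f : ℕ → R) (i j : ℕ) : ∀ n,
    ascSum f i (j + n + 1) = ascSum f (i + j + 1) n + ascSum f i j * asc f (i + j) (n + 1)
  | 0 => by simp [ascSum, asc]
  | n + 1 => by
    have e : i + (j + n + 1) = i + j + 1 + n := by omega
    have e' : i + j + (n + 1) = i + j + 1 + n := by omega
    have e3 : asc f (i + j) (n + 1 + 1) = asc f (i + j) (n + 1) * f (i + j + 1 + n) := by
      rw [asc, e']
    rw [← add_assoc, ascSum, ascSum_add f i j n, e, e3, add_mul, ascSum, ← add_assoc, mul_assoc]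

/-- The quantum symmetrizer is the product of the unshuffles with the symmetrizers of the two
groups of strands. -/
theorem qsym_mul_unshuffle (hf : BraidRel N f) : ∀ i j, i + j ≤ N →
    qsym f 0 i * qsym f i j * unshuffle f i j = qsym f 0 (i + j)
  | 0, j, _ => by simp [qsym, unshuffle]
  | i + 1, 0, _ => by simp [qsym, unshuffle]
  | i + 1, j + 1, hN => by
    have h1 := qsym_mul_unshuffle hf (i + 1) j (by omega)
    have h2 := qsym_mul_unshuffle hf i (j + 1) (by omega)
    have e : i + 1 + j = i + j + 1 := by omega
    have e' : i + (j + 1) = i + j + 1 := by omega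
    have c1 : Commute (qsym f 0 (i + 1)) (ascSum f (i + 1) j) :=
      (commute_qsym fun l _ hl => (commute_ascSum fun t ht ht' =>
        hf.far l t (by omega) (by omega)).symm).symm
    have c2 : Commute (qsym f 0 i) (asc f i (j + 1)) :=
      (commute_qsym fun l _ hl => (commute_asc fun t ht ht' =>
        hf.far l t (by omega) (by omega)).symm).symm
    have h3 := asc_qsym hf (i := i) (n := j + 1) (m := j + 1) (a := i) (by omega) le_rfl le_rfl
    have h4 : qsym f 0 (i + 1) * qsym f (i + 1) (j + 1) * unshuffle f (i + 1) j =
        ascSum f (i + 1) j * qsym f 0 (i + j + 1) := by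
      rw [qsym_succ hf j (i + 1) (by omega), ← mul_assoc, c1.eq, mul_assoc, mul_assoc,
        ← mul_assoc (qsym f 0 (i + 1)), h1, e]
    have h5 : qsym f 0 (i + 1) * qsym f (i + 1) (j + 1) *
          (asc f i (j + 1) * unshuffle f i (j + 1)) =
        ascSum f 0 i * asc f i (j + 1) * qsym f 0 (i + j + 1) := by
      rw [qsym_succ hf i 0 (by omega), ← e', ← h2]
      calc ascSum f 0 i * qsym f 0 i * qsym f (i + 1) (j + 1) *
            (asc f i (j + 1) * unshuffle f i (j + 1))
          = ascSum f 0 i * qsym f 0 i * (qsym f (i + 1) (j + 1) * asc f i (j + 1)) *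
              unshuffle f i (j + 1) := by simp only [mul_assoc]
        _ = ascSum f 0 i * (qsym f 0 i * asc f i (j + 1)) * qsym f i (j + 1) *
              unshuffle f i (j + 1) := by rw [h3]; simp only [mul_assoc]
        _ = _ := by rw [c2.eq]; simp only [mul_assoc]
    have h6 := ascSum_add f 0 i j
    rw [Nat.zero_add] at h6
    rw [unshuffle, mul_add, h4, h5, ← add_mul, ← h6, ← qsym_succ hf _ 0 (by omega)]
    congr 1
    omega

theorem qsym_mem_left_of_add (hf : BraidRel N f) (i a : ℕ) : ∀ n, i + a + n ≤ N →
    ∃ y, qsym f i (a + n) = y * qsym f i a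
  | 0, _ => ⟨1, by simp⟩
  | n + 1, hN => by
    obtain ⟨y, hy⟩ := qsym_mem_left_of_add hf i a n (by omega)
    exact ⟨ascSum f i (a + n) * y, by
      rw [← add_assoc, qsym_succ hf _ _ (by omega), hy, mul_assoc]⟩

theorem qsym_mem_right_of_add (f : ℕ → R) : ∀ a i n,
    ∃ y, qsym f i (a + n) = y * qsym f (i + a) n
  | 0, i, n => ⟨1, by simp⟩
  | a + 1, i, n => by
    obtain ⟨y, hy⟩ := qsym_mem_right_of_add f a (i + 1) n
    have e : a + 1 + n = a + n + 1 := by omega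
    have e' : i + 1 + a = i + (a + 1) := by omega
    exact ⟨descSum f i (a + n) * y, by rw [e, qsym, hy, e', mul_assoc]⟩

/-- The quantum symmetrizer of all strands is a left multiple of that of a block of strands; hence
the kernels of the quantum symmetrizers form a two-sided ideal in the tensor algebra. -/
theorem exists_qsym_eq_mul (hf : BraidRel N f) (a n b : ℕ) (hN : a + n + b ≤ N) :
    ∃ y, qsym f 0 (a + n + b) = y * qsym f a n := by
  obtain ⟨y, hy⟩ := qsym_mem_right_of_add f a 0 (n + b)
  obtain ⟨z, hz⟩ := qsym_mem_left_of_add hf a n b hN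
  exact ⟨y * z, by rw [add_assoc, hy, Nat.zero_add, hz, mul_assoc]⟩

section Naturality

variable {S : Type*} [Ring S] (φ : R →+* S) {g : ℕ → S} {s : ℕ}

theorem map_desc {i n : ℕ} (h : ∀ l, i ≤ l → l < i + n → φ (f l) = g (s + l)) :
    φ (desc f i n) = desc g (s + i) n := by
  induction n with
  | zero => exact map_one φ
  | succ n ih =>
    rw [desc, map_mul, ih fun l h1 h2 => h l h1 (by omega), h _ (by omega) (by omega), desc,
      add_assoc]

theorem map_descSum {i n : ℕ} (h : ∀ l, i ≤ l → l < i + n → φ (f l) = g (s + l)) :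
    φ (descSum f i n) = descSum g (s + i) n := by
  induction n with
  | zero => exact map_one φ
  | succ n ih =>
    rw [descSum, map_add, ih fun l h1 h2 => h l h1 (by omega), map_desc φ h, descSum]

theorem map_qsym {i n : ℕ} (h : ∀ l, i ≤ l → l + 1 < i + n → φ (f l) = g (s + l)) :
    φ (qsym f i n) = qsym g (s + i) n := by
  induction n generalizing i with
  | zero => exact map_one φ
  | succ n ih =>
    rw [qsym, map_mul, ih fun l h1 h2 => h l (by omega) (by omega),
      map_descSum φ fun l h1 h2 => h l h1 (by omega), qsym, add_assoc]

end Naturality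

end Factorizations

section Matsumoto

theorem desc_eq_prod {R : Type*} [Ring R] (f : ℕ → R) (i : ℕ) : ∀ n,
    desc f i n = (((List.range n).reverse.map (· + i)).map f).prod
  | 0 => by simp [desc]
  | n + 1 => by
    rw [desc, desc_eq_prod f i n, List.range_succ]
    simp [add_comm]

theorem descSum_eq_sum {R : Type*} [Ring R] (f : ℕ → R) (i n : ℕ) :
    descSum f i n = ∑ j : Fin (n + 1), desc f i j := by
  induction n with
  | zero => simp [descSum, desc]
  | succ n ih =>
    rw [Fin.sum_univ_castSucc, descSum, ih]
    rfl

/-- The bijection `τ ↦ (τ 0, τ')` underlying the recursive definition of `reducedWord`. -/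
def permSuccEquiv (n : ℕ) : Equiv.Perm (Fin (n + 1)) ≃ Fin (n + 1) × Equiv.Perm (Fin n) where
  toFun τ := (τ 0, (Equiv.Perm.decomposeFin (Fin.cycleRange (τ 0) * τ)).2)
  invFun p := (Fin.cycleRange p.1)⁻¹ * Equiv.Perm.decomposeFin.symm (0, p.2)
  left_inv τ := by
    have h : Equiv.Perm.decomposeFin (Fin.cycleRange (τ 0) * τ) =
        (0, (Equiv.Perm.decomposeFin (Fin.cycleRange (τ 0) * τ)).2) := by
      refine Prod.ext ?_ rfl
      have := Equiv.Perm.decomposeFin_symm_apply_zero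
        (Equiv.Perm.decomposeFin (Fin.cycleRange (τ 0) * τ)).1
        (Equiv.Perm.decomposeFin (Fin.cycleRange (τ 0) * τ)).2
      rw [Prod.mk.eta, Equiv.symm_apply_apply] at this
      simp only [← this, Equiv.Perm.mul_apply, Fin.cycleRange_self]
    simp only
    rw [← h, Equiv.symm_apply_apply, inv_mul_cancel_left]
  right_inv p := by
    have h : ((Fin.cycleRange p.1)⁻¹ * Equiv.Perm.decomposeFin.symm (0, p.2)) 0 = p.1 := by
      rw [Equiv.Perm.mul_apply, Equiv.Perm.decomposeFin_symm_apply_zero,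
        Equiv.Perm.inv_eq_iff_eq, Fin.cycleRange_self]
    refine Prod.ext h ?_
    simp only
    rw [h, mul_inv_cancel_left, Equiv.apply_symm_apply]

theorem sum_reducedWord {R : Type*} [Ring R] (f : ℕ → R) : ∀ n i,
    ∑ τ : Equiv.Perm (Fin n), (((reducedWord n τ).map (· + i)).map f).prod = qsym f i n
  | 0, i => by simp [reducedWord, qsym]
  | n + 1, i => by
    rw [← (permSuccEquiv n).symm.sum_comp, Fintype.sum_prod_type, qsym, descSum_eq_sum,
      Finset.sum_mul]
    refine Finset.sum_congr rfl fun j _ => ?_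
    rw [← sum_reducedWord f n (i + 1), Finset.mul_sum]
    refine Finset.sum_congr rfl fun τ _ => ?_
    have h := (permSuccEquiv n).apply_symm_apply (j, τ)
    have h1 : ((permSuccEquiv n).symm (j, τ)) 0 = j := congrArg Prod.fst h
    have h2 : (Equiv.Perm.decomposeFin (Fin.cycleRange (((permSuccEquiv n).symm (j, τ)) 0) *
      ((permSuccEquiv n).symm (j, τ)))).2 = τ := congrArg Prod.snd h
    have h3 : ((· + i) ∘ (· + 1) : ℕ → ℕ) = (· + (i + 1)) := by
      funext x
      simp only [Function.comp_apply]
      omega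
    rw [reducedWord, h2, h1, List.map_append, List.map_append, List.prod_append, desc_eq_prod,
      List.map_map (g := (· + i)), h3]

/-- The quantum symmetrizer of the definition is the recursive one. -/
theorem quantumSymmetrizer_eq (k : Type*) [Field k] (n : ℕ) : quantumSymmetrizer k n =
    qsym (fun i => MonoidAlgebra.of k (Braid n) (Braid.s n i)) 0 n := by
  rw [← sum_reducedWord, quantumSymmetrizer]
  refine Finset.sum_congr rfl fun τ _ => ?_
  rw [matsumoto, map_list_prod, List.map_map]
  simp [Function.comp_def]

end Matsumoto

/-! ### Semisimplicity of the finite quotients -/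

section Semisimple

/-- Semisimple rings are von Neumann regular. -/
theorem exists_mul_mul_eq_self {k G : Type*} [Field k] [CharZero k] [Group G] [Finite G]
    (s : MonoidAlgebra k G) : ∃ t : MonoidAlgebra k G, s * t * s = s := by
  have : NeZero (Nat.card G : k) := ⟨Nat.cast_ne_zero.2 Nat.card_pos.ne'⟩
  -- By Maschke's theorem the left ideal generated by `s` has a complement; `t * s` is the component
  -- of `1` in that ideal.
  obtain ⟨J, hJ⟩ := MonoidAlgebra.Submodule.exists_isCompl
    (Submodule.span (MonoidAlgebra k G) {s})
  obtain ⟨e, he, j, hj, h1⟩ := Submodule.mem_sup.1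
    (hJ.codisjoint.eq_top ▸ Submodule.mem_top : (1 : MonoidAlgebra k G) ∈ _ ⊔ J)
  obtain ⟨t, rfl⟩ := Submodule.mem_span_singleton.1 he
  refine ⟨t, ?_⟩
  have h2 : s * j = s - s * t * s := by
    rw [← eq_sub_iff_add_eq'] at h1
    rw [h1, mul_sub, mul_one, smul_eq_mul, mul_assoc]
  have h3 : s * j ∈ (⊥ : Submodule (MonoidAlgebra k G) (MonoidAlgebra k G)) := by
    rw [← hJ.disjoint.eq_bot]
    refine ⟨?_, J.smul_mem s hj⟩
    rw [h2]
    exact Submodule.sub_mem _ (Submodule.mem_span_singleton_self s)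
      (Submodule.mem_span_singleton.2 ⟨s * t, rfl⟩)
  rw [Submodule.mem_bot, h2, sub_eq_zero] at h3
  exact h3.symm

variable (k : Type*) [Field k]

/-- The average of the elements of a finite subgroup. -/
noncomputable def subgroupAverage {G : Type*} [Group G] (H : Subgroup G) [Fintype H] :
    MonoidAlgebra k G :=
  (Fintype.card H : k)⁻¹ • ∑ h : H, MonoidAlgebra.of k G h

variable {k}

theorem of_mul_subgroupAverage {G : Type*} [Group G] (H : Subgroup G) [Fintype H] {g : G}
    (hg : g ∈ H) : MonoidAlgebra.of k G g * subgroupAverage k H = subgroupAverage k H := by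
  rw [subgroupAverage, mul_smul_comm, Finset.mul_sum,
    ← Equiv.sum_comp (Equiv.mulLeft (⟨g, hg⟩ : H)) fun h : H => MonoidAlgebra.of k G (h : G)]
  simp

theorem subgroupAverage_mul_of {G : Type*} [Group G] (H : Subgroup G) [Fintype H] {g : G}
    (hg : g ∈ H) : subgroupAverage k H * MonoidAlgebra.of k G g = subgroupAverage k H := by
  rw [subgroupAverage, smul_mul_assoc, Finset.sum_mul,
    ← Equiv.sum_comp (Equiv.mulRight (⟨g, hg⟩ : H)) fun h : H => MonoidAlgebra.of k G (h : G)]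
  simp

theorem mul_subgroupAverage_of_forall [CharZero k] {G : Type*} [Group G] (H : Subgroup G)
    [Fintype H] {x : MonoidAlgebra k G} (hx : ∀ h ∈ H, MonoidAlgebra.of k G h * x = x) :
    subgroupAverage k H * x = x := by
  rw [subgroupAverage, smul_mul_assoc, Finset.sum_mul,
    Finset.sum_congr rfl fun (h : H) _ => hx h h.2]
  have : (Fintype.card H : k) ≠ 0 := Nat.cast_ne_zero.2 Fintype.card_ne_zero
  rw [Finset.sum_const, Finset.card_univ, ← Nat.cast_smul_eq_nsmul k, smul_smul,
    inv_mul_cancel₀ this, one_smul]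

theorem map_subgroupAverage [CharZero k] {G G' : Type*} [Group G] [Group G'] (φ : G →* G')
    (H : Subgroup G) [Fintype H] (H' : Subgroup G') [Fintype H'] (hH : H.map φ = H') :
    MonoidAlgebra.mapDomainAlgHom k k φ (subgroupAverage k H) = subgroupAverage k H' := by
  subst hH
  set F := MonoidAlgebra.mapDomainAlgHom k k φ
  have hF : ∀ g, F (MonoidAlgebra.of k G g) = MonoidAlgebra.of k G' (φ g) := fun g => by
    simp [F]
  have h1 : subgroupAverage k (H.map φ) * F (subgroupAverage k H) = F (subgroupAverage k H) := by
    refine mul_subgroupAverage_of_forall _ ?_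
    rintro _ ⟨g, hg, rfl⟩
    rw [← hF, ← map_mul, of_mul_subgroupAverage H hg]
  have h2 : subgroupAverage k (H.map φ) * F (subgroupAverage k H) =
      subgroupAverage k (H.map φ) := by
    have e : F (subgroupAverage k H) = (Fintype.card H : k)⁻¹ •
        ∑ h : H, MonoidAlgebra.of k G' (φ h) := by
      rw [subgroupAverage, map_smul, map_sum]
      simp only [hF]
    have : (Fintype.card H : k) ≠ 0 := Nat.cast_ne_zero.2 Fintype.card_ne_zero
    rw [e, mul_smul_comm, Finset.mul_sum, Finset.sum_congr rfl fun (h : H) _ =>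
      subgroupAverage_mul_of _ (Subgroup.mem_map_of_mem φ h.2), Finset.sum_const,
      Finset.card_univ, ← Nat.cast_smul_eq_nsmul k, smul_smul, inv_mul_cancel₀ this, one_smul]
  rw [← h1, h2]

theorem toLevel_of {n : ℕ} (N : Level n) (g : Braid n) :
    toLevel k N (MonoidAlgebra.of k _ g) =
      MonoidAlgebra.of k _ (QuotientGroup.mk' N.N g) := by
  simp [toLevel]

theorem toLevel_surjective {n : ℕ} (N : Level n) : Function.Surjective (toLevel k N) := by
  intro y
  induction y using MonoidAlgebra.induction_on with
  | of g =>
    obtain ⟨g, rfl⟩ := QuotientGroup.mk'_surjective N.N g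
    exact ⟨_, toLevel_of N g⟩
  | add a b ha hb =>
    obtain ⟨a, rfl⟩ := ha
    obtain ⟨b, rfl⟩ := hb
    exact ⟨a + b, map_add _ _ _⟩
  | smul r a ha =>
    obtain ⟨a, rfl⟩ := ha
    exact ⟨r • a, map_smul _ _ _⟩

theorem toHat_mul {n : ℕ} (x y : MonoidAlgebra k (Braid n)) :
    toHat k n (x * y) = toHat k n x * toHat k n y :=
  Subtype.ext (funext fun N => map_mul (toLevel k N) x y)

variable [CharZero k]

open Classical in
/-- The central idempotent of the completion which projects to the factor `k[B_n / N]`. -/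
theorem exists_idempotent_of_level {n : ℕ} (N : Level n) : ∃ z : BrAssHat k n, z.1 N = 1 ∧
    ∀ y : MonoidAlgebra k (Braid n), toLevel k N y = 0 → toHat k n y * z = 0 := by
  have hfin : ∀ N' : Level n, Fintype (N.N.map (QuotientGroup.mk' N'.N)) :=
    fun N' => Fintype.ofFinite _
  -- In `k[B_n / N']`, the idempotent is the average of the image of `N`.
  let z : ∀ N' : Level n, LevelAlg k N' := fun N' =>
    subgroupAverage k (N.N.map (QuotientGroup.mk' N'.N))
  refine ⟨⟨z, fun N₁ N₂ h => ?_⟩, ?_, fun y hy => ?_⟩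
  · refine map_subgroupAverage _ _ _ ?_
    rw [Subgroup.map_map]
    rfl
  · have e : N.N.map (QuotientGroup.mk' N.N) = ⊥ := QuotientGroup.map_mk'_self N.N
    have h := mul_subgroupAverage_of_forall (k := k) (N.N.map (QuotientGroup.mk' N.N)) (x := 1)
      (by
        rw [e]
        rintro h (rfl : h = 1)
        rw [map_one, one_mul])
    rwa [mul_one] at h
  · refine Subtype.ext (funext fun N' => ?_)
    change toLevel k N' y * z N' = 0
    -- Multiplication by `z` in `k[B_n / N']` factors through `k[B_n / N]`.
    let F : Braid n ⧸ N.N → LevelAlg k N' := fun q =>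
      Quotient.liftOn' q (fun g => MonoidAlgebra.of k _ (QuotientGroup.mk' N'.N g) * z N')
        (fun a b hab => by
          have h : a⁻¹ * b ∈ N.N := QuotientGroup.leftRel_apply.1 hab
          have h2 : b = a * (a⁻¹ * b) := by group
          rw [h2, map_mul, map_mul, mul_assoc,
            of_mul_subgroupAverage _ (Subgroup.mem_map_of_mem _ h)])
    have key : ∀ y : MonoidAlgebra k (Braid n),
        toLevel k N' y * z N' = Finsupp.linearCombination k F (toLevel k N y).coeff := by
      intro y
      induction y using MonoidAlgebra.induction_on with
      | of g =>
        rw [toLevel_of, toLevel_of]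
        change _ = Finsupp.linearCombination k F (Finsupp.single _ 1)
        rw [Finsupp.linearCombination_single, one_smul]
        rfl
      | add a b ha hb => simp [add_mul, ha, hb]
      | smul r a ha => simp [ha]
    rw [key, hy]
    simp

/-- Let `N` be the kernel of a finite quotient of `B_n`. There is an element of `𝔚(n)` which maps
to `1 - t S` in `k[B_n / N]` for some `t`: it is an idempotent projecting to the kernel of the
quantum symmetrizer. -/
theorem exists_wor_eq_one_sub {n : ℕ} (N : Level n) : ∃ x ∈ Wor k n, ∃ t : LevelAlg k N,
    x.1 N = 1 - t * toLevel k N (quantumSymmetrizer k n) := by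
  obtain ⟨z, hz, hz'⟩ := exists_idempotent_of_level (k := k) N
  obtain ⟨t, ht⟩ := exists_mul_mul_eq_self (toLevel k N (quantumSymmetrizer k n))
  obtain ⟨t, rfl⟩ := toLevel_surjective N t
  refine ⟨toHat k n (1 - t * quantumSymmetrizer k n) * z, ?_, toLevel k N t, ?_⟩
  · rw [Wor, LinearMap.mem_ker, LinearMap.mulLeft_apply, ← mul_assoc, ← toHat_mul]
    refine hz' _ ?_
    rw [map_mul, map_sub, map_one, map_mul, mul_sub, mul_one, ← mul_assoc, ht, sub_self]
  · change toLevel k N _ * z.1 N = _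
    rw [hz, mul_one, map_sub, map_one, map_mul]

end Semisimple

/-! ### The action of the quantum symmetrizer on tensor powers -/

section Sym

variable {C : Type u} [Category.{v} C] [Preadditive C] [MonoidalCategory C] [BraidedCategory C]

/-- The generators of `B_n` in the endomorphism ring of `X^{⊗ n}`. -/
def genEnd (X : C) (n : ℕ) (i : ℕ) : End (tpow X n) := (braidGen X n i).hom

/-- The action of the quantum symmetrizer on `X^{⊗ n}`. -/
def sym (X : C) (n : ℕ) : tpow X n ⟶ tpow X n :=
  qsym (R := End (tpow X n)) (genEnd X n) 0 n

theorem braidRel_genEnd (X : C) (n : ℕ) : BraidRel n (genEnd X n) where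
  braid i hi := congrArg Iso.hom ((isBraidSeq_braidGen X n).braid i hi)
  far i j hij hj := congrArg Iso.hom ((isBraidSeq_braidGen X n).far i j hij hj)

theorem sym_zero (X : C) : sym X 0 = 𝟙 _ := rfl

variable [MonoidalPreadditive C]

/-- Endomorphisms of `X^{⊗ a}` act on the first `a` factors of `X^{⊗ (a + b)}`. -/
def endLeft (X : C) (a b : ℕ) : End (tpow X a) →+* End (tpow X (a + b)) where
  toFun g := (catIso X a b).inv ≫ (g : tpow X a ⟶ tpow X a) ▷ tpow X b ≫ (catIso X a b).hom
  map_one' := by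
    change _ ≫ (𝟙 (tpow X a)) ▷ _ ≫ _ = 𝟙 _
    simp
  map_mul' f g := by
    change _ ≫ (_ ≫ _ : tpow X a ⟶ tpow X a) ▷ _ ≫ _ = (_ ≫ _ ≫ _) ≫ (_ ≫ _ ≫ _)
    simp
  map_zero' := by
    change _ ≫ (0 : tpow X a ⟶ tpow X a) ▷ _ ≫ _ = 0
    simp
  map_add' f g := by
    change _ ≫ (_ + _ : tpow X a ⟶ tpow X a) ▷ _ ≫ _ = _ ≫ _ + _ ≫ _
    rw [MonoidalPreadditive.add_whiskerRight, Preadditive.add_comp, Preadditive.comp_add]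

/-- Endomorphisms of `X^{⊗ b}` act on the last `b` factors of `X^{⊗ (a + b)}`. -/
def endRight (X : C) (a b : ℕ) : End (tpow X b) →+* End (tpow X (a + b)) where
  toFun g := (catIso X a b).inv ≫ tpow X a ◁ (g : tpow X b ⟶ tpow X b) ≫ (catIso X a b).hom
  map_one' := by
    change _ ≫ _ ◁ (𝟙 (tpow X b)) ≫ _ = 𝟙 _
    simp
  map_mul' f g := by
    change _ ≫ _ ◁ (_ ≫ _ : tpow X b ⟶ tpow X b) ≫ _ = (_ ≫ _ ≫ _) ≫ (_ ≫ _ ≫ _)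
    simp
  map_zero' := by
    change _ ≫ _ ◁ (0 : tpow X b ⟶ tpow X b) ≫ _ = 0
    simp
  map_add' f g := by
    change _ ≫ _ ◁ (_ + _ : tpow X b ⟶ tpow X b) ≫ _ = _ ≫ _ + _ ≫ _
    rw [MonoidalPreadditive.whiskerLeft_add, Preadditive.add_comp, Preadditive.comp_add]

theorem catIso_braidGen_left (X : C) (a l : ℕ) (h : l + 1 < a) : ∀ b,
    (catIso X a b).hom ≫ (braidGen X (a + b) l).hom =
      (braidGen X a l).hom ▷ tpow X b ≫ (catIso X a b).hom
  | 0 => by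
    rw [catIso_zero]
    exact (rightUnitor_naturality _).symm
  | b + 1 => by
    obtain ⟨a, rfl⟩ : ∃ a', a = a' + 1 := ⟨a - 1, by omega⟩
    have ih := catIso_braidGen_left X (a + 1) l h b
    have e : a + 1 + b = a + b + 1 := by omega
    have key : ∀ m, m = a + b + 1 → (braidGen X (m + 1) l).hom = (braidGen X m l).hom ▷ X := by
      rintro _ rfl
      exact braidGen_ne _ _ _ (by omega)
    have h2 := key _ e
    change (braidGen X (a + 1 + (b + 1)) l).hom = _ at h2
    rw [h2, catIso_succ, Category.assoc, ← comp_whiskerRight, ih]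
    change _ = _ ▷ (tpow X b ⊗ X) ≫ _
    rw [comp_whiskerRight, ← associator_inv_naturality_left_assoc]

theorem catIso_braidGen_right (X : C) (a l : ℕ) : ∀ b, l + 1 < b →
    (catIso X a b).hom ≫ (braidGen X (a + b) (a + l)).hom =
      tpow X a ◁ (braidGen X b l).hom ≫ (catIso X a b).hom
  | 0, h => by omega
  | 1, h => by omega
  | b + 2, h => by
    rcases Nat.lt_or_ge (l + 1) (b + 1) with h' | h'
    · have ih := catIso_braidGen_right X a l (b + 1) h'
      have h1 : (braidGen X (a + (b + 2)) (a + l)).hom = _ :=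
        braidGen_ne X (a + b) (a + l) (by omega)
      rw [h1, braidGen_ne X b l (by omega), catIso_succ, Category.assoc, ← comp_whiskerRight]
      change _ ≫ ((catIso X a (b + 1)).hom ≫ (braidGen X (a + (b + 1)) (a + l)).hom) ▷ X = _
      rw [ih]
      simp
    · obtain rfl : l = b := by omega
      have h1 : (braidGen X (a + (l + 2)) (a + l)).hom = _ := braidGen_last X (a + l)
      rw [h1, braidGen_last, catIso_succ, catIso_succ]
      change _ ≫ (α_ (tpow X (a + l)) X X).hom ≫ _ ≫ (α_ (tpow X (a + l)) X X).inv = _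
      simp only [comp_whiskerRight, Category.assoc, MonoidalCategory.whiskerLeft_comp]
      rw [associator_naturality_left_assoc, ← whisker_exchange_assoc]
      have e : (α_ (tpow X a) (tpow X (l + 1)) X).inv ≫ (α_ (tpow X a) (tpow X l) X).inv ▷ X ≫
          (α_ (tpow X a ⊗ tpow X l) X X).hom ≫ (tpow X a ⊗ tpow X l) ◁ (β_ X X).hom ≫
            (α_ (tpow X a ⊗ tpow X l) X X).inv = tpow X a ◁ (α_ (tpow X l) X X).hom ≫
            tpow X a ◁ tpow X l ◁ (β_ X X).hom ≫ tpow X a ◁ (α_ (tpow X l) X X).inv ≫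
            (α_ (tpow X a) (tpow X (l + 1)) X).inv ≫ (α_ (tpow X a) (tpow X l) X).inv ▷ X := by
        change (α_ (tpow X a) (tpow X l ⊗ X) X).inv ≫ _ = _ ≫ _ ≫ _ ≫
          (α_ (tpow X a) (tpow X l ⊗ X) X).inv ≫ _
        monoidal
      have h2 := congrArg (· ≫ (catIso X a l).hom ▷ X ▷ X) e
      simp only [Category.assoc] at h2
      rw [← h2, associator_inv_naturality_left]

theorem endLeft_genEnd (X : C) {a l : ℕ} (b : ℕ) (h : l + 1 < a) :
    endLeft X a b (genEnd X a l) = genEnd X (a + b) l := by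
  change (catIso X a b).inv ≫ _ = _
  rw [Iso.inv_comp_eq]
  exact (catIso_braidGen_left X a l h b).symm

theorem endRight_genEnd (X : C) (a : ℕ) {b l : ℕ} (h : l + 1 < b) :
    endRight X a b (genEnd X b l) = genEnd X (a + b) (a + l) := by
  change (catIso X a b).inv ≫ _ = _
  rw [Iso.inv_comp_eq]
  exact (catIso_braidGen_right X a l b h).symm

theorem endLeft_qsym (X : C) {a i n : ℕ} (b : ℕ) (h : i + n ≤ a) :
    endLeft X a b (qsym (genEnd X a) i n) = qsym (genEnd X (a + b)) i n := by
  have := map_qsym (s := 0) (g := genEnd X (a + b)) (endLeft X a b) (f := genEnd X a)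
    (i := i) (n := n) fun l h1 h2 => (endLeft_genEnd X b (by omega)).trans (by rw [Nat.zero_add])
  rwa [Nat.zero_add] at this

theorem endRight_qsym (X : C) (a b : ℕ) :
    endRight X a b (qsym (genEnd X b) 0 b) = qsym (genEnd X (a + b)) a b :=
  map_qsym (s := a) (g := genEnd X (a + b)) (endRight X a b) (f := genEnd X b)
    (i := 0) (n := b) fun l h1 h2 => endRight_genEnd X a (by omega)

theorem catIso_endLeft (X : C) (a b : ℕ) (g : End (tpow X a)) :
    (catIso X a b).hom ≫ endLeft X a b g =
      (g : tpow X a ⟶ tpow X a) ▷ tpow X b ≫ (catIso X a b).hom :=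
  Iso.hom_inv_id_assoc _ _

theorem catIso_endRight (X : C) (a b : ℕ) (g : End (tpow X b)) :
    (catIso X a b).hom ≫ endRight X a b g =
      tpow X a ◁ (g : tpow X b ⟶ tpow X b) ≫ (catIso X a b).hom :=
  Iso.hom_inv_id_assoc _ _

/-- The kernels of the quantum symmetrizers form a two-sided ideal of the tensor algebra. -/
theorem ideal_sym {X P : C} (a n b : ℕ) (x : P ⟶ tpow X n) (hx : x ≫ sym X n = 0) :
    (tpow X a ◁ x) ▷ tpow X b ≫ (catIso X a n).hom ▷ tpow X b ≫ (catIso X (a + n) b).hom ≫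
      sym X (a + n + b) = 0 := by
  obtain ⟨y, hy⟩ := exists_qsym_eq_mul (braidRel_genEnd X (a + n + b)) a n b le_rfl
  have h1 : sym X (a + n + b) =
      (endLeft X (a + n) b (endRight X a n (sym X n)) : tpow X (a + n + b) ⟶ _) ≫ y := by
    rw [sym, hy, sym, endRight_qsym, endLeft_qsym X b le_rfl]
    rfl
  have h2 : tpow X a ◁ x ≫ (catIso X a n).hom ≫
      (endRight X a n (sym X n) : tpow X (a + n) ⟶ tpow X (a + n)) = 0 := by
    have h := catIso_endRight X a n (sym X n)
    rw [h, ← MonoidalCategory.whiskerLeft_comp_assoc, hx]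
    simp
  rw [h1, ← Category.assoc (catIso X (a + n) b).hom, catIso_endLeft, Category.assoc,
    ← comp_whiskerRight_assoc, ← comp_whiskerRight_assoc, Category.assoc, h2]
  simp

end Sym

section HatAct

variable {k : Type w} [Field k] {C : Type u} [Category.{v} C] [Preadditive C] [Linear k C]
  [MonoidalCategory C] [BraidedCategory C]

theorem braidAct_s (X : C) {n i : ℕ} (h : i + 1 < n) :
    (braidAct X n (Braid.s n i)).hom = genEnd X n i :=
  congrArg Iso.hom (Braid.lift_s (G := Aut (tpow X n)) _ _ i h)

theorem levelAct_quantumSymmetrizer (X : C) {n : ℕ} (N : Level n)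
    (h : N.N ≤ (braidAct X n).ker) :
    levelAct k X N h (toLevel k N (quantumSymmetrizer k n)) = sym X n := by
  rw [quantumSymmetrizer_eq]
  refine map_qsym (s := 0) (i := 0) (n := n) (g := genEnd X n)
    (((levelAct k X N h).comp (toLevel k N)).toRingHom) fun l _ hl => ?_
  change levelAct k X N h (toLevel k N _) = _
  rw [toLevel_of, levelAct_of, braidAct_s X (by omega), Nat.zero_add]

/-- Elements of `𝔚(n)` act on `X^{⊗ n}` with image in the kernel of the quantum symmetrizer: the
multiplication of endomorphisms is `f * g = g ≫ f`, so in `S x` the element `x` acts first. -/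
theorem hatAct_comp_sym {X : C} (hX : FinitelyBraided X) {n : ℕ} {x : BrAssHat k n}
    (hx : x ∈ Wor k n) : hatAct k X n x ≫ sym X n = 0 := by
  rw [hatAct_eq X (kerLevel (hX n)) le_rfl,
    ← levelAct_quantumSymmetrizer (k := k) X (kerLevel (hX n)) le_rfl]
  refine (map_mul (levelAct k X (kerLevel (hX n)) le_rfl) _ _).symm.trans ?_
  rw [Wor, LinearMap.mem_ker, LinearMap.mulLeft_apply] at hx
  have h := congrArg (fun y : BrAssHat k n => y.1 (kerLevel (hX n))) hx
  change toLevel k _ _ * x.1 _ = 0 at h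
  rw [h, map_zero]

/-- The kernel of the quantum symmetrizer on `X^{⊗ n}` is the image of an element of `𝔚(n)`. -/
theorem exists_hatAct_eq [CharZero k] {X : C} (hX : FinitelyBraided X) (n : ℕ) :
    ∃ x ∈ Wor k n, ∃ t, hatAct k X n x = 𝟙 _ - sym X n ≫ t := by
  obtain ⟨x, hx, t, ht⟩ := exists_wor_eq_one_sub (k := k) (kerLevel (hX n))
  refine ⟨x, hx, levelAct k X (kerLevel (hX n)) le_rfl t, ?_⟩
  rw [hatAct_eq X (kerLevel (hX n)) le_rfl, ht, map_sub, map_one, map_mul]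
  exact congrArg (fun s : tpow X n ⟶ tpow X n => 𝟙 (tpow X n) - s ≫
    (levelAct k X (kerLevel (hX n)) le_rfl t : tpow X n ⟶ tpow X n))
    (levelAct_quantumSymmetrizer X (kerLevel (hX n)) le_rfl)

end HatAct

/-! ### Generalized elements of the tensor algebra -/

section Filtered

variable {C : Type u} [Category.{v} C] [Abelian C]

attribute [local instance] IsFiltered.isConnected in
/-- In an abelian category with exact filtered colimits, a morphism `g` out of `P` vanishes if it
does so on those generalized elements of `P` whose image in a given filtered colimit comes from a
finite stage. -/
theorem eq_zero_of_isColimit {J : Type*} [Category* J] [IsFiltered J] [HasColimitsOfShape J C]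
    [HasExactColimitsOfShape J C] {F : J ⥤ C} {c : Cocone F} (hc : IsColimit c) {P Y : C}
    (x : P ⟶ c.pt) (g : P ⟶ Y)
    (h : ∀ (P' : C) (t : P' ⟶ P) (j : J) (y : P' ⟶ F.obj j), t ≫ x = y ≫ c.ι.app j → t ≫ g = 0) :
    g = 0 := by
  have hp := (IsPullback.of_hasPullback c.ι ((Functor.const J).map x)).map
    (colim : (J ⥤ C) ⥤ C)
  have h1 : IsIso ((colim : (J ⥤ C) ⥤ C).map c.ι) := by
    let e : colimit ((Functor.const J).obj c.pt) ≅ c.pt :=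
      (colimit.isColimit _).coconePointUniqueUpToIso (isColimitConstCocone J c.pt)
    let e' : colimit F ≅ c.pt := (colimit.isColimit F).coconePointUniqueUpToIso hc
    have : colim.map c.ι ≫ e.hom = e'.hom := by
      refine colimit.hom_ext fun j => ?_
      have h2 : colimit.ι ((Functor.const J).obj c.pt) j ≫ e.hom = 𝟙 _ :=
        (colimit.isColimit _).comp_coconePointUniqueUpToIso_hom (isColimitConstCocone J c.pt) j
      have h3 : colimit.ι F j ≫ e'.hom = c.ι.app j :=
        (colimit.isColimit F).comp_coconePointUniqueUpToIso_hom hc j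
      rw [colim_map, ι_colimMap_assoc, h2, h3]
      exact Category.comp_id _
    rw [← Iso.eq_comp_inv] at this
    rw [this]
    infer_instance
  have h2 := hp.isIso_snd_of_isIso
  have j₀ : J := IsFiltered.nonempty.some
  let d : colimit ((Functor.const J).obj P) ⟶ P :=
    colimit.desc _ (constCocone J P)
  have hd : ∀ j, colimit.ι ((Functor.const J).obj P) j ≫ d = 𝟙 P := fun j => colimit.ι_desc _ _
  have h3 : d ≫ g = 0 := by
    rw [← cancel_epi (colim.map (pullback.snd c.ι ((Functor.const J).map x))), comp_zero]
    refine colimit.hom_ext fun j => ?_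
    rw [colim_map, ι_colimMap_assoc, reassoc_of% hd, comp_zero]
    refine (congrArg ((pullback.snd c.ι ((Functor.const J).map x)).app j ≫ ·)
      (Category.id_comp g)).trans (h _ _ j ((pullback.fst c.ι ((Functor.const J).map x)).app j) ?_)
    exact (congrArg (fun t => t.app j) (pullback.condition (f := c.ι)
      (g := (Functor.const J).map x))).symm
  rw [← Category.id_comp g, ← hd j₀, Category.assoc, h3, comp_zero]

variable [MonoidalCategory C] [BraidedCategory C] [HasColimitsOfSize.{w, w} C]
  [AB5OfSize.{w, w} C] [∀ X : C, PreservesColimitsOfSize.{w, w} (tensorLeft X)]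

open CoproductsFromFiniteFiltered in
/-- To show that a morphism vanishes on a generalized element `x` of the tensor algebra, one may
assume that `x` is a finite sum of generalized elements of the tensor powers. -/
theorem tensorAlg.eq_zero_of_finite {X P Y : C} (x : P ⟶ tensorAlg.{w} X) (g : P ⟶ Y)
    (h : ∀ (P' : C) (t : P' ⟶ P) (p : ℕ) (y : ∀ n, P' ⟶ tpow X n),
      t ≫ x = ∑ n ∈ Finset.range p, y n ≫ tensorAlg.inc X n → t ≫ g = 0) : g = 0 := by
  classical
  let f : ULift.{w} ℕ → C := fun n => tpow X n.down
  have : HasExactColimitsOfShape (Finset (Discrete (ULift.{w} ℕ))) C := inferInstance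
  let pr : ∀ n, tensorAlg.{w} X ⟶ tpow X n := fun n =>
    tensorAlg.desc fun m => if h : m = n then eqToHom (congrArg (tpow X) h) else 0
  have hpr : ∀ m n, m ≠ n → tensorAlg.inc.{w} X m ≫ pr n = 0 := fun m n hmn => by
    simp only [pr]
    rw [tensorAlg.inc_desc, dif_neg hmn]
  have hpr' : ∀ n, tensorAlg.inc.{w} X n ≫ pr n = 𝟙 _ := fun n => by
    simp only [pr]
    rw [tensorAlg.inc_desc, dif_pos rfl, eqToHom_refl]
  refine eq_zero_of_isColimit (isColimitFiniteSubproductsCocone f) x g fun P' t s y hy => ?_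
  obtain ⟨p, hp⟩ : ∃ p, ∀ n ∈ s, n.as.down < p :=
    ⟨s.sup (fun n => n.as.down) + 1, fun n hn =>
      Nat.lt_succ_of_le (Finset.le_sup (f := fun n : Discrete (ULift.{w} ℕ) => n.as.down) hn)⟩
  refine h P' t p (fun n => t ≫ x ≫ pr n) ?_
  let c : (∐ fun x : s => (Discrete.functor f).obj x) ⟶ tensorAlg.{w} X :=
    (finiteSubcoproductsCocone f).ι.app s
  have key : c = ∑ n ∈ Finset.range p, c ≫ pr n ≫ tensorAlg.inc X n := by
    refine Sigma.hom_ext _ _ fun i => ?_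
    have hi : Sigma.ι (fun x : s => (Discrete.functor f).obj x) i ≫ c =
      tensorAlg.inc X i.1.as.down := Sigma.ι_desc _ _
    rw [Preadditive.comp_sum, Finset.sum_eq_single i.1.as.down, hi, reassoc_of% hi,
      reassoc_of% hpr']
    · intro n _ hn
      rw [reassoc_of% hi, ← Category.assoc, hpr _ _ hn.symm, zero_comp]
    · intro hn
      exact absurd (Finset.mem_range.2 (hp _ i.2)) hn
  let y' : P' ⟶ ∐ fun x : s => (Discrete.functor f).obj x := y
  have hy' : t ≫ x = y' ≫ c := hy
  have h2 : y' ≫ c = ∑ n ∈ Finset.range p, y' ≫ c ≫ pr n ≫ tensorAlg.inc X n := by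
    conv_lhs => rw [key]
    exact Preadditive.comp_sum _ _ _
  rw [hy', h2]
  refine Finset.sum_congr rfl fun n _ => ?_
  have h3 := congrArg (· ≫ pr n ≫ tensorAlg.inc X n) hy'
  simp only [Category.assoc] at h3 ⊢
  exact h3.symm

end Filtered

/-! ### Permanence properties of finitely braided objects -/

section Finite

variable {C : Type u} [Category.{v} C] [MonoidalCategory C] [BraidedCategory C]

theorem epi_tpowMap {C : Type u} [Category.{v} C] [Abelian C] [MonoidalCategory C]
    [BraidedCategory C] [∀ X : C, PreservesFiniteColimits (tensorLeft X)] {X Y : C} (f : X ⟶ Y)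
    [Epi f] : ∀ n, Epi (tpowMap f n)
  | 0 => inferInstanceAs (Epi (𝟙 _))
  | n + 1 => by
    have := epi_tpowMap f n
    rw [tpowMap]
    infer_instance

/-- A quotient of a finitely braided object is finitely braided. -/
theorem FinitelyBraided.of_epi {C : Type u} [Category.{v} C] [Abelian C] [MonoidalCategory C]
    [BraidedCategory C] [∀ X : C, PreservesFiniteColimits (tensorLeft X)] {X Y : C}
    (hX : FinitelyBraided X) (f : X ⟶ Y) [Epi f] : FinitelyBraided Y := fun n => by
  have := hX n
  have := epi_tpowMap f n
  refine Subgroup.finiteIndex_of_le (H := (braidAct X n).ker) fun g hg => ?_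
  rw [MonoidHom.mem_ker] at hg ⊢
  have h := braidAct_naturality f n g
  rw [hg] at h
  refine Iso.ext ((cancel_epi (tpowMap f n)).1 ?_)
  rw [← h]
  exact (Category.id_comp _).trans (Category.comp_id _).symm

theorem Braid.closure_s (n : ℕ) (K : Subgroup (Braid n))
    (hK : ∀ i, i + 1 < n → Braid.s n i ∈ K) : K = ⊤ := by
  rw [eq_top_iff, ← PresentedGroup.closure_range_of, Subgroup.closure_le]
  rintro _ ⟨i, rfl⟩
  have h := hK i (by omega)
  rwa [Braid.s, dif_pos i.2] at h

/-- The identification of `(X ⊗ X)^{⊗ n}` with `X^{⊗ 2n}`. -/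
def doubleIso (X : C) : ∀ n, tpow (X ⊗ X) n ≅ tpow X (2 * n)
  | 0 => Iso.refl _
  | n + 1 => (α_ (tpow (X ⊗ X) n) X X).symm ≪≫
      whiskerRightIso (whiskerRightIso (doubleIso X n) X) X

/-- The braiding of the last two factors of `(P ⊗ X) ⊗ X`. -/
def lastBraid (P X : C) : (P ⊗ X) ⊗ X ⟶ (P ⊗ X) ⊗ X :=
  (α_ P X X).hom ≫ P ◁ (β_ X X).hom ≫ (α_ P X X).inv

theorem lastBraid_naturality {P Q : C} (d : P ⟶ Q) (X : C) :
    d ▷ X ▷ X ≫ lastBraid Q X = lastBraid P X ≫ d ▷ X ▷ X := by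
  rw [lastBraid, lastBraid, Category.assoc, Category.assoc, ← associator_inv_naturality_left,
    whisker_exchange_assoc, associator_naturality_left_assoc]

/-- The braiding of `X ⊗ X` with itself is the product of four braidings of `X` with itself. -/
theorem braiding_tensor_self {P Q : C} (d : P ⟶ Q) (X : C) :
    ((α_ P (X ⊗ X) (X ⊗ X)).hom ≫ P ◁ (β_ (X ⊗ X) (X ⊗ X)).hom ≫
      (α_ P (X ⊗ X) (X ⊗ X)).inv) ≫ (α_ (P ⊗ (X ⊗ X)) X X).inv ≫
        ((α_ P X X).inv ≫ d ▷ X ▷ X) ▷ X ▷ X =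
    ((α_ (P ⊗ (X ⊗ X)) X X).inv ≫ ((α_ P X X).inv ≫ d ▷ X ▷ X) ▷ X ▷ X) ≫
      lastBraid (Q ⊗ X) X ▷ X ≫ lastBraid ((Q ⊗ X) ⊗ X) X ≫ lastBraid Q X ▷ X ▷ X ≫
      lastBraid (Q ⊗ X) X ▷ X := by
  have h1 : d ▷ X ▷ X ▷ X ▷ X ≫ lastBraid (Q ⊗ X) X ▷ X =
      lastBraid (P ⊗ X) X ▷ X ≫ d ▷ X ▷ X ▷ X ▷ X := by
    rw [← comp_whiskerRight, lastBraid_naturality, comp_whiskerRight]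
  have h2 : d ▷ X ▷ X ▷ X ▷ X ≫ lastBraid ((Q ⊗ X) ⊗ X) X =
      lastBraid ((P ⊗ X) ⊗ X) X ≫ d ▷ X ▷ X ▷ X ▷ X := lastBraid_naturality _ _
  have h3 : d ▷ X ▷ X ▷ X ▷ X ≫ lastBraid Q X ▷ X ▷ X =
      lastBraid P X ▷ X ▷ X ≫ d ▷ X ▷ X ▷ X ▷ X := by
    rw [← comp_whiskerRight, ← comp_whiskerRight, lastBraid_naturality, comp_whiskerRight,
      comp_whiskerRight]
  have h : (α_ P (X ⊗ X) (X ⊗ X)).hom ≫ P ◁ (β_ (X ⊗ X) (X ⊗ X)).hom ≫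
      (α_ P (X ⊗ X) (X ⊗ X)).inv ≫ (α_ (P ⊗ (X ⊗ X)) X X).inv ≫ (α_ P X X).inv ▷ X ▷ X =
    (α_ (P ⊗ (X ⊗ X)) X X).inv ≫ (α_ P X X).inv ▷ X ▷ X ≫
      lastBraid (P ⊗ X) X ▷ X ≫ lastBraid ((P ⊗ X) ⊗ X) X ≫ lastBraid P X ▷ X ▷ X ≫
      lastBraid (P ⊗ X) X ▷ X := by
    rw [BraidedCategory.braiding_tensor_left_hom, BraidedCategory.braiding_tensor_right_hom]
    simp only [lastBraid]
    monoidal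
  simp only [comp_whiskerRight, Category.assoc]
  rw [reassoc_of% h1, reassoc_of% h2, reassoc_of% h3, h1]
  have h' := congrArg (· ≫ d ▷ X ▷ X ▷ X ▷ X) h
  simp only [Category.assoc] at h'
  exact h'

/-- The generators of `B_n` act on `(X ⊗ X)^{⊗ n}` as elements of `B_{2n}` on `X^{⊗ 2n}`. -/
theorem braidGen_doubleIso (X : C) : ∀ n i, i + 1 < n → ∃ g ∈ (braidAct X (2 * n)).range,
    (braidGen (X ⊗ X) n i).hom ≫ (doubleIso X n).hom = (doubleIso X n).hom ≫ g.hom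
  | 0, i, h => by omega
  | 1, i, h => by omega
  | n + 2, i, h => by
    obtain ⟨a, ha⟩ : ∃ a : ℕ → Aut (tpow X (2 * n + 2 + 2)), ∀ j, j + 1 < 2 * n + 2 + 2 →
        a j ∈ (braidAct X (2 * (n + 2))).range ∧ (a j).hom = (braidGen X (2 * n + 2 + 2) j).hom :=
      ⟨fun j => braidAct X (2 * (n + 2)) (Braid.s _ j), fun j hj => ⟨⟨_, rfl⟩,
        congrArg Iso.hom (Braid.lift_s (G := Aut (tpow X (2 * n + 2 + 2))) _ _ j hj)⟩⟩
    by_cases hi : i = n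
    · subst hi
      refine ⟨a (2 * i + 1) * a (2 * i) * a (2 * i + 2) * a (2 * i + 1),
        mul_mem (mul_mem (mul_mem (ha _ (by omega)).1 (ha _ (by omega)).1) (ha _ (by omega)).1)
          (ha _ (by omega)).1, ?_⟩
      change _ = _ ≫ ((a (2 * i + 1)).hom ≫ (a (2 * i + 2)).hom ≫ (a (2 * i)).hom ≫
        (a (2 * i + 1)).hom)
      rw [(ha _ (by omega)).2, (ha _ (by omega)).2, (ha _ (by omega)).2, braidGen_last,
        braidGen_last, braidGen_ne X (2 * i + 2) _ (by omega), braidGen_last,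
        braidGen_ne X (2 * i + 2) _ (by omega), braidGen_ne X (2 * i + 1) _ (by omega),
        braidGen_last]
      exact braiding_tensor_self (doubleIso X i).hom X
    · obtain ⟨_, ⟨g, rfl⟩, h1⟩ := braidGen_doubleIso X (n + 1) i (by omega)
      let φ : Aut (tpow X (2 * n + 2)) →* Aut (tpow X (2 * n + 2 + 2)) :=
        { toFun := fun f => whiskerRightIso (whiskerRightIso f X) X
          map_one' := Iso.ext (by
            change 𝟙 (tpow X (2 * n + 2)) ▷ X ▷ X = 𝟙 _
            rw [id_whiskerRight, id_whiskerRight])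
          map_mul' := fun f g => Iso.ext (by
            change (g.hom ≫ f.hom) ▷ X ▷ X = g.hom ▷ X ▷ X ≫ f.hom ▷ X ▷ X
            rw [comp_whiskerRight, comp_whiskerRight]) }
      have hφ : (braidAct X (2 * (n + 1))).range ≤
          ((braidAct X (2 * (n + 2))).range).comap φ := by
        rw [MonoidHom.range_eq_map, Subgroup.map_le_iff_le_comap, top_le_iff]
        refine Braid.closure_s (2 * (n + 1)) _ fun j hj => ?_
        obtain ⟨h2, h3⟩ := ha j (by omega)
        change φ (braidAct X (2 * (n + 1)) (Braid.s _ j)) ∈ (braidAct X (2 * (n + 2))).range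
        have h4 : φ (braidAct X (2 * (n + 1)) (Braid.s _ j)) = a j := by
          refine Iso.ext ?_
          change (braidAct X (2 * (n + 1)) (Braid.s _ j)).hom ▷ X ▷ X = _
          rw [h3, braidGen_ne X (2 * n + 2) j (by omega), braidGen_ne X (2 * n + 1) j (by omega)]
          congr 2
          exact congrArg Iso.hom (Braid.lift_s (G := Aut (tpow X (2 * (n + 1)))) _ _ j hj)
        rw [h4]
        exact h2
      refine ⟨φ (braidAct X (2 * (n + 1)) g), hφ ⟨g, rfl⟩, ?_⟩
      rw [braidGen_ne _ _ _ hi]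
      change _ ▷ (X ⊗ X) ≫ (α_ (tpow (X ⊗ X) (n + 1)) X X).inv ≫
        (doubleIso X (n + 1)).hom ▷ X ▷ X = ((α_ (tpow (X ⊗ X) (n + 1)) X X).inv ≫
        (doubleIso X (n + 1)).hom ▷ X ▷ X) ≫ (braidAct X (2 * (n + 1)) g).hom ▷ X ▷ X
      rw [associator_inv_naturality_left_assoc, Category.assoc, ← comp_whiskerRight,
        ← comp_whiskerRight, h1]
      simp

/-- The tensor square of a finitely braided object is finitely braided. -/
theorem FinitelyBraided.tensor {X : C} (hX : FinitelyBraided X) :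
    FinitelyBraided (X ⊗ X) := fun n => by
  have := hX (2 * n)
  have hfin : Finite (braidAct X (2 * n)).range :=
    Finite.of_equiv _ (QuotientGroup.quotientKerEquivRange (braidAct X (2 * n))).toEquiv
  let e : Aut (tpow X (2 * n)) ≃* Aut (tpow (X ⊗ X) n) := Aut.autMulEquivOfIso (doubleIso X n).symm
  let H : Subgroup (Aut (tpow (X ⊗ X) n)) := (braidAct X (2 * n)).range.map e.toMonoidHom
  have hH : (braidAct (X ⊗ X) n).range ≤ H := by
    rw [MonoidHom.range_eq_map, Subgroup.map_le_iff_le_comap, top_le_iff]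
    refine Braid.closure_s n _ fun i hi => ?_
    obtain ⟨g, hg, h⟩ := braidGen_doubleIso X n i hi
    refine ⟨g, hg, ?_⟩
    rw [show braidAct (X ⊗ X) n (Braid.s n i) = braidGen (X ⊗ X) n i from
      Braid.lift_s (G := Aut (tpow (X ⊗ X) n)) _ _ i hi]
    refine Iso.ext ?_
    change (doubleIso X n).hom ≫ g.hom ≫ (doubleIso X n).inv = _
    rw [← Category.assoc, ← h, Category.assoc, Iso.hom_inv_id, Category.comp_id]
  have hfin' : Finite H := Set.Finite.image _ (Set.toFinite _)
  have : Finite (braidAct (X ⊗ X) n).range :=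
    Finite.of_injective _ (Subgroup.inclusion_injective hH)
  exact Subgroup.finiteIndex_ker _

end Finite

/-! ### The action of cabled braids -/

section Cables

variable {C : Type u} [Category.{v} C] [MonoidalCategory C] [BraidedCategory C]

/-- Concatenation `(X^{⊗ j} ⊗ X) ⊗ X^{⊗ n} ≅ X^{⊗ (j + n + 1)}`: this is `catIso X (j + 1) n` up to
the identification of `j + 1 + n` with `j + n + 1`. -/
def catIsoSucc (X : C) (j : ℕ) : ∀ n, (tpow X j ⊗ X) ⊗ tpow X n ≅ tpow X (j + n + 1)
  | 0 => ρ_ (tpow X j ⊗ X)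
  | n + 1 => (α_ (tpow X j ⊗ X) (tpow X n) X).symm ≪≫ whiskerRightIso (catIsoSucc X j n) X

theorem catIsoSucc_succ (X : C) (j n : ℕ) : (catIsoSucc X j (n + 1)).hom =
    (α_ (tpow X j ⊗ X) (tpow X n) X).inv ≫ (catIsoSucc X j n).hom ▷ X := rfl

theorem catIsoSucc_eq (X : C) (j : ℕ) : ∀ n (h : j + 1 + n = j + n + 1), (catIsoSucc X j n).hom =
    (catIso X (j + 1) n).hom ≫ eqToHom (congrArg (tpow X) h)
  | 0, h => by
    rw [eqToHom_refl, Category.comp_id]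
    rfl
  | n + 1, h => by
    rw [catIsoSucc_succ, catIsoSucc_eq X j n (by omega), catIso_succ, comp_whiskerRight,
      eqToHom_succ X (show j + 1 + n = j + n + 1 by omega) h, Category.assoc]

/-- The generators of `B_n` in the automorphism group of `X^{⊗ n}`. -/
def genAut (X : C) (n : ℕ) : ℕ → Aut (tpow X n) := braidGen X n

theorem braidGen_succ (X : C) {n i : ℕ} (h : i + 1 < n) : (braidGen X (n + 1) i).hom =
    (braidGen X n i).hom ▷ X := by
  obtain ⟨n, rfl⟩ : ∃ m, n = m + 1 := ⟨n - 1, by omega⟩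
  exact braidGen_ne X n i (by omega)

theorem braidGen_lastBraid (X : C) (n : ℕ) :
    (braidGen X (n + 2) n).hom = lastBraid (tpow X n) X := braidGen_last X n

theorem ascProd_braidGen_succ (X : C) {N j : ℕ} : ∀ n, j + n < N →
    (ascProd (genAut X (N + 1)) j n).hom =
      (ascProd (genAut X N) j n).hom ▷ X
  | 0, _ => (id_whiskerRight _ _).symm
  | n + 1, h => by
    change (braidGen X (N + 1) (j + n)).hom ≫ (ascProd (genAut X (N + 1)) j n).hom =
      ((braidGen X N (j + n)).hom ≫ (ascProd (genAut X N) j n).hom) ▷ X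
    rw [ascProd_braidGen_succ X n (by omega), comp_whiskerRight, braidGen_succ X (by omega)]

theorem descProd_braidGen_succ (X : C) {N j : ℕ} : ∀ n, j + n < N →
    (descProd (genAut X (N + 1)) j n).hom =
      (descProd (genAut X N) j n).hom ▷ X
  | 0, _ => (id_whiskerRight _ _).symm
  | n + 1, h => by
    change (descProd (genAut X (N + 1)) j n).hom ≫ (braidGen X (N + 1) (j + n)).hom =
      ((descProd (genAut X N) j n).hom ≫ (braidGen X N (j + n)).hom) ▷ X
    rw [descProd_braidGen_succ X n (by omega), comp_whiskerRight, braidGen_succ X (by omega)]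

/-- The ascending product of `n` generators moves the last strand in front of the preceding
`n` strands. -/
theorem catIso_ascProd (X : C) (j : ℕ) : ∀ n,
    (catIso X j n).hom ▷ X ≫
        (ascProd (genAut X (j + n + 1)) j n).hom =
      (α_ (tpow X j) (tpow X n) X).hom ≫ tpow X j ◁ (β_ (tpow X n) X).hom ≫
        (α_ (tpow X j) X (tpow X n)).inv ≫ (catIsoSucc X j n).hom
  | 0 => by
    change (ρ_ (tpow X j)).hom ▷ X ≫ 𝟙 (tpow X j ⊗ X) = _ ≫ _ ◁ (β_ (𝟙_ C) X).hom ≫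
      (α_ (tpow X j) X (𝟙_ C)).inv ≫ (ρ_ (tpow X j ⊗ X)).hom
    rw [braiding_tensorUnit_left]
    monoidal
  | n + 1 => by
    have ih := catIso_ascProd X j n
    have h1 : (ascProd (genAut X (j + n + 2)) j (n + 1)).hom =
        lastBraid (tpow X (j + n)) X ≫
        (ascProd (genAut X (j + n + 1)) j n).hom ▷ X := by
      rw [← ascProd_braidGen_succ X n (by omega), ← braidGen_lastBraid]
      rfl
    refine (congrArg ((catIso X j (n + 1)).hom ▷ X ≫ ·) h1).trans ?_
    rw [catIso_succ, catIsoSucc_succ, comp_whiskerRight, Category.assoc]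
    have h2 := lastBraid_naturality (catIso X j n).hom X
    have h3 : lastBraid (tpow X j ⊗ tpow X n) X ≫ (α_ (tpow X j) (tpow X n) X).hom ▷ X ≫
        (tpow X j ◁ (β_ (tpow X n) X).hom) ▷ X ≫ (α_ (tpow X j) X (tpow X n)).inv ▷ X =
        (α_ (tpow X j) (tpow X n) X).hom ▷ X ≫ (α_ (tpow X j) (tpow X n ⊗ X) X).hom ≫
        tpow X j ◁ (β_ (tpow X n ⊗ X) X).hom ≫ (α_ (tpow X j) X (tpow X n ⊗ X)).inv ≫
        (α_ (tpow X j ⊗ X) (tpow X n) X).inv := by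
      rw [BraidedCategory.braiding_tensor_left_hom, lastBraid]
      monoidal
    have h4 : (α_ (tpow X j) (tpow X n) X).inv ▷ X ≫ (α_ (tpow X j) (tpow X n) X).hom ▷ X =
        𝟙 _ := by
      rw [← comp_whiskerRight, Iso.inv_hom_id, id_whiskerRight]
    have h5 := congrArg ((α_ (tpow X j) (tpow X n) X).inv ▷ X ≫ · ≫ (catIsoSucc X j n).hom ▷ X) h3
    simp only [Category.assoc] at h5
    rw [reassoc_of% h2, ← comp_whiskerRight, ih]
    simp only [comp_whiskerRight]
    rw [h5, reassoc_of% h4]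

/-- The descending product of `n` generators moves the strand in position `j` behind the
following `n` strands. -/
theorem catIsoSucc_descProd (X : C) (j : ℕ) : ∀ n,
    (catIsoSucc X j n).hom ≫
        (descProd (genAut X (j + n + 1)) j n).hom =
      (α_ (tpow X j) X (tpow X n)).hom ≫ tpow X j ◁ (β_ X (tpow X n)).hom ≫
        (α_ (tpow X j) (tpow X n) X).inv ≫ (catIso X j n).hom ▷ X
  | 0 => by
    change (ρ_ (tpow X j ⊗ X)).hom ≫ 𝟙 (tpow X j ⊗ X) = _ ≫ _ ◁ (β_ X (𝟙_ C)).hom ≫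
      (α_ (tpow X j) (𝟙_ C) X).inv ≫ (ρ_ (tpow X j)).hom ▷ X
    rw [braiding_tensorUnit_right]
    monoidal
  | n + 1 => by
    have ih := catIsoSucc_descProd X j n
    have h1 : (descProd (genAut X (j + n + 2)) j (n + 1)).hom =
        (descProd (genAut X (j + n + 1)) j n).hom ▷ X ≫
        lastBraid (tpow X (j + n)) X := by
      rw [← descProd_braidGen_succ X n (by omega), ← braidGen_lastBraid]
      rfl
    refine (congrArg ((catIsoSucc X j (n + 1)).hom ≫ ·) h1).trans ?_
    have h2 := lastBraid_naturality (catIso X j n).hom X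
    rw [catIso_succ, catIsoSucc_succ, comp_whiskerRight, Category.assoc,
      ← comp_whiskerRight_assoc, ih]
    simp only [comp_whiskerRight, Category.assoc]
    rw [h2]
    have h3 : (α_ (tpow X j ⊗ X) (tpow X n) X).inv ≫ (α_ (tpow X j) X (tpow X n)).hom ▷ X ≫
        (tpow X j ◁ (β_ X (tpow X n)).hom) ▷ X ≫ (α_ (tpow X j) (tpow X n) X).inv ▷ X ≫
        lastBraid (tpow X j ⊗ tpow X n) X = (α_ (tpow X j) X (tpow X n ⊗ X)).hom ≫
        tpow X j ◁ (β_ X (tpow X n ⊗ X)).hom ≫ (α_ (tpow X j) (tpow X n ⊗ X) X).inv ≫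
        (α_ (tpow X j) (tpow X n) X).inv ▷ X := by
      rw [BraidedCategory.braiding_tensor_right_hom, lastBraid]
      monoidal
    have h5 := congrArg (· ≫ (catIso X j n).hom ▷ X ▷ X) h3
    simp only [Category.assoc] at h5
    exact h5

/-- The morphism `X^{⊗ N} ⟶ X^{⊗ m}` applying an `n`-ary operation to the factors in positions
`i, …, i + n - 1`, and zero if `m + n ≠ N + 1` or `m ≤ i`. -/
def insertPos [HasZeroMorphisms C] {X : C} {n : ℕ} (g : tpow X n ⟶ X) (N m i : ℕ) :
    tpow X N ⟶ tpow X m :=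
  if h : i < m ∧ m + n = N + 1 then
    eqToHom (congrArg (tpow X) (show N = i + n + (m - 1 - i) by omega)) ≫
      insertAt i g (m - 1 - i) ≫
      eqToHom (congrArg (tpow X) (show i + 1 + (m - 1 - i) = m by omega))
  else 0

variable [Preadditive C] [MonoidalPreadditive C]

theorem insertPos_eq {X : C} {n : ℕ} (g : tpow X n ⟶ X) (a b : ℕ) :
    insertPos g (a + n + b) (a + 1 + b) a = insertAt a g b := by
  have key : ∀ c (h1 : a + n + b = a + n + c) (h2 : a + 1 + c = a + 1 + b),
      eqToHom (congrArg (tpow X) h1) ≫ insertAt a g c ≫ eqToHom (congrArg (tpow X) h2) =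
        insertAt a g b := by
    intro c h1 h2
    obtain rfl : c = b := by omega
    simp
  rw [insertPos, dif_pos ⟨by omega, by omega⟩]
  exact key (a + 1 + b - 1 - a) (by omega) (by omega)

theorem insertPos_last {X : C} {n : ℕ} (g : tpow X n ⟶ X) (a : ℕ) :
    insertPos g (a + n) (a + 1) a = (catIso X a n).inv ≫ tpow X a ◁ g :=
  insertPos_eq g a 0

theorem insertPos_succ {X : C} {n : ℕ} (g : tpow X n ⟶ X) {N m i : ℕ} (h : i < m)
    (h' : m + n = N + 1) : insertPos g (N + 1) (m + 1) i = insertPos g N m i ▷ X := by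
  obtain ⟨b, rfl⟩ : ∃ b, m = i + 1 + b := ⟨m - (i + 1), by omega⟩
  obtain rfl : N = i + n + b := by omega
  rw [insertPos_eq]
  exact insertPos_eq g i (b + 1)

theorem insertPos_last_succ {X : C} {n : ℕ} (g : tpow X n ⟶ X) (j : ℕ) :
    insertPos g (j + n + 1) (j + 2) (j + 1) = (catIsoSucc X j n).inv ≫ (tpow X j ⊗ X) ◁ g := by
  have key : ∀ N (h : j + 1 + n = N), insertPos g N (j + 2) (j + 1) =
      eqToHom (congrArg (tpow X) h.symm) ≫ (catIso X (j + 1) n).inv ≫ (tpow X j ⊗ X) ◁ g := by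
    rintro _ rfl
    rw [eqToHom_refl, Category.id_comp]
    exact insertPos_last g (j + 1)
  rw [key _ (by omega), ← Category.assoc]
  congr 1
  rw [← cancel_epi (catIsoSucc X j n).hom, Iso.hom_inv_id, catIsoSucc_eq X j n (by omega)]
  simp

theorem cableGen_braidGen_succ (X : C) {m n N : ℕ} (hN : m + n = N + 1) {i j : ℕ} (hi : i < m)
    (hj : j + 1 < m) :
    (cableGen (genAut X (N + 1)) n j i).hom =
      (cableGen (genAut X N) n j i).hom ▷ X := by
  rcases lt_trichotomy i j with h | rfl | h
  · rw [cableGen_lt _ _ h, cableGen_lt _ _ h]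
    exact braidGen_succ X (by omega)
  · rw [cableGen_left, cableGen_left]
    exact ascProd_braidGen_succ X n (by omega)
  · rcases Nat.eq_or_lt_of_le h with rfl | h
    · rw [cableGen_right, cableGen_right]
      exact descProd_braidGen_succ X n (by omega)
    · rw [cableGen_gt _ _ h, cableGen_gt _ _ h]
      exact braidGen_succ X (by omega)

/-- Cabling a generator commutes with the application of an operation to the cabled strands. -/
theorem cableGen_insertPos {X : C} {n : ℕ} (g : tpow X n ⟶ X) : ∀ (m N i j : ℕ),
    m + n = N + 1 → i < m → j + 1 < m →
    (cableGen (genAut X N) n j i).hom ≫ insertPos g N m (swapPos j i) =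
      insertPos g N m i ≫ (braidGen X m j).hom
  | 0, _, _, _, _, _, hj => by omega
  | 1, _, _, _, _, _, hj => by omega
  | m + 2, N, i, j, hN, hi, hj => by
    obtain ⟨N, rfl⟩ : ∃ N', N = N' + 1 := ⟨N - 1, by omega⟩
    by_cases hj' : j + 1 < m + 1
    · by_cases hi' : i < m + 1
      · rw [insertPos_succ g (swapPos_lt hj' hi') (by omega), insertPos_succ g hi' (by omega),
          braidGen_succ X hj', cableGen_braidGen_succ X (m := m + 1) (by omega) hi' hj',
          ← comp_whiskerRight, ← comp_whiskerRight,
          cableGen_insertPos g (m + 1) N i j (by omega) hi' hj']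
      · obtain rfl : i = m + 1 := by omega
        have e : N + 1 = m + 1 + n := by omega
        rw [e, cableGen_gt _ _ hj', swapPos_of_ne (by omega) (by omega), insertPos_last,
          braidGen_succ X hj']
        change (braidGen X (m + 1 + n) j).hom ≫ _ = _
        have h := catIso_braidGen_left X (m + 1) j hj' n
        rw [← Iso.eq_inv_comp] at h
        rw [h]
        simp only [Category.assoc, Iso.hom_inv_id_assoc]
        rw [whisker_exchange]
    · obtain rfl : j = m := by omega
      rcases Nat.lt_or_ge i j with h | h
      · have e : j + n = j + n - 1 + 1 := by omega
        obtain ⟨N, rfl⟩ : ∃ N', N = N' + 1 := ⟨N - 1, by omega⟩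
        rw [cableGen_lt _ _ h, swapPos_of_ne (by omega) (by omega),
          insertPos_succ g (m := j + 1) (by omega) (by omega),
          insertPos_succ g (m := j) (by omega) (by omega), show j + n - 1 = N by omega,
          braidGen_lastBraid]
        change (braidGen X (N + 2) N).hom ≫ _ = _
        rw [braidGen_lastBraid, lastBraid_naturality]
      · rcases Nat.eq_or_lt_of_le h with rfl | h
        · obtain rfl : N = j + n := by omega
          rw [cableGen_left, swapPos_left, insertPos_last_succ,
            insertPos_succ g (m := j + 1) (by omega) (by omega), insertPos_last,
            braidGen_lastBraid]
          have h := catIso_ascProd X j n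
          rw [← cancel_epi ((catIso X j n).hom ▷ X), reassoc_of% h, Iso.hom_inv_id_assoc,
            comp_whiskerRight, Category.assoc, ← comp_whiskerRight_assoc, Iso.hom_inv_id,
            id_whiskerRight, Category.id_comp, lastBraid]
          have h2 : (β_ (tpow X n) X).hom ≫ X ◁ g = g ▷ X ≫ (β_ X X).hom :=
            (BraidedCategory.braiding_naturality_left g X).symm
          rw [associator_naturality_middle_assoc, ← whiskerLeft_comp_assoc, ← h2]
          simp
        · obtain rfl : i = j + 1 := by omega
          obtain rfl : N = j + n := by omega
          rw [cableGen_right, swapPos_right, insertPos_last_succ,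
            insertPos_succ g (m := j + 1) (by omega) (by omega), insertPos_last,
            braidGen_lastBraid]
          have h := catIsoSucc_descProd X j n
          rw [← cancel_epi (catIsoSucc X j n).hom, reassoc_of% h, Category.assoc,
            Iso.hom_inv_id_assoc,
            ← comp_whiskerRight, Iso.hom_inv_id_assoc, lastBraid]
          have h2 : (β_ X (tpow X n)).hom ≫ g ▷ X = X ◁ g ≫ (β_ X X).hom :=
            (BraidedCategory.braiding_naturality_right X g).symm
          rw [tensor_whiskerLeft]
          simp only [Category.assoc, Iso.inv_hom_id_assoc]
          rw [← whiskerLeft_comp_assoc, ← h2]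
          simp

end Cables

/-! ### Finitely braided monoids are algebras over the Woronowicz operad -/

section CompLevel

variable {k : Type*} [Field k] {a b n : ℕ} (R : Level (a + n + b))

theorem compLevel_add_left (x x' : LevelAlg k (outerLevel R)) (y : LevelAlg k (innerLevel R)) :
    compLevel k R (x + x') y = compLevel k R x y + compLevel k R x' y := by
  classical
  rw [compLevel, MonoidAlgebra.coeff_add]
  exact Finsupp.sum_add_index' (fun p => by simp) fun p r s => by
    rw [← Finsupp.sum_add]
    simp only [add_mul, add_smul]

theorem compLevel_smul_left (r : k) (x : LevelAlg k (outerLevel R))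
    (y : LevelAlg k (innerLevel R)) :
    compLevel k R (r • x) y = r • compLevel k R x y := by
  classical
  rw [compLevel, MonoidAlgebra.coeff_smul, Finsupp.sum_smul_index' (fun p => by simp), compLevel,
    Finsupp.smul_sum]
  simp only [Finsupp.smul_sum, smul_smul, smul_eq_mul, mul_assoc]

theorem compLevel_add_right (x : LevelAlg k (outerLevel R)) (y y' : LevelAlg k (innerLevel R)) :
    compLevel k R x (y + y') = compLevel k R x y + compLevel k R x y' := by
  classical
  simp only [compLevel, MonoidAlgebra.coeff_add]
  rw [← Finsupp.sum_add]
  congr 1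
  funext p r
  exact Finsupp.sum_add_index' (fun p => by simp) fun p r s => by rw [mul_add, add_smul]

theorem compLevel_smul_right (r : k) (x : LevelAlg k (outerLevel R))
    (y : LevelAlg k (innerLevel R)) :
    compLevel k R x (r • y) = r • compLevel k R x y := by
  classical
  simp only [compLevel, MonoidAlgebra.coeff_smul]
  rw [Finsupp.smul_sum]
  congr 1
  funext p s
  rw [Finsupp.sum_smul_index' (fun p => by simp), Finsupp.smul_sum]
  simp only [smul_smul, smul_eq_mul, mul_left_comm]

theorem compLevel_of (p : Braid (a + 1 + b) ⧸ (outerLevel R).N) (q : Braid n ⧸ (innerLevel R).N) :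
    compLevel k R (MonoidAlgebra.of k _ p) (MonoidAlgebra.of k _ q) =
      MonoidAlgebra.of k _ (cableLevel R p q) := by
  classical
  simp only [compLevel, MonoidAlgebra.of_apply, MonoidAlgebra.coeff_single]
  rw [Finsupp.sum_single_index (by simp), Finsupp.sum_single_index (by simp), mul_one, one_smul]

end CompLevel

section Cabling

theorem map_ascProd {G H : Type*} [Group G] [Group H] (φ : G →* H) {f : ℕ → G} {g : ℕ → H}
    (j : ℕ) : ∀ n, (∀ l, l < j + n → φ (f l) = g l) → φ (ascProd f j n) = ascProd g j n
  | 0, _ => map_one φ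
  | n + 1, h => by
    rw [ascProd, ascProd, map_mul, map_ascProd φ j n fun l hl => h l (by omega), h _ (by omega)]

theorem map_descProd {G H : Type*} [Group G] [Group H] (φ : G →* H) {f : ℕ → G} {g : ℕ → H}
    (j : ℕ) : ∀ n, (∀ l, l < j + n → φ (f l) = g l) → φ (descProd f j n) = descProd g j n
  | 0, _ => map_one φ
  | n + 1, h => by
    rw [descProd, descProd, map_mul, map_descProd φ j n fun l hl => h l (by omega), h _ (by omega)]

theorem map_cableGen {G H : Type*} [Group G] [Group H] (φ : G →* H) {f : ℕ → G} {g : ℕ → H}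
    {m n N i j : ℕ} (hN : m + n = N + 1) (hi : i < m) (hj : j + 1 < m)
    (h : ∀ l, l + 1 < N → φ (f l) = g l) : φ (cableGen f n j i) = cableGen g n j i := by
  unfold cableGen
  split_ifs
  · exact h _ (by omega)
  · exact map_ascProd φ j n fun l hl => h l (by omega)
  · exact map_descProd φ j n fun l hl => h l (by omega)
  · exact h _ (by omega)

end Cabling

section QuotAct

variable {C : Type u} [Category.{v} C] [MonoidalCategory C] [BraidedCategory C]

/-- The action on `X^{⊗ N}` of a quotient of `B_N` through which `B_N` acts. -/
def quotAct (X : C) {N : ℕ} (R : Level N) (h : R.N ≤ (braidAct X N).ker) :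
    Braid N ⧸ R.N →* Aut (tpow X N) :=
  QuotientGroup.lift R.N (braidAct X N) h

theorem quotAct_s (X : C) {N : ℕ} (R : Level N) (h : R.N ≤ (braidAct X N).ker) {l : ℕ}
    (hl : l + 1 < N) : quotAct X R h (QuotientGroup.mk' R.N (Braid.s N l)) = genAut X N l :=
  Braid.lift_s (G := Aut (tpow X N)) (genAut X N) (isBraidSeq_braidGen X N) l hl

variable [Preadditive C] [MonoidalPreadditive C]

/-- The compatibility of cabling with the application of an operation to the cabled strands. -/
theorem cableLevelHom_insertPos {X : C} {a b n : ℕ} (R : Level (a + n + b))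
    (h : R.N ≤ (braidAct X (a + n + b)).ker) (g : tpow X n ⟶ X) (σ : Braid (a + 1 + b))
    (p : Fin (a + 1 + b) × (Braid (a + n + b) ⧸ R.N)) :
    (quotAct X R h (cableLevelHom R σ p).2).hom ≫
        insertPos g (a + n + b) (a + 1 + b) (cableLevelHom R σ p).1 =
      (quotAct X R h p.2).hom ≫ insertPos g (a + n + b) (a + 1 + b) p.1 ≫
        (braidAct X (a + 1 + b) σ).hom := by
  let K : Subgroup (Braid (a + 1 + b)) :=
    { carrier := {σ | ∀ p : Fin (a + 1 + b) × (Braid (a + n + b) ⧸ R.N),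
        (quotAct X R h (cableLevelHom R σ p).2).hom ≫
          insertPos g (a + n + b) (a + 1 + b) (cableLevelHom R σ p).1 =
        (quotAct X R h p.2).hom ≫ insertPos g (a + n + b) (a + 1 + b) p.1 ≫
          (braidAct X (a + 1 + b) σ).hom}
      one_mem' := fun p => by
        rw [map_one, map_one]
        exact (congrArg (_ ≫ ·) (Category.comp_id _)).symm
      mul_mem' := fun {σ σ'} hσ hσ' p => by
        rw [map_mul, map_mul]
        change _ = _ ≫ _ ≫ (braidAct X (a + 1 + b) σ').hom ≫ (braidAct X (a + 1 + b) σ).hom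
        have h1 := hσ (cableLevelHom R σ' p)
        rw [← Category.assoc, hσ' p] at h1
        simp only [Category.assoc] at h1
        exact h1
      inv_mem' := fun {σ} hσ p => by
        have h1 := hσ (cableLevelHom R σ⁻¹ p)
        rw [← Equiv.Perm.mul_apply, ← map_mul, mul_inv_cancel, map_one, Equiv.Perm.one_apply,
          ← Category.assoc] at h1
        rw [map_inv (braidAct X (a + 1 + b)) σ]
        change _ = _ ≫ _ ≫ (braidAct X (a + 1 + b) σ).inv
        rw [← Category.assoc]
        exact (Iso.eq_comp_inv (braidAct X (a + 1 + b) σ :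
          tpow X (a + 1 + b) ≅ tpow X (a + 1 + b))).2 h1.symm }
  have hK : K = ⊤ := Braid.closure_s _ _ fun j hj p => by
    have h1 : cableLevelHom R (Braid.s (a + 1 + b) j) =
        cablePerm (fun i => QuotientGroup.mk' R.N (Braid.s (a + n + b) i)) (a + 1 + b) n j :=
      Braid.lift_s _ (isBraidSeq_cablePerm (isBraidSeq_level R) (by omega)) j hj
    rw [h1, cablePerm_apply _ n hj, map_mul, map_cableGen (quotAct X R h) (by omega) p.1.2 hj
      fun l hl => quotAct_s X R h hl]
    change ((quotAct X R h p.2).hom ≫ (cableGen (genAut X (a + n + b)) n j p.1).hom) ≫ _ = _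
    have h2 : (braidAct X (a + 1 + b) (Braid.s (a + 1 + b) j)).hom =
      (braidGen X (a + 1 + b) j).hom := braidAct_s X hj
    rw [Category.assoc, h2]
    congr 1
    exact cableGen_insertPos g _ _ _ j (by omega) p.1.2 hj
  exact (hK ▸ Subgroup.mem_top σ : σ ∈ K) p

theorem braidGen_insertAt {X : C} (a : ℕ) {n l : ℕ} (hl : l + 1 < n) (g : tpow X n ⟶ X) : ∀ b,
    (braidGen X (a + n + b) (a + l)).hom ≫ insertAt a g b =
      insertAt a ((braidGen X n l).hom ≫ g) b
  | 0 => by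
    change (braidGen X (a + n) (a + l)).hom ≫ (catIso X a n).inv ≫ tpow X a ◁ g =
      (catIso X a n).inv ≫ tpow X a ◁ _
    rw [← cancel_epi (catIso X a n).hom, reassoc_of% (catIso_braidGen_right X a l n hl)]
    simp
  | b + 1 => by
    change _ ≫ insertAt a g b ▷ X = insertAt a _ b ▷ X
    rw [← braidGen_insertAt a hl g b, comp_whiskerRight]
    congr 1
    exact braidGen_succ X (n := a + n + b) (by omega)

/-- The compatibility of the insertion of braids with the application of an operation. -/
theorem shiftLevelHom_insertAt {X : C} {a b n : ℕ} (R : Level (a + n + b))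
    (h : R.N ≤ (braidAct X (a + n + b)).ker) (ρ : Braid n) (g : tpow X n ⟶ X) :
    (quotAct X R h (shiftLevelHom R ρ)).hom ≫ insertAt a g b =
      insertAt a ((braidAct X n ρ).hom ≫ g) b := by
  let K : Subgroup (Braid n) :=
    { carrier := {ρ | ∀ g : tpow X n ⟶ X,
        (quotAct X R h (shiftLevelHom R ρ)).hom ≫ insertAt a g b =
          insertAt a ((braidAct X n ρ).hom ≫ g) b}
      one_mem' := fun g => by
        rw [map_one, map_one, map_one]
        exact (Category.id_comp _).trans (congrArg (fun g => insertAt a g b)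
          (Category.id_comp _).symm)
      mul_mem' := fun {ρ ρ'} hρ hρ' g => by
        rw [map_mul, map_mul, map_mul]
        change ((quotAct X R h (shiftLevelHom R ρ')).hom ≫
          (quotAct X R h (shiftLevelHom R ρ)).hom) ≫ _ =
          insertAt a (((braidAct X n ρ').hom ≫ (braidAct X n ρ).hom) ≫ g) b
        rw [Category.assoc, hρ g, hρ', Category.assoc]
      inv_mem' := fun {ρ} hρ g => by
        rw [map_inv, map_inv, map_inv]
        change (quotAct X R h (shiftLevelHom R ρ)).inv ≫ _ =
          insertAt a ((braidAct X n ρ).inv ≫ g) b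
        refine (Iso.inv_comp_eq (quotAct X R h (shiftLevelHom R ρ) :
          tpow X (a + n + b) ≅ tpow X (a + n + b))).2 ((hρ _).trans ?_).symm
        exact congrArg (fun g => insertAt a g b) (Iso.hom_inv_id_assoc (braidAct X n ρ) g) }
  have hK : K = ⊤ := Braid.closure_s _ _ fun l hl g => by
    have h1 : shiftLevelHom R (Braid.s n l) =
        QuotientGroup.mk' R.N (Braid.s (a + n + b) (a + l)) :=
      Braid.lift_s _ (isBraidSeq_shift (isBraidSeq_level R) (by omega)) l hl
    rw [h1, quotAct_s X R h (by omega)]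
    refine (braidGen_insertAt a hl g b).trans ?_
    rw [show (braidGen X n l).hom = (braidAct X n (Braid.s n l)).hom from (braidAct_s X hl).symm]
  exact (hK ▸ Subgroup.mem_top ρ : ρ ∈ K) g

theorem insertAt_add {X : C} (a : ℕ) {n : ℕ} (g g' : tpow X n ⟶ X) : ∀ b,
    insertAt a (g + g') b = insertAt a g b + insertAt a g' b
  | 0 => by
    change (catIso X a n).inv ≫ _ ◁ (g + g') = _ ≫ _ + _ ≫ _
    rw [MonoidalPreadditive.whiskerLeft_add, Preadditive.comp_add]
  | b + 1 => by
    change insertAt a (g + g') b ▷ X = insertAt a g b ▷ X + insertAt a g' b ▷ X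
    rw [insertAt_add a g g' b, MonoidalPreadditive.add_whiskerRight]

theorem insertAt_smul {k : Type*} [Field k] [Linear k C] [MonoidalLinear k C] {X : C} (a : ℕ)
    {n : ℕ} (r : k) (g : tpow X n ⟶ X) : ∀ b,
    insertAt a (r • g) b = r • insertAt a g b
  | 0 => by
    change (catIso X a n).inv ≫ _ ◁ (r • g) = r • (_ ≫ _)
    rw [MonoidalLinear.whiskerLeft_smul, Linear.comp_smul]
  | b + 1 => by
    change insertAt a (r • g) b ▷ X = r • (insertAt a g b ▷ X)
    rw [insertAt_smul a r g b, MonoidalLinear.smul_whiskerRight]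

end QuotAct

section MulN

variable {C : Type u} [Category.{v} C] [MonoidalCategory C]

theorem insertAt_mulN (A : C) [MonObj A] (a n : ℕ) : ∀ b,
    insertAt a (mulN A n) b ≫ mulN A (a + 1 + b) = mulN A (a + n + b)
  | 0 => by
    change ((catIso A a n).inv ≫ tpow A a ◁ mulN A n) ≫ mulN A a ▷ A ≫ μ = _
    rw [Category.assoc, ← tensorHom_def'_assoc, Iso.inv_comp_eq]
    exact (mulN_catIso A a n).symm
  | b + 1 => by
    change insertAt a (mulN A n) b ▷ A ≫ mulN A (a + 1 + b) ▷ A ≫ μ = mulN A (a + n + b) ▷ A ≫ μ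
    rw [← comp_whiskerRight_assoc, insertAt_mulN A a n b]

theorem insertPos_mulN [BraidedCategory C] [Preadditive C]
    [MonoidalPreadditive C] (A : C) [MonObj A] {n N m i : ℕ} (hi : i < m)
    (h : m + n = N + 1) : insertPos (mulN A n) N m i ≫ mulN A m = mulN A N := by
  obtain ⟨b, rfl⟩ : ∃ b, m = i + 1 + b := ⟨m - (i + 1), by omega⟩
  obtain rfl : N = i + n + b := by omega
  rw [insertPos_eq, insertAt_mulN]

theorem insertAt_naturality {X Y : C} (f : X ⟶ Y) (a : ℕ) {n : ℕ} {g : tpow X n ⟶ X}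
    {g' : tpow Y n ⟶ Y} (h : g ≫ f = tpowMap f n ≫ g') : ∀ b,
    insertAt a g b ≫ tpowMap f (a + 1 + b) = tpowMap f (a + n + b) ≫ insertAt a g' b
  | 0 => by
    change ((catIso X a n).inv ≫ tpow X a ◁ g) ≫ (tpowMap f a ⊗ₘ f) =
      tpowMap f (a + n) ≫ (catIso Y a n).inv ≫ tpow Y a ◁ g'
    rw [← cancel_epi (catIso X a n).hom, reassoc_of% (catIso_tpowMap f a n)]
    simp only [Category.assoc, Iso.hom_inv_id_assoc]
    rw [MonoidalCategory.tensorHom_def', MonoidalCategory.tensorHom_def',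
      ← whiskerLeft_comp_assoc, h, whiskerLeft_comp_assoc, Category.assoc, whisker_exchange]
  | b + 1 => by
    change insertAt a g b ▷ X ≫ (tpowMap f (a + 1 + b) ⊗ₘ f) =
      (tpowMap f (a + n + b) ⊗ₘ f) ≫ insertAt a g' b ▷ Y
    rw [MonoidalCategory.tensorHom_def, MonoidalCategory.tensorHom_def, ← comp_whiskerRight_assoc,
      insertAt_naturality f a h b, comp_whiskerRight_assoc, Category.assoc, whisker_exchange]

end MulN

section WorAlg

variable {k : Type w} [Field k] {C : Type u} [Category.{v} C] [Preadditive C] [Linear k C]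
  [MonoidalCategory C] [BraidedCategory C]

theorem transition_of {n : ℕ} {N N' : Level n} (h : N.N ≤ N'.N) (g : Braid n) :
    transition k h (MonoidAlgebra.of k _ (QuotientGroup.mk' N.N g)) =
      MonoidAlgebra.of k _ (QuotientGroup.mk' N'.N g) := by
  rw [← toLevel_of, ← toLevel_of]
  exact transition_toLevel k h _

/-- The intersection of two levels. -/
def Level.inf {n : ℕ} (N N' : Level n) : Level n where
  N := N.N ⊓ N'.N
  normal := inferInstance
  finiteIndex := inferInstance

theorem Level.inf_le_left {n : ℕ} (N N' : Level n) : (N.inf N').N ≤ N.N :=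
  _root_.inf_le_left (a := N.N)

theorem Level.inf_le_right {n : ℕ} (N N' : Level n) : (N.inf N').N ≤ N'.N :=
  _root_.inf_le_right (a := N.N)

/-- The kernel of the action on `X^{⊗ n}`, as a level. -/
def FinitelyBraided.level {X : C} (hX : FinitelyBraided X) (n : ℕ) : Level n := kerLevel (hX n)

theorem FinitelyBraided.level_le {X : C} (hX : FinitelyBraided X) (n : ℕ) :
    (hX.level n).N ≤ (braidAct X n).ker := le_refl (braidAct X n).ker

theorem hatAct_one {X : C} (hX : FinitelyBraided X) (n : ℕ) : hatAct k X n 1 = 𝟙 _ := by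
  rw [hatAct_eq X (hX.level n) (hX.level_le n)]
  exact map_one (levelAct k X (hX.level n) (hX.level_le n))

/-- The order is reversed, as the multiplication of endomorphisms is `f * g = g ≫ f`. -/
theorem hatAct_mul {X : C} (hX : FinitelyBraided X) (n : ℕ) (x y : BrAssHat k n) :
    hatAct k X n (x * y) = hatAct k X n y ≫ hatAct k X n x := by
  simp only [hatAct_eq X (hX.level n) (hX.level_le n)]
  exact map_mul (levelAct k X (hX.level n) (hX.level_le n)) _ _

theorem hatAct_of {X : C} (hX : FinitelyBraided X) (n : ℕ) (g : Braid n) :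
    hatAct k X n (toHat k n (MonoidAlgebra.of k (Braid n) g)) = (braidAct X n g).hom := by
  rw [hatAct_eq X (hX.level n) (hX.level_le n)]
  change levelAct k X (hX.level n) (hX.level_le n) (toLevel k _ _) = _
  rw [toLevel_of]
  exact levelAct_of X (hX.level n) (hX.level_le n) g

variable [MonoidalPreadditive C] [MonoidalLinear k C]

/-- The operations of the profinite braided associative operad on a finitely braided monoid are
compatible with composition. -/
theorem hatAct_comp {A : C} [MonObj A] (hA : FinitelyBraided A) {a b n : ℕ}
    {x : BrAssHat k (a + 1 + b)} {y : BrAssHat k n} {z : BrAssHat k (a + n + b)}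
    (h : IsComp x y z) : hatAct k A _ z ≫ mulN A _ =
      insertAt a (hatAct k A n y ≫ mulN A n) b ≫ hatAct k A _ x ≫ mulN A _ := by
  let R := hA.level (a + n + b)
  have hR : R.N ≤ (braidAct A (a + n + b)).ker := hA.level_le _
  -- All levels have to be fine enough both for the composition at level `R` and for the actions.
  let O := (outerLevel R).inf (hA.level (a + 1 + b))
  let I := (innerLevel R).inf (hA.level n)
  have hO : O.N ≤ (braidAct A (a + 1 + b)).ker := (Level.inf_le_right _ _).trans (hA.level_le _)
  have hI : I.N ≤ (braidAct A n).ker := (Level.inf_le_right _ _).trans (hA.level_le _)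
  have key : ∀ (u : LevelAlg k O) (v : LevelAlg k I),
      (levelAct k A R hR (compLevel k R
          (transition k (N' := outerLevel R) (Level.inf_le_left _ _) u)
          (transition k (N' := innerLevel R) (Level.inf_le_left _ _) v)) :
        tpow A (a + n + b) ⟶ _) ≫ mulN A _ =
      insertAt a ((levelAct k A I hI v : tpow A n ⟶ _) ≫ mulN A n) b ≫
        (levelAct k A O hO u : tpow A (a + 1 + b) ⟶ _) ≫ mulN A _ := by
    intro u v
    induction u using MonoidAlgebra.induction_on with
    | of p =>
      induction v using MonoidAlgebra.induction_on with
      | of q =>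
        obtain ⟨σ, rfl⟩ := QuotientGroup.mk'_surjective O.N p
        obtain ⟨ρ, rfl⟩ := QuotientGroup.mk'_surjective I.N q
        rw [transition_of, transition_of, compLevel_of, levelAct_of, levelAct_of]
        set c := cableLevelHom R σ (⟨a, by omega⟩, 1) with hc
        have h1 : (levelAct k A R hR (MonoidAlgebra.of k _ (cableLevel R
            (QuotientGroup.mk' _ σ) (QuotientGroup.mk' _ ρ))) : tpow A (a + n + b) ⟶ _) =
            (quotAct A R hR (shiftLevelHom R ρ)).hom ≫ (quotAct A R hR c.2).hom := by
          have h2 : cableLevel R (QuotientGroup.mk' _ σ) (QuotientGroup.mk' _ ρ) =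
            c.2 * shiftLevelHom R ρ := rfl
          rw [h2]
          obtain ⟨g, hg⟩ := QuotientGroup.mk'_surjective R.N (c.2 * shiftLevelHom R ρ)
          rw [← hg, levelAct_of]
          change (quotAct A R hR (QuotientGroup.mk' R.N g)).hom = _
          rw [hg, map_mul]
          rfl
        have h3 := cableLevelHom_insertPos R hR (mulN A n) σ (⟨a, by omega⟩, 1)
        rw [← hc, map_one, insertPos_eq] at h3
        replace h3 := h3.trans (Category.id_comp _)
        have h4 := insertPos_mulN A (n := n) (N := a + n + b) c.1.2 (by omega)
        rw [h1, Category.assoc, ← h4, reassoc_of% h3, ← Category.assoc, shiftLevelHom_insertAt]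
      | add v v' hv hv' =>
        rw [map_add, map_add, compLevel_add_right, map_add, Preadditive.add_comp, hv, hv',
          Preadditive.add_comp, insertAt_add, Preadditive.add_comp]
      | smul r v hv =>
        rw [map_smul, map_smul, compLevel_smul_right, map_smul, Linear.smul_comp, hv,
          Linear.smul_comp, insertAt_smul, Linear.smul_comp]
    | add u u' hu hu' =>
      rw [map_add, map_add, compLevel_add_left, map_add, Preadditive.add_comp, hu, hu',
        Preadditive.add_comp, Preadditive.comp_add]
    | smul r u hu =>
      rw [map_smul, map_smul, compLevel_smul_left, map_smul, Linear.smul_comp, hu,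
        Linear.smul_comp, Linear.comp_smul]
  rw [hatAct_eq A R hR, hatAct_eq A O hO, hatAct_eq A I hI, h R,
    ← x.2 O (outerLevel R) (Level.inf_le_left _ _),
    ← y.2 I (innerLevel R) (Level.inf_le_left _ _)]
  exact key _ _

/-- A finitely braided monoid is a `𝔚_*`-algebra. -/
theorem isWorAlg_worOps {A : C} [MonObj A] (hA : FinitelyBraided A) : IsWorAlg (worOps k A) where
  continuous n := ⟨hA.level n, fun x hx => by
    change hatAct k A n x.1 ≫ mulN A n = 0
    rw [hatAct_eq A (hA.level n) (hA.level_le n), hx, map_zero]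
    exact zero_comp⟩
  unit := by
    change hatAct k A 1 1 ≫ η ▷ A ≫ μ = _
    rw [hatAct_one hA, Category.id_comp, MonObj.one_mul]
  equivariant n x y g h := by
    change hatAct k A n y.1 ≫ mulN A n = _ ≫ hatAct k A n x.1 ≫ mulN A n
    rw [h, hatAct_mul hA, hatAct_of hA, Category.assoc]
  comp a b n x y z h := hatAct_comp hA h

theorem IsWorAlg.of_mono {X Y : C} {op : Ops k X} (h : IsWorAlg op) {op' : Ops k Y} (f : Y ⟶ X)
    [Mono f] (hf : ∀ n (x : WorStar k n), op' n x ≫ f = tpowMap f n ≫ op n x) :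
    IsWorAlg op' where
  continuous n := by
    obtain ⟨N, hN⟩ := h.continuous n
    refine ⟨N, fun x hx => ?_⟩
    rw [← cancel_mono f, hf, hN x hx, comp_zero, zero_comp]
  unit := by
    rw [← cancel_mono f, hf, h.unit]
    change (𝟙 _ ⊗ₘ f) ≫ _ = _
    rw [id_tensorHom, leftUnitor_naturality]
  equivariant n x y g hxy := by
    rw [← cancel_mono f, hf, h.equivariant n x y g hxy, Category.assoc, hf, ← Category.assoc,
      ← braidAct_naturality, Category.assoc]
  comp a b n x y z hxyz := by
    rw [← cancel_mono f, hf, h.comp a b n x y z hxyz, Category.assoc, hf, ← Category.assoc,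
      ← Category.assoc, insertAt_naturality f a (hf n y) b]

end WorAlg

/-! ### Powers of a sum of two morphisms that commute up to the braiding -/

section Words

variable {C : Type u} [Category.{v} C] [MonoidalCategory C]

/-- The product in a monoid of `i` copies of `u` and `N - i` copies of `v`, in this order. -/
def wordProd {X B : C} [MonObj B] (u v : X ⟶ B) : ∀ N, ℕ → (tpow X N ⟶ B)
  | 0, _ => η
  | N + 1, i => (wordProd u v N i ⊗ₘ if N < i then u else v) ≫ μ

theorem tpowMap_mulN_succ {X B : C} [MonObj B] (f : X ⟶ B) (n : ℕ) :
    tpowMap f (n + 1) ≫ mulN B (n + 1) = ((tpowMap f n ≫ mulN B n) ⊗ₘ f) ≫ μ := by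
  change (tpowMap f n ⊗ₘ f) ≫ mulN B n ▷ B ≫ μ = _
  rw [← tensorHom_id, tensorHom_comp_tensorHom_assoc, Category.comp_id]

theorem wordProd_self {X B : C} [MonObj B] (u v : X ⟶ B) : ∀ N i, N ≤ i →
    wordProd u v N i = tpowMap u N ≫ mulN B N
  | 0, _, _ => (Category.id_comp _).symm
  | N + 1, i, h => by
    rw [wordProd, wordProd_self u v N i (by omega), if_pos (by omega), tpowMap_mulN_succ]

theorem wordProd_add {X B : C} [MonObj B] (u v : X ⟶ B) (i : ℕ) : ∀ j,
    wordProd u v (i + j) i =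
      (catIso X i j).inv ≫ ((tpowMap u i ≫ mulN B i) ⊗ₘ (tpowMap v j ≫ mulN B j)) ≫ μ
  | 0 => by
    have h : tpowMap v 0 ≫ mulN B 0 = η := Category.id_comp _
    rw [h, MonObj.mul_one_hom]
    change _ = (ρ_ _).inv ≫ _
    refine Eq.trans ?_ (Iso.inv_hom_id_assoc (ρ_ (tpow X i)) _).symm
    exact wordProd_self u v _ _ le_rfl
  | j + 1 => by
    have ih := wordProd_add u v i j
    have h1 : wordProd u v (i + (j + 1)) i = (wordProd u v (i + j) i ⊗ₘ v) ≫ μ := by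
      change (wordProd u v (i + j) i ⊗ₘ if i + j < i then u else v) ≫ μ = _
      rw [if_neg (by omega)]
    rw [h1, ih, tpowMap_mulN_succ, ← cancel_epi (catIso X i (j + 1)).hom, Iso.hom_inv_id_assoc,
      catIso_succ, Category.assoc, ← tensorHom_id, tensorHom_comp_tensorHom_assoc,
      Iso.hom_inv_id_assoc, Category.id_comp]
    set a := tpowMap u i ≫ mulN B i
    set b := tpowMap v j ≫ mulN B j
    have h2 : ((a ⊗ₘ b) ≫ μ ⊗ₘ v) = ((a ⊗ₘ b) ⊗ₘ v) ≫ μ ▷ B := by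
      rw [← tensorHom_id, tensorHom_comp_tensorHom, Category.comp_id]
    have h3 : (a ⊗ₘ (b ⊗ₘ v) ≫ μ) = (a ⊗ₘ (b ⊗ₘ v)) ≫ B ◁ μ := by
      rw [← id_tensorHom, tensorHom_comp_tensorHom, Category.comp_id]
    rw [h2, h3, Category.assoc, Category.assoc, MonObj.mul_assoc, Iso.inv_comp_eq,
      associator_naturality_assoc]

variable [BraidedCategory C] [Preadditive C] [MonoidalPreadditive C]

/-- The ascending product of generators, as an endomorphism of `X^{⊗ N}`. -/
def ascHom (X : C) (N i j : ℕ) : tpow X N ⟶ tpow X N :=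
  asc (R := End (tpow X N)) (genEnd X N) i j

/-- The sum of unshuffles, as an endomorphism of `X^{⊗ N}`. -/
def unshuffleHom (X : C) (N i j : ℕ) : tpow X N ⟶ tpow X N :=
  unshuffle (R := End (tpow X N)) (genEnd X N) i j

theorem unshuffleHom_zero_left (X : C) (N j : ℕ) : unshuffleHom X N 0 j = 𝟙 _ := by
  rw [unshuffleHom, unshuffle]
  rfl

theorem unshuffleHom_zero_right (X : C) (N : ℕ) : ∀ i, unshuffleHom X N i 0 = 𝟙 _
  | 0 => unshuffleHom_zero_left X N 0
  | _ + 1 => by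
    rw [unshuffleHom, unshuffle]
    rfl

theorem unshuffleHom_succ_succ (X : C) (N i j : ℕ) : unshuffleHom X N (i + 1) (j + 1) =
    unshuffleHom X N (i + 1) j + unshuffleHom X N i (j + 1) ≫ ascHom X N i (j + 1) := by
  rw [unshuffleHom, unshuffle]
  rfl

theorem ascHom_succ (X : C) {N i : ℕ} : ∀ j, i + j < N →
    ascHom X (N + 1) i j =
      ascHom X N i j ▷ X
  | 0, _ => (id_whiskerRight _ _).symm
  | j + 1, h => by
    change (braidGen X (N + 1) (i + j)).hom ≫
      ascHom X (N + 1) i j =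
      ((braidGen X N (i + j)).hom ≫ ascHom X N i j) ▷ X
    rw [ascHom_succ X j (by omega), comp_whiskerRight, braidGen_succ X (by omega)]

theorem unshuffleHom_succ (X : C) {N : ℕ} : ∀ i j, i + j ≤ N →
    unshuffleHom X (N + 1) i j =
      unshuffleHom X N i j ▷ X
  | 0, j, _ => by
    rw [unshuffleHom_zero_left, unshuffleHom_zero_left, id_whiskerRight]
  | i + 1, 0, _ => by
    rw [unshuffleHom_zero_right, unshuffleHom_zero_right, id_whiskerRight]
  | i + 1, j + 1, h => by
    rw [unshuffleHom_succ_succ, unshuffleHom_succ_succ, unshuffleHom_succ X (i + 1) j (by omega),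
      unshuffleHom_succ X i (j + 1) (by omega),
      ascHom_succ X (j + 1) (by omega), MonoidalPreadditive.add_whiskerRight,
      comp_whiskerRight]

/-- If `v u = u v` up to the braiding, then one more factor `u` can be moved in front of the
factors `v` at the cost of an ascending product of generators. -/
theorem wordProd_tensor {X B : C} [MonObj B] {u v : X ⟶ B}
    (h : (v ⊗ₘ u) ≫ μ = (β_ X X).hom ≫ (u ⊗ₘ v) ≫ μ) (i : ℕ) : ∀ j,
    (wordProd u v (i + j) i ⊗ₘ u) ≫ μ =
      ascHom X (i + j + 1) i j ≫
        wordProd u v (i + j + 1) (i + 1)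
  | 0 => by
    change _ = 𝟙 _ ≫ (wordProd u v i (i + 1) ⊗ₘ if i < i + 1 then u else v) ≫ μ
    rw [Category.id_comp, if_pos (Nat.lt_succ_self i), wordProd_self u v i (i + 1) (by omega)]
    congr 2
    exact wordProd_self u v i i le_rfl
  | j + 1 => by
    have ih := wordProd_tensor h i j
    have h1 : wordProd u v (i + (j + 1)) i = (wordProd u v (i + j) i ⊗ₘ v) ≫ μ := by
      change (wordProd u v (i + j) i ⊗ₘ if i + j < i then u else v) ≫ μ = _
      rw [if_neg (by omega)]
    have h2 : wordProd u v (i + (j + 1) + 1) (i + 1) =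
        (wordProd u v (i + j + 1) (i + 1) ⊗ₘ v) ≫ μ := by
      change (wordProd u v (i + j + 1) (i + 1) ⊗ₘ if i + j + 1 < i + 1 then u else v) ≫ μ = _
      rw [if_neg (by omega)]
    have h3 : ascHom X (i + (j + 1) + 1) i (j + 1) = lastBraid (tpow X (i + j)) X ≫
          ascHom X (i + j + 1) i j ▷ X := by
      rw [← ascHom_succ X j (by omega), ← braidGen_lastBraid]
      rfl
    set a := wordProd u v (i + j) i
    have h4 : ((a ⊗ₘ v) ≫ μ ⊗ₘ u) ≫ μ = lastBraid (tpow X (i + j)) X ≫ ((a ⊗ₘ u) ≫ μ ⊗ₘ v) ≫ μ := by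
      have e : ∀ x y : X ⟶ B, ((a ⊗ₘ x) ≫ μ ⊗ₘ y) ≫ μ =
          (α_ _ _ _).hom ≫ (a ⊗ₘ (x ⊗ₘ y) ≫ μ) ≫ μ := by
        intro x y
        have h2 : ((a ⊗ₘ x) ≫ μ ⊗ₘ y) = ((a ⊗ₘ x) ⊗ₘ y) ≫ μ ▷ B := by
          rw [← tensorHom_id, tensorHom_comp_tensorHom, Category.comp_id]
        have h3 : (a ⊗ₘ (x ⊗ₘ y) ≫ μ) = (a ⊗ₘ (x ⊗ₘ y)) ≫ B ◁ μ := by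
          rw [← id_tensorHom, tensorHom_comp_tensorHom, Category.comp_id]
        rw [h2, h3, Category.assoc, Category.assoc, MonObj.mul_assoc, associator_naturality_assoc]
      rw [e, e, h, lastBraid]
      have h5 : (a ⊗ₘ (β_ X X).hom ≫ (u ⊗ₘ v) ≫ μ) = tpow X (i + j) ◁ (β_ X X).hom ≫
          (a ⊗ₘ (u ⊗ₘ v) ≫ μ) := by
        rw [← id_tensorHom, tensorHom_comp_tensorHom, Category.id_comp]
      rw [h5]
      simp only [Category.assoc, Iso.inv_hom_id_assoc]
    rw [h1, h4, ih]
    refine Eq.trans ?_ (congrArg₂ (· ≫ ·) h3 h2).symm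
    have h6 : (ascHom X (i + j + 1) i j ≫
        wordProd u v (i + j + 1) (i + 1) ⊗ₘ v) =
        ascHom X (i + j + 1) i j ▷ X ≫
        (wordProd u v (i + j + 1) (i + 1) ⊗ₘ v) := by
      rw [← tensorHom_id, tensorHom_comp_tensorHom, Category.id_comp]
    rw [h6, Category.assoc, Category.assoc]

/-- The noncommutative binomial formula: if `v u = u v` up to the braiding, then `(u + v)^n` is
the sum over `i + j = n` of the unshuffles followed by `u^i v^j`. -/
theorem tpowMap_add_mulN {X B : C} [MonObj B] {u v : X ⟶ B}
    (h : (v ⊗ₘ u) ≫ μ = (β_ X X).hom ≫ (u ⊗ₘ v) ≫ μ) : ∀ n,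
    tpowMap (u + v) n ≫ mulN B n = ∑ i ∈ Finset.range (n + 1),
      unshuffleHom X n i (n - i) ≫ wordProd u v n i
  | 0 => by
    rw [Finset.sum_range_one, unshuffleHom_zero_left, Category.id_comp]
    exact Category.id_comp _
  | n + 1 => by
    let U : ℕ → ℕ → (tpow X (n + 1) ⟶ tpow X (n + 1)) := fun i j =>
      unshuffleHom X (n + 1) i j
    let W : ℕ → (tpow X (n + 1) ⟶ B) := wordProd u v (n + 1)
    have ih := tpowMap_add_mulN h n
    have hv : ∀ i, i < n + 1 → (unshuffleHom X n i (n - i) ≫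
        wordProd u v n i ⊗ₘ v) ≫ μ = U i (n - i) ≫ W i := fun i hi => by
      have h1 : W i = (wordProd u v n i ⊗ₘ v) ≫ μ := by
        change (wordProd u v n i ⊗ₘ if n < i then u else v) ≫ μ = _
        rw [if_neg (by omega)]
      have h2 : U i (n - i) = _ := unshuffleHom_succ X i (n - i) (by omega)
      rw [h1, h2, ← tensorHom_id, tensorHom_comp_tensorHom_assoc, Category.id_comp]
    have hu : ∀ i, i < n + 1 → (unshuffleHom X n i (n - i) ≫
        wordProd u v n i ⊗ₘ u) ≫ μ = (U i (n - i) ≫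
          ascHom X (n + 1) i (n - i)) ≫ W (i + 1) :=
      fun i hi => by
      obtain ⟨j, rfl⟩ : ∃ j, n = i + j := ⟨n - i, by omega⟩
      have h1 := wordProd_tensor h i j
      have h2 : U i (i + j - i) = _ := unshuffleHom_succ X i (i + j - i) (by omega)
      rw [Nat.add_sub_cancel_left] at h2 ⊢
      have h3 : (unshuffleHom X (i + j) i j ≫
          wordProd u v (i + j) i ⊗ₘ u) =
          unshuffleHom X (i + j) i j ▷ X ≫ (wordProd u v (i + j) i ⊗ₘ u) := by
        rw [← tensorHom_id, tensorHom_comp_tensorHom, Category.id_comp]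
      rw [h3, Category.assoc, h1, h2, Category.assoc]
    -- The last factor of `(u + v)^(n + 1)` is `v`, or it is `u` and has to be moved to the left.
    have hlhs : tpowMap (u + v) (n + 1) ≫ mulN B (n + 1) =
        ∑ i ∈ Finset.range (n + 1), U i (n - i) ≫ W i + ∑ i ∈ Finset.range (n + 1),
          (U i (n - i) ≫ ascHom X (n + 1) i (n - i)) ≫ W (i + 1) := by
      rw [tpowMap_mulN_succ, ih, MonoidalPreadditive.tensor_add, Preadditive.add_comp,
        sum_tensor, sum_tensor, Preadditive.sum_comp, Preadditive.sum_comp]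
      refine (add_comm _ _).trans (congrArg₂ (· + ·) ?_ ?_)
      · exact Finset.sum_congr rfl fun i hi => hv i (Finset.mem_range.1 hi)
      · exact Finset.sum_congr rfl fun i hi => hu i (Finset.mem_range.1 hi)
    rw [hlhs]
    change _ = ∑ i ∈ Finset.range (n + 1 + 1), U i (n + 1 - i) ≫ W i
    have e0 : ∀ j, U 0 j = 𝟙 _ := unshuffleHom_zero_left X (n + 1)
    have e0' : ∀ i, U i 0 = 𝟙 _ := unshuffleHom_zero_right X (n + 1)
    have e1 : ∀ i ∈ Finset.range n, U (i + 1) (n + 1 - (i + 1)) ≫ W (i + 1) =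
        U (i + 1) (n - (i + 1)) ≫ W (i + 1) +
          (U i (n - i) ≫ ascHom X (n + 1) i (n - i)) ≫ W (i + 1) := fun i hi => by
      obtain ⟨j, rfl⟩ : ∃ j, n = i + j + 1 := ⟨n - i - 1, by have := Finset.mem_range.1 hi; omega⟩
      rw [← Preadditive.add_comp, show i + j + 1 + 1 - (i + 1) = j + 1 by omega,
        show i + j + 1 - (i + 1) = j by omega, show i + j + 1 - i = j + 1 by omega]
      exact congrArg (· ≫ W (i + 1)) (unshuffleHom_succ_succ X _ i j)
    have e2 : ascHom X (n + 1) n 0 = 𝟙 _ := rfl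
    have r1 := Finset.sum_range_succ (fun i => U i (n + 1 - i) ≫ W i) (n + 1)
    have r2 := Finset.sum_range_succ' (fun i => U i (n + 1 - i) ≫ W i) n
    have r3 := Finset.sum_range_succ' (fun i => U i (n - i) ≫ W i) n
    have r4 := Finset.sum_range_succ
      (fun i => (U i (n - i) ≫ ascHom X (n + 1) i (n - i)) ≫ W (i + 1)) n
    simp only [e0, e0', e2, Nat.sub_self, Category.id_comp] at r1 r2 r3 r4
    rw [Finset.sum_congr rfl e1, Finset.sum_add_distrib] at r2
    rw [r1, r2, r3, r4]
    abel

end Words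

/-! ### Powers of primitive morphisms -/

section Primitive

variable {C : Type u} [Category.{v} C] [MonoidalCategory C]

/-- The first inclusion `x ↦ x ⊗ 1` of a tensor product of monoids. -/
def inl (D E : C) [MonObj E] : D ⟶ D ⊗ E := (ρ_ D).inv ≫ D ◁ η

/-- The second inclusion `x ↦ 1 ⊗ x` of a tensor product of monoids. -/
def inr (D E : C) [MonObj D] : E ⟶ D ⊗ E := (λ_ E).inv ≫ η ▷ E

theorem inl_naturality {D D' E E' : C} [MonObj E] [MonObj E'] (f : D ⟶ D') (g : E ⟶ E')
    [IsMonHom g] : inl D E ≫ (f ⊗ₘ g) = f ≫ inl D' E' := by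
  rw [inl, inl, tensorHom_def', Category.assoc, ← whiskerLeft_comp_assoc, IsMonHom.one_hom,
    whisker_exchange, ← Category.assoc, ← rightUnitor_inv_naturality, Category.assoc]

theorem inr_naturality {D D' E E' : C} [MonObj D] [MonObj D'] (f : D ⟶ D') (g : E ⟶ E')
    [IsMonHom f] : inr D E ≫ (f ⊗ₘ g) = g ≫ inr D' E' := by
  rw [inr, inr, MonoidalCategory.tensorHom_def, Category.assoc, ← comp_whiskerRight_assoc,
    IsMonHom.one_hom, ← whisker_exchange, ← Category.assoc, ← leftUnitor_inv_naturality,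
    Category.assoc]

variable [BraidedCategory C]

instance isMonHom_inl (D E : C) [MonObj D] [MonObj E] : IsMonHom (inl D E) := by
  have : IsMonHom (ρ_ D).inv := inferInstance
  have : IsMonHom (η : 𝟙_ C ⟶ E) := ⟨by simp, by simp [unitors_equal]⟩
  rw [inl]
  infer_instance

instance isMonHom_inr (D E : C) [MonObj D] [MonObj E] : IsMonHom (inr D E) := by
  have : IsMonHom (η : 𝟙_ C ⟶ D) := ⟨by simp, by simp [unitors_equal]⟩
  rw [inr]
  infer_instance

theorem inl_inr_mul (D E : C) [MonObj D] [MonObj E] :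
    (inl D E ⊗ₘ inr D E) ≫ μ = 𝟙 _ := by
  rw [inl, inr, MonObj.tensorObj.mul_def, ← tensorHom_comp_tensorHom, Category.assoc,
    ← id_tensorHom, ← tensorHom_id, tensorμ_natural_assoc, tensorHom_comp_tensorHom,
    MonObj.mul_one_hom, MonObj.one_mul_hom, Category.comp_id, Category.comp_id, tensorμ,
    braiding_tensorUnit_left]
  monoidal

theorem inr_inl_mul (D E : C) [MonObj D] [MonObj E] :
    (inr D E ⊗ₘ inl D E) ≫ μ = (β_ E D).hom := by
  rw [inl, inr, MonObj.tensorObj.mul_def, ← tensorHom_comp_tensorHom, Category.assoc,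
    ← id_tensorHom, ← tensorHom_id, tensorμ_natural_assoc, tensorHom_comp_tensorHom]
  simp [tensorμ]
  monoidal

/-- The two inclusions of the factors of a tensor product commute up to the braiding. -/
theorem inr_inl_comm {X D E : C} [MonObj D] [MonObj E] (f : X ⟶ D) (g : X ⟶ E) :
    (g ≫ inr D E ⊗ₘ f ≫ inl D E) ≫ μ =
      (β_ X X).hom ≫ (f ≫ inl D E ⊗ₘ g ≫ inr D E) ≫ μ := by
  rw [← tensorHom_comp_tensorHom, ← tensorHom_comp_tensorHom, Category.assoc, Category.assoc,
    inr_inl_mul, inl_inr_mul, Category.comp_id, BraidedCategory.braiding_naturality]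

end Primitive

section Powers

variable {C : Type u} [Category.{v} C] [MonoidalCategory C]

/-- The `n`-fold product of a morphism `κ : K ⟶ D` to a monoid. -/
def powHom {K D : C} [MonObj D] (κ : K ⟶ D) (n : ℕ) : tpow K n ⟶ D := tpowMap κ n ≫ mulN D n

theorem powHom_zero {K D : C} [MonObj D] (κ : K ⟶ D) : powHom κ 0 = η := Category.id_comp _

theorem powHom_one {K D : C} [MonObj D] (κ : K ⟶ D) : powHom κ 1 = (λ_ K).hom ≫ κ := by
  change (𝟙 _ ⊗ₘ κ) ≫ η ▷ D ≫ μ = _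
  rw [MonObj.one_mul, id_tensorHom, leftUnitor_naturality]

theorem powHom_comp {K D D' : C} [MonObj D] [MonObj D'] (κ : K ⟶ D) (f : D ⟶ D') [IsMonHom f]
    (n : ℕ) : powHom κ n ≫ f = powHom (κ ≫ f) n := by
  rw [powHom, powHom, Category.assoc, mulN_naturality, tpowMap_comp, Category.assoc]

theorem tpowMap_powHom {K K' D : C} [MonObj D] (f : K ⟶ K') (κ : K' ⟶ D) (n : ℕ) :
    tpowMap f n ≫ powHom κ n = powHom (f ≫ κ) n := by
  rw [powHom, powHom, tpowMap_comp, Category.assoc]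

variable [BraidedCategory C] [Preadditive C] [MonoidalPreadditive C]

/-- `qsym` is compatible with adding a strand on the right. -/
theorem qsym_genEnd_succ (X : C) {N i n : ℕ} (h : i + n ≤ N) :
    (qsym (genEnd X (N + 1)) i n : End (tpow X (N + 1))) =
      (show tpow X N ⟶ tpow X N from qsym (R := End (tpow X N)) (genEnd X N) i n) ▷ X := by
  let φ : End (tpow X N) →+* End (tpow X (N + 1)) :=
    { toFun := fun g => (g : tpow X N ⟶ tpow X N) ▷ X
      map_one' := id_whiskerRight _ _
      map_mul' := fun f g => comp_whiskerRight _ _ _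
      map_zero' := MonoidalPreadditive.zero_whiskerRight
      map_add' := fun f g => MonoidalPreadditive.add_whiskerRight _ _ }
  have := map_qsym (s := 0) (g := genEnd X (N + 1)) φ (f := genEnd X N) (i := i) (n := n)
    fun l _ hl => by
      rw [Nat.zero_add]
      exact (braidGen_succ X (by omega)).symm
  rw [Nat.zero_add] at this
  exact this.symm

/-- The factorization of the quantum symmetrizer in which the last strand is split off. -/
theorem sym_succ (X : C) (m : ℕ) :
    sym X (m + 1) = unshuffleHom X (m + 1) m 1 ≫ sym X m ▷ X := by
  have h := qsym_mul_unshuffle (braidRel_genEnd X (m + 1)) m 1 le_rfl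
  have h1 : qsym (genEnd X (m + 1)) m 1 = 1 := by
    change descSum _ _ 0 * 1 = _
    rw [descSum, mul_one]
  rw [h1, mul_one, qsym_genEnd_succ X (by omega)] at h
  exact h.symm

/-- The factorization of the quantum symmetrizer through the unshuffles, followed by the quantum
symmetrizers of the first `i` and of the last `j` strands. -/
theorem sym_add (X : C) (i j : ℕ) : sym X (i + j) =
    unshuffleHom X (i + j) i j ≫ (catIso X i j).inv ≫ (sym X i ⊗ₘ sym X j) ≫
      (catIso X i j).hom := by
  have h := qsym_mul_unshuffle (braidRel_genEnd X (i + j)) i j le_rfl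
  rw [← endLeft_qsym X j (by omega), ← endRight_qsym] at h
  refine h.symm.trans ?_
  change unshuffleHom X (i + j) i j ≫ ((catIso X i j).inv ≫ tpow X i ◁ sym X j ≫
    (catIso X i j).hom) ≫ (catIso X i j).inv ≫ sym X i ▷ tpow X j ≫ (catIso X i j).hom = _
  rw [tensorHom_def']
  simp

theorem wordProd_inl_inr {K D : C} [MonObj D] (κ : K ⟶ D) (i j : ℕ) :
    wordProd (κ ≫ inl D D) (κ ≫ inr D D) (i + j) i =
      (catIso K i j).inv ≫ (powHom κ i ⊗ₘ powHom κ j) := by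
  have h1 := powHom_comp κ (inl D D) i
  have h2 := powHom_comp κ (inr D D) j
  rw [wordProd_add]
  change _ ≫ (powHom _ i ⊗ₘ powHom _ j) ≫ _ = _
  rw [← h1, ← h2, ← tensorHom_comp_tensorHom, Category.assoc, inl_inr_mul, Category.comp_id]

/-- The value on the powers of a primitive morphism of a comultiplication that is a morphism of
monoids. -/
theorem powHom_comul {K D : C} [MonObj D] {d : D ⟶ D ⊗ D} [IsMonHom d] {κ : K ⟶ D}
    (hκ : κ ≫ d = κ ≫ inl D D + κ ≫ inr D D) (n : ℕ) :
    powHom κ n ≫ d = ∑ i ∈ Finset.range (n + 1),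
      unshuffleHom K n i (n - i) ≫ wordProd (κ ≫ inl D D) (κ ≫ inr D D) n i := by
  rw [powHom_comp, hκ]
  exact tpowMap_add_mulN (inr_inl_comm κ κ) n

end Powers

/-! ### The filtration by powers of the primitives -/

section Filtration

attribute [local instance] Abelian.hasFiniteBiproducts

variable {C : Type u} [Category.{v} C] [Abelian C] [MonoidalCategory C] [MonoidalPreadditive C]
  [BraidedCategory C]

section

variable {K D Q : C} [MonObj D] {d : D ⟶ D ⊗ D} [IsMonHom d] {κ : K ⟶ D}
  (hκ : κ ≫ d = κ ≫ inl D D + κ ≫ inr D D) {m : ℕ} {q : D ⟶ Q}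
  (hq : ∀ n < m, powHom κ n ≫ q = 0)

include hq in
theorem wordProd_comp_quotient {n i : ℕ} (hi : i < m) (hn : i ≤ n) :
    wordProd (κ ≫ inl D D) (κ ≫ inr D D) n i ≫ q ▷ D = 0 := by
  obtain ⟨j, rfl⟩ : ∃ j, n = i + j := ⟨n - i, by omega⟩
  rw [wordProd_inl_inr, Category.assoc, ← tensorHom_id, tensorHom_comp_tensorHom, hq i hi,
    MonoidalPreadditive.zero_tensor, comp_zero]

theorem inl_whiskerRight {E : C} [MonObj E] (q : D ⟶ Q) : inl D E ≫ q ▷ E = q ≫ inl Q E := by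
  rw [← tensorHom_id, inl_naturality]

include hκ hq

/-- Let `q` kill products of fewer than `m` primitives. As the left tensor factors of the
comultiplication of a product are shorter products, `q ⊗ D` kills the comultiplication of products
of fewer than `m` primitives. -/
theorem powHom_comul_of_lt {n : ℕ} (h : n < m) : powHom κ n ≫ d ≫ q ▷ D = 0 := by
  rw [← Category.assoc, powHom_comul hκ, Preadditive.sum_comp]
  refine Finset.sum_eq_zero fun i hi => ?_
  have := Finset.mem_range.1 hi
  rw [Category.assoc, wordProd_comp_quotient hq (by omega) (by omega), comp_zero]

/-- In the comultiplication of a product `x` of `m` primitives, only the term `x ⊗ 1` survives under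
`q ⊗ D`. -/
theorem powHom_comul_self : powHom κ m ≫ d ≫ q ▷ D = powHom κ m ≫ q ≫ inl Q D := by
  rw [← Category.assoc, powHom_comul hκ, Finset.sum_range_succ, Preadditive.add_comp,
    Preadditive.sum_comp, Finset.sum_eq_zero, zero_add, Nat.sub_self, unshuffleHom_zero_right,
    Category.id_comp, wordProd_self _ _ _ _ le_rfl]
  · change powHom _ m ≫ _ = _
    rw [← powHom_comp, Category.assoc, inl_whiskerRight]
  · intro i hi
    have := Finset.mem_range.1 hi
    rw [Category.assoc, wordProd_comp_quotient hq (by omega) (by omega), comp_zero]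

/-- In the comultiplication of a product `x` of `m + 1` primitives, only `x ⊗ 1` and the terms of
bidegree `(m, 1)` survive under `q ⊗ D`. -/
theorem powHom_comul_succ : powHom κ (m + 1) ≫ d ≫ q ▷ D =
    powHom κ (m + 1) ≫ q ≫ inl Q D + unshuffleHom K (m + 1) m 1 ≫ (powHom κ m ≫ q ⊗ₘ κ) := by
  have h1 : wordProd (κ ≫ inl D D) (κ ≫ inr D D) (m + 1) m = (powHom κ m ⊗ₘ κ) := by
    change (wordProd (κ ≫ inl D D) (κ ≫ inr D D) m m ⊗ₘ if m < m then _ else _) ≫ μ = _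
    rw [wordProd_self _ _ _ _ le_rfl, if_neg (lt_irrefl m)]
    change (powHom _ m ⊗ₘ _) ≫ μ = _
    rw [← powHom_comp, ← tensorHom_comp_tensorHom, Category.assoc, inl_inr_mul, Category.comp_id]
  rw [← Category.assoc, powHom_comul hκ, Finset.sum_range_succ, Finset.sum_range_succ,
    Preadditive.add_comp, Preadditive.add_comp, Preadditive.sum_comp, Finset.sum_eq_zero,
    zero_add, Nat.sub_self, unshuffleHom_zero_right,
    Category.id_comp, wordProd_self _ _ _ _ le_rfl, Nat.add_sub_cancel_left, h1]
  · refine (add_comm _ _).trans ?_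
    change powHom _ (m + 1) ≫ _ + _ = _
    rw [← powHom_comp, Category.assoc, inl_whiskerRight, Category.assoc]
    congr 2
    rw [← tensorHom_id, tensorHom_comp_tensorHom, Category.comp_id]
  · intro i hi
    have := Finset.mem_range.1 hi
    rw [Category.assoc, wordProd_comp_quotient hq (by omega) (by omega), comp_zero]

end

/-- The quotient of `D` by the sum of the images of the `n`-fold products of `κ`, for `n < m`. -/
noncomputable def lowQuot {K D : C} [MonObj D] (κ : K ⟶ D) (m : ℕ) :
    D ⟶ cokernel (biproduct.desc fun n : Fin m => powHom κ n) :=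
  cokernel.π _

theorem powHom_lowQuot {K D : C} [MonObj D] (κ : K ⟶ D) {m n : ℕ} (h : n < m) :
    powHom κ n ≫ lowQuot κ m = 0 := by
  have h1 : biproduct.ι (fun n : Fin m => tpow K n) ⟨n, h⟩ ≫
      biproduct.desc (fun n : Fin m => powHom κ n) = powHom κ n := biproduct.ι_desc _ _
  rw [← h1, Category.assoc, lowQuot, cokernel.condition, comp_zero]

theorem exists_of_comp_lowQuot {K D P : C} [MonObj D] (κ : K ⟶ D) {m : ℕ} (y : P ⟶ D)
    (hy : y ≫ lowQuot κ m = 0) : ∃ (P' : C) (e : P' ⟶ P) (_ : Epi e) (x : ∀ n, P' ⟶ tpow K n),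
      e ≫ y = ∑ n ∈ Finset.range m, x n ≫ powHom κ n := by
  obtain ⟨P', e, he, x, hx⟩ := (ShortComplex.exact_cokernel
    (biproduct.desc fun n : Fin m => powHom κ n)).exact_up_to_refinements y hy
  refine ⟨P', e, he, fun n => if h : n < m then
    x ≫ biproduct.π (fun n : Fin m => tpow K n) ⟨n, h⟩ else 0, ?_⟩
  rw [hx, ← Fin.sum_univ_eq_sum_range (fun n => (if h : n < m then
    x ≫ biproduct.π (fun n : Fin m => tpow K n) ⟨n, h⟩ else 0) ≫ powHom κ n)]
  change x ≫ biproduct.desc _ = _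
  rw [biproduct.desc_eq, Preadditive.comp_sum]
  refine Finset.sum_congr rfl fun n _ => ?_
  rw [dif_pos n.2, Category.assoc]

variable [∀ X : C, PreservesFiniteLimits (tensorLeft X)]

/-- Exactness of the tensor product on the left: a generalized element of `X ⊗ K` in the kernel of
`a ⊗ K` is killed by `b ⊗ K` if the kernel of `a` is killed by `b`. -/
theorem comp_whiskerRight_eq_zero {P X Y Z K : C} (y : P ⟶ X ⊗ K) (a : X ⟶ Y) (b : X ⟶ Z)
    (h : kernel.ι a ≫ b = 0) (hy : y ≫ a ▷ K = 0) : y ≫ b ▷ K = 0 := by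
  let l := KernelFork.IsLimit.lift'
    (isLimitOfHasKernelOfPreservesLimit (tensorRight K) a) y hy
  have h1 : l.1 ≫ kernel.ι a ▷ K = y := l.2
  rw [← h1, Category.assoc, ← comp_whiskerRight, h, MonoidalPreadditive.zero_whiskerRight,
    comp_zero]

/-- A primitive multiple of the unit vanishes. -/
theorem eq_zero_of_primitive {D P : C} [MonObj D] [Mono (η : 𝟙_ C ⟶ D)] {d : D ⟶ D ⊗ D}
    [IsMonHom d] (t : P ⟶ 𝟙_ C)
    (h : (t ≫ η) ≫ d = (t ≫ η) ≫ inl D D + (t ≫ η) ≫ inr D D) : t = 0 := by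
  rw [Category.assoc, IsMonHom.one_hom, Category.assoc, IsMonHom.one_hom, Category.assoc,
    IsMonHom.one_hom, left_eq_add, ← IsMonHom.one_hom (f := inl D D), ← Category.assoc] at h
  have : Mono (inl D D) := by
    rw [inl]
    infer_instance
  rwa [← zero_comp (f := inl D D), cancel_mono, ← zero_comp (f := (η : 𝟙_ C ⟶ D)),
    cancel_mono] at h

variable {K D : C} [MonObj D] {d : D ⟶ D ⊗ D} [IsMonHom d] {κ : K ⟶ D} [Mono κ]
  [Mono (η : 𝟙_ C ⟶ D)] (hκ : κ ≫ d = κ ≫ inl D D + κ ≫ inr D D)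

include hκ

/-- If `z` is a sum of products of at most `m + 1` primitives and behaves as a primitive modulo
products of fewer than `m` primitives, then its leading coefficient is killed by the quantum
symmetrizer, provided that this holds for the kernel of `m`-fold products modulo shorter ones. -/
theorem leading_comp_sym {m : ℕ} (hm : ∀ (P : C) (y : P ⟶ tpow K m),
      y ≫ powHom κ m ≫ lowQuot κ m = 0 → y ≫ sym K m = 0) {P : C} (x : ∀ n, P ⟶ tpow K n)
    (y : P ⟶ tpow K (m + 1)) (z : P ⟶ D)
    (hz : z = ∑ n ∈ Finset.range (m + 1), x n ≫ powHom κ n + y ≫ powHom κ (m + 1))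
    (hzd : z ≫ d ≫ lowQuot κ m ▷ D = z ≫ lowQuot κ m ≫ inl _ D) : y ≫ sym K (m + 1) = 0 := by
  have hq : ∀ n < m, powHom κ n ≫ lowQuot κ m = 0 := fun n hn => powHom_lowQuot κ hn
  rw [Finset.sum_range_succ] at hz
  rw [hz] at hzd
  simp only [Preadditive.add_comp, Preadditive.sum_comp, Category.assoc] at hzd
  rw [Finset.sum_eq_zero fun n hn => by
      rw [powHom_comul_of_lt hκ hq (Finset.mem_range.1 hn), comp_zero],
    Finset.sum_eq_zero fun n hn => by
      rw [reassoc_of% (hq n (Finset.mem_range.1 hn)), zero_comp, comp_zero],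
    powHom_comul_self hκ hq, powHom_comul_succ hκ hq, Preadditive.comp_add, ← add_assoc,
    add_eq_left, MonoidalCategory.tensorHom_def] at hzd
  -- The component of bidegree `(m, 1)` vanishes, and `κ` is a monomorphism.
  have h1 : (y ≫ unshuffleHom K (m + 1) m 1) ≫ (powHom κ m ≫ lowQuot κ m) ▷ K = 0 := by
    rw [← cancel_mono (_ ◁ κ), zero_comp, Category.assoc, Category.assoc]
    exact hzd
  rw [sym_succ, ← Category.assoc]
  exact comp_whiskerRight_eq_zero _ _ _ (hm _ _ (kernel.condition _)) h1

/-- An element of `K^{⊗ m}` whose product is a sum of shorter products is killed by the quantum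
symmetrizer. -/
theorem comp_sym_of_comp_lowQuot : ∀ (m : ℕ) (P : C) (y : P ⟶ tpow K m),
    y ≫ powHom κ m ≫ lowQuot κ m = 0 → y ≫ sym K m = 0
  | 0, P, y, hy => by
    obtain ⟨P', e, he, x, hx⟩ := exists_of_comp_lowQuot κ (y ≫ powHom κ 0)
      ((Category.assoc _ _ _).trans hy)
    rw [Finset.sum_range_zero, powHom_zero, ← Category.assoc, ← zero_comp, cancel_mono,
      ← comp_zero (f := e), cancel_epi] at hx
    rw [hx, zero_comp]
  | m + 1, P, y, hy => by
    obtain ⟨P', e, he, x, hx⟩ := exists_of_comp_lowQuot κ (y ≫ powHom κ (m + 1))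
      ((Category.assoc _ _ _).trans hy)
    have h := leading_comp_sym hκ (comp_sym_of_comp_lowQuot m) (fun n => -x n) (e ≫ y) 0
      (by rw [Category.assoc, hx]; simp) (by rw [zero_comp, zero_comp])
    rwa [Category.assoc, ← comp_zero (f := e), cancel_epi] at h

variable (hK : ∀ n (P : C) (y : P ⟶ tpow K n), y ≫ sym K n = 0 → y ≫ powHom κ n = 0)

include hK

/-- Relations between products of primitives are consequences of those given by the kernels of
the quantum symmetrizers. -/
theorem comp_sym_of_sum_eq_zero : ∀ (p : ℕ) {P : C} (x : ∀ n, P ⟶ tpow K n),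
    ∑ n ∈ Finset.range p, x n ≫ powHom κ n = 0 → ∀ n < p, x n ≫ sym K n = 0
  | 0, _, _, _, n, hn => absurd hn (Nat.not_lt_zero n)
  | p + 1, P, x, hx, n, hn => by
    rw [Finset.sum_range_succ] at hx
    have h1 : x p ≫ sym K p = 0 := by
      refine comp_sym_of_comp_lowQuot hκ p P (x p) ?_
      have h := congrArg (· ≫ lowQuot κ p) hx
      simp only [Preadditive.add_comp, Preadditive.sum_comp, Category.assoc, zero_comp] at h
      rwa [Finset.sum_eq_zero fun n hn => by
        rw [powHom_lowQuot κ (Finset.mem_range.1 hn), comp_zero], zero_add] at h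
    rcases Nat.lt_succ_iff_lt_or_eq.1 hn with h | rfl
    · rw [hK p P _ h1, add_zero] at hx
      exact comp_sym_of_sum_eq_zero p x hx n h
    · exact h1

/-- If the kernels of the quantum symmetrizers die in `D`, then a primitive element which is a
sum of products of elements of `K` is an element of `K`. -/
theorem exists_eq_of_primitive : ∀ (p : ℕ) {P : C} (x : ∀ n, P ⟶ tpow K n) (z : P ⟶ D),
    z = ∑ n ∈ Finset.range p, x n ≫ powHom κ n → z ≫ d = z ≫ inl D D + z ≫ inr D D →
      ∃ t : P ⟶ K, z = t ≫ κ
  | 0, _, _, z, hz, _ => ⟨0, by rw [hz, Finset.sum_range_zero, zero_comp]⟩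
  | 1, P, x, z, hz, hd => ⟨0, by
    rw [Finset.sum_range_one, powHom_zero] at hz
    rw [hz] at hd
    rw [hz, eq_zero_of_primitive _ hd, zero_comp, zero_comp]⟩
  | 2, P, x, z, hz, hd => by
    rw [Finset.sum_range_succ, Finset.sum_range_one, powHom_zero, powHom_one] at hz
    refine ⟨x 1 ≫ (λ_ K).hom, ?_⟩
    have h1 : (x 0 ≫ η) ≫ d = (x 0 ≫ η) ≫ inl D D + (x 0 ≫ η) ≫ inr D D := by
      have h2 : x 0 ≫ η = z - (x 1 ≫ (λ_ K).hom) ≫ κ := by rw [hz]; simp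
      rw [h2]
      simp only [Preadditive.sub_comp, hd, Category.assoc, hκ, Preadditive.comp_add]
      abel
    rw [hz, eq_zero_of_primitive _ h1, zero_comp, zero_add, Category.assoc]
  | p + 3, P, x, z, hz, hd => by
    rw [Finset.sum_range_succ] at hz
    have h1 : x (p + 2) ≫ sym K (p + 2) = 0 := by
      refine leading_comp_sym hκ (comp_sym_of_comp_lowQuot hκ (p + 1)) x _ z hz ?_
      -- The term `1 ⊗ z` dies modulo shorter products, as the unit is the empty product.
      have h2 : inr D D ≫ lowQuot κ (p + 1) ▷ D = 0 := by
        rw [inr, Category.assoc, ← comp_whiskerRight, ← powHom_zero κ,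
          powHom_lowQuot κ (Nat.succ_pos p), MonoidalPreadditive.zero_whiskerRight, comp_zero]
      rw [reassoc_of% hd, Preadditive.add_comp, Category.assoc, Category.assoc, h2, comp_zero,
        add_zero, inl_whiskerRight]
    rw [hK _ P _ h1, add_zero] at hz
    exact exists_eq_of_primitive (p + 2) x z hz hd

end Filtration

/-! ### The quotient by the kernels of the quantum symmetrizers -/

section SymKer

variable {C : Type u} [Category.{v} C] [Abelian C] [MonoidalCategory C] [MonoidalPreadditive C]
  [BraidedCategory C] [HasColimitsOfSize.{w, w} C]

/-- The sum of the kernels of the quantum symmetrizers on the tensor powers of `V`. -/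
noncomputable def symKer (V : C) : C := ∐ fun n : ULift.{w} ℕ => kernel (sym V n.down)

/-- The inclusion of the kernel in degree `n`. -/
noncomputable def symKer.inc (V : C) (n : ℕ) : kernel (sym V n) ⟶ symKer.{w} V :=
  Sigma.ι (fun n : ULift.{w} ℕ => kernel (sym V n.down)) ⟨n⟩

/-- The element of `symKer V` given by an element of degree `n` killed by the quantum
symmetrizer. -/
noncomputable def symKer.mk {V P : C} {n : ℕ} (y : P ⟶ tpow V n) (hy : y ≫ sym V n = 0) :
    P ⟶ symKer.{w} V :=
  kernel.lift _ y hy ≫ symKer.inc V n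

theorem symKer.hom_ext {V Z : C} {f g : symKer.{w} V ⟶ Z}
    (h : ∀ n, symKer.inc V n ≫ f = symKer.inc V n ≫ g) : f = g :=
  Sigma.hom_ext _ _ fun n => h n.down

/-- A map out of `symKer V` given by its restrictions to the kernels. -/
noncomputable def symKer.desc {V Z : C} (f : ∀ n, kernel (sym V n) ⟶ Z) : symKer.{w} V ⟶ Z :=
  Sigma.desc fun n => f n.down

theorem symKer.inc_desc {V Z : C} (f : ∀ n, kernel (sym V n) ⟶ Z) (n : ℕ) :
    symKer.inc.{w} V n ≫ symKer.desc f = f n :=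
  Sigma.ι_desc _ _

/-- The relations in a monoid `Z` imposed by the kernels of the quantum symmetrizers on the tensor
powers of `V`, for `z : V ⟶ Z`. -/
noncomputable def symRel {V Z : C} [MonObj Z] (z : V ⟶ Z) : symKer.{w} V ⟶ Z :=
  symKer.desc fun n => kernel.ι (sym V n) ≫ powHom z n

theorem symKer.inc_symRel {V Z : C} [MonObj Z] (z : V ⟶ Z) (n : ℕ) :
    symKer.inc.{w} V n ≫ symRel z = kernel.ι (sym V n) ≫ powHom z n :=
  symKer.inc_desc _ n

theorem symKer.mk_symRel {V P Z : C} [MonObj Z] {n : ℕ} (y : P ⟶ tpow V n)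
    (hy : y ≫ sym V n = 0) (z : V ⟶ Z) : symKer.mk.{w} y hy ≫ symRel z = y ≫ powHom z n := by
  rw [symKer.mk, Category.assoc, symKer.inc_symRel, kernel.lift_ι_assoc]

theorem symRel_ext {V Z Y : C} [MonObj Z] {z : V ⟶ Z} {f : Z ⟶ Y}
    (h : ∀ n, kernel.ι (sym V n) ≫ powHom z n ≫ f = 0) : symRel.{w} z ≫ f = 0 := by
  refine symKer.hom_ext fun n => ?_
  rw [← Category.assoc, symKer.inc_symRel, Category.assoc, h, comp_zero]

theorem symRel_comp {V Z Z' : C} [MonObj Z] [MonObj Z'] (z : V ⟶ Z) (f : Z ⟶ Z') [IsMonHom f] :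
    symRel.{w} z ≫ f = symRel (z ≫ f) := by
  refine symKer.hom_ext fun n => ?_
  rw [← Category.assoc, symKer.inc_symRel, symKer.inc_symRel, Category.assoc, powHom_comp]

variable [∀ X : C, PreservesFiniteColimits (tensorLeft X)]

/-- The quotient of `Z` by the ideal generated by the kernels of the quantum symmetrizers. -/
noncomputable abbrev symQuot {V Z : C} [MonObj Z] (z : V ⟶ Z) : C := quot (symRel.{w} z)

/-- The projection to `symQuot`. -/
noncomputable abbrev symQuot.π {V Z : C} [MonObj Z] (z : V ⟶ Z) : Z ⟶ symQuot.{w} z :=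
  quot.π (symRel z)

theorem comp_powHom_symQuot {V Z P : C} [MonObj Z] (z : V ⟶ Z) {n : ℕ} (y : P ⟶ tpow V n)
    (hy : y ≫ sym V n = 0) : y ≫ powHom z n ≫ symQuot.π.{w} z = 0 := by
  rw [← Category.assoc, ← symKer.mk_symRel y hy, Category.assoc, quot.rel_π, comp_zero]

end SymKer

section Ideal

variable {C : Type u} [Category.{v} C] [Abelian C] [MonoidalCategory C] [MonoidalPreadditive C]
  [BraidedCategory C] [HasColimitsOfSize.{w, w} C]
  [∀ X : C, PreservesColimitsOfSize.{w, w} (tensorLeft X)]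

theorem powHom_add {V Z : C} [MonObj Z] (z : V ⟶ Z) (a b : ℕ) :
    (powHom z a ⊗ₘ powHom z b) ≫ μ = (catIso V a b).hom ≫ powHom z (a + b) := by
  rw [powHom, powHom, powHom, ← Category.assoc, catIso_tpowMap, Category.assoc, mulN_catIso,
    tensorHom_comp_tensorHom_assoc]

theorem tensorAlg_symKer_hom_ext {V Z : C}
    {f g : (tensorAlg.{w} V ⊗ symKer.{w} V) ⊗ tensorAlg.{w} V ⟶ Z}
    (h : ∀ a n b, ((tensorAlg.inc V a ⊗ₘ symKer.inc V n) ⊗ₘ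
        tensorAlg.inc V b) ≫ f =
      ((tensorAlg.inc V a ⊗ₘ symKer.inc V n) ⊗ₘ
        tensorAlg.inc V b) ≫ g) : f = g := by
  refine tensorAlg.hom_ext_left fun b => ?_
  refine Cofan.IsColimit.hom_ext (isColimitCofanMkObjOfIsColimit (tensorRight (tpow V b)) _ _
    (tensorAlg.isColimitRight V (symKer.{w} V))) _ _ fun a => ?_
  refine Cofan.IsColimit.hom_ext (isColimitCofanMkObjOfIsColimit (tensorRight (tpow V b)) _ _
    (isColimitCofanMkObjOfIsColimit (tensorLeft (tpow V a.down)) _ _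
      (coproductIsCoproduct fun n : ULift.{w} ℕ => kernel (sym V n.down)))) _ _ fun n => ?_
  have := h a.down n.down b
  rw [MonoidalCategory.tensorHom_def, MonoidalCategory.tensorHom_def',
    comp_whiskerRight] at this
  simp only [Category.assoc] at this
  exact this

variable [∀ X : C, PreservesFiniteColimits (tensorLeft X)]

/-- If `V` generates `Z`, then the image of the relations is already a two-sided ideal, as the
kernels of the quantum symmetrizers form an ideal of the tensor algebra. -/
theorem idealMap_symRel_cokernel {V Z : C} [MonObj Z] (z : V ⟶ Z)
    [Epi (tensorAlg.lift.{w} z)] : idealMap (symRel.{w} z) ≫ cokernel.π (symRel.{w} z) = 0 := by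
  let φ := tensorAlg.lift.{w} z
  rw [← cancel_epi ((φ ⊗ₘ 𝟙 _) ⊗ₘ φ), comp_zero]
  refine tensorAlg_symKer_hom_ext fun a n b => ?_
  have h1 : ((tensorAlg.inc V a ⊗ₘ symKer.inc V n) ⊗ₘ
      tensorAlg.inc V b) ≫ ((φ ⊗ₘ 𝟙 _) ⊗ₘ φ) ≫ idealMap (symRel.{w} z) =
      ((tpow V a ◁ kernel.ι (sym V n)) ▷ tpow V b ≫ (catIso V a n).hom ▷ tpow V b ≫
        (catIso V (a + n) b).hom) ≫ powHom z (a + n + b) := by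
    have h2 : ∀ m, tensorAlg.inc V m ≫ φ = powHom z m := tensorAlg.inc_lift z
    have h3 := symKer.inc_symRel.{w} z n
    rw [idealMap, ← tensorHom_id, ← id_tensorHom]
    simp only [tensorHom_comp_tensorHom_assoc, Category.comp_id, Category.id_comp, h2, h3,
      Category.assoc]
    have h4 : (powHom z a ⊗ₘ kernel.ι (sym V n) ≫ powHom z n) ≫ μ =
        tpow V a ◁ kernel.ι (sym V n) ≫ (catIso V a n).hom ≫ powHom z (a + n) := by
      rw [← powHom_add, ← id_tensorHom, tensorHom_comp_tensorHom_assoc, Category.id_comp]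
    rw [h4, ← powHom_add z (a + n) b, ← tensorHom_id, ← tensorHom_id,
      tensorHom_comp_tensorHom_assoc, tensorHom_comp_tensorHom_assoc, Category.id_comp,
      Category.id_comp, Category.assoc]
  have h2 := ideal_sym a n b (kernel.ι (sym V n)) (kernel.condition _)
  have h3 := congrArg (· ≫ cokernel.π (symRel.{w} z)) h1
  simp only [Category.assoc] at h3
  rw [h3, comp_zero, ← Category.assoc, ← Category.assoc, ← Category.assoc]
  simp only [← Category.assoc] at h2
  rw [← symKer.mk_symRel.{w} _ h2, Category.assoc, cokernel.condition, comp_zero]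

/-- If `V` generates `Z`, an element that dies in the quotient is, up to a cover, the value of a
relation, without multiplying by elements of `Z`. -/
theorem exists_of_comp_symQuot {V Z P : C} [MonObj Z] (z : V ⟶ Z)
    [Epi (tensorAlg.lift.{w} z)] (y : P ⟶ Z) (hy : y ≫ symQuot.π.{w} z = 0) :
    ∃ (P' : C) (e : P' ⟶ P) (_ : Epi e) (g : P' ⟶ symKer.{w} V), e ≫ y = g ≫ symRel z := by
  refine (ShortComplex.exact_cokernel (symRel.{w} z)).exact_up_to_refinements y ?_
  have h : cokernel.π (symRel.{w} z) =
      symQuot.π z ≫ cokernel.desc _ _ (idealMap_symRel_cokernel z) :=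
    (cokernel.π_desc _ _ _).symm
  change y ≫ cokernel.π (symRel.{w} z) = 0
  exact (congrArg (y ≫ ·) h).trans ((Category.assoc _ _ _).symm.trans
    ((congrArg (· ≫ _) hy).trans zero_comp))

end Ideal

/-! ### The quotient bialgebra -/

section Bialgebra

variable {C : Type u} [Category.{v} C] [Abelian C] [MonoidalCategory C] [MonoidalPreadditive C]
  [BraidedCategory C] [HasColimitsOfSize.{w, w} C]
  [∀ X : C, PreservesFiniteColimits (tensorLeft X)]
  [∀ X : C, PreservesFiniteLimits (tensorLeft X)]

theorem comp_whiskerLeft_eq_zero {P X Y Z K : C} (y : P ⟶ K ⊗ X) (a : X ⟶ Y) (b : X ⟶ Z)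
    (h : kernel.ι a ≫ b = 0) (hy : y ≫ K ◁ a = 0) : y ≫ K ◁ b = 0 := by
  let l := KernelFork.IsLimit.lift'
    (isLimitOfHasKernelOfPreservesLimit (tensorLeft K) a) y hy
  have h1 : l.1 ≫ K ◁ kernel.ι a = y := l.2
  rw [← h1, Category.assoc, ← whiskerLeft_comp, h, MonoidalPreadditive.whiskerLeft_zero,
    comp_zero]

/-- Exactness of the tensor product in both variables: what is killed by `a ⊗ a'` is killed by
`b ⊗ b'` if the kernels of `a` and `a'` are killed by `b` and `b'`. -/
theorem comp_tensorHom_eq_zero {P X Y Z X' Y' Z' : C} (y : P ⟶ X ⊗ X') (a : X ⟶ Y) (b : X ⟶ Z)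
    (a' : X' ⟶ Y') (b' : X' ⟶ Z') (h : kernel.ι a ≫ b = 0) (h' : kernel.ι a' ≫ b' = 0)
    (hy : y ≫ (a ⊗ₘ a') = 0) : y ≫ (b ⊗ₘ b') = 0 := by
  rw [MonoidalCategory.tensorHom_def, ← Category.assoc] at hy
  have h1 := comp_whiskerLeft_eq_zero _ a' b' h' hy
  rw [Category.assoc, ← whisker_exchange, ← Category.assoc] at h1
  have h2 := comp_whiskerRight_eq_zero _ a b h h1
  rw [tensorHom_def', ← Category.assoc, h2]

variable {V A : C} [MonObj A] {d : A ⟶ A ⊗ A} [IsMonHom d] {v : V ⟶ A}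
  (hv : v ≫ d = v ≫ inl A A + v ≫ inr A A)

include hv

/-- The comultiplication descends to the quotient: the component of bidegree `(i, j)` of the
comultiplication on `V^{⊗ n}` is an unshuffle, which maps the kernel of the quantum symmetrizer to
the kernel of the tensor product of the quantum symmetrizers in degrees `i` and `j`. -/
theorem symRel_comul : symRel.{w} v ≫ d ≫ (symQuot.π.{w} v ⊗ₘ symQuot.π.{w} v) = 0 := by
  refine symRel_ext fun n => ?_
  set π := symQuot.π.{w} v
  have h1 : v ≫ d ≫ (π ⊗ₘ π) = (v ≫ π) ≫ inl _ _ + (v ≫ π) ≫ inr _ _ := by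
    rw [reassoc_of% hv, Preadditive.add_comp, Category.assoc, Category.assoc, inl_naturality,
      inr_naturality, Category.assoc, Category.assoc]
  have h2 : powHom v n ≫ d ≫ (π ⊗ₘ π) = _ := powHom_comp v (d ≫ (π ⊗ₘ π)) n
  rw [h2, h1, powHom, tpowMap_add_mulN (inr_inl_comm _ _), Preadditive.comp_sum]
  refine Finset.sum_eq_zero fun i hi => ?_
  obtain ⟨j, rfl⟩ : ∃ j, n = i + j := ⟨n - i, by have := Finset.mem_range.1 hi; omega⟩
  rw [Nat.add_sub_cancel_left, wordProd_inl_inr, ← Category.assoc, ← Category.assoc]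
  refine comp_tensorHom_eq_zero _ (sym V i) _ (sym V j) _ ?_ ?_ ?_
  · rw [← powHom_comp]
    exact comp_powHom_symQuot v _ (kernel.condition _)
  · rw [← powHom_comp]
    exact comp_powHom_symQuot v _ (kernel.condition _)
  · rw [← cancel_mono (catIso V i j).hom, zero_comp, Category.assoc, Category.assoc,
      Category.assoc, ← sym_add, kernel.condition]

/-- The comultiplication of the quotient. -/
noncomputable def symQuot.comul : symQuot.{w} v ⟶ symQuot.{w} v ⊗ symQuot.{w} v :=
  quot.desc _ (d ≫ (symQuot.π v ⊗ₘ symQuot.π v)) (symRel_comul hv)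

instance symQuot.comul_isMonHom : IsMonHom (symQuot.comul.{w} hv) := quot.desc_isMonHom _ _ _

theorem symQuot.π_comul :
    symQuot.π.{w} v ≫ symQuot.comul hv = d ≫ (symQuot.π v ⊗ₘ symQuot.π v) :=
  quot.π_desc _ _ _

theorem symQuot.primitive : (v ≫ symQuot.π.{w} v) ≫ symQuot.comul hv =
    (v ≫ symQuot.π v) ≫ inl _ _ + (v ≫ symQuot.π v) ≫ inr _ _ := by
  rw [Category.assoc, symQuot.π_comul, reassoc_of% hv, Preadditive.add_comp, Category.assoc,
    Category.assoc, inl_naturality, inr_naturality, Category.assoc, Category.assoc]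

omit hv in
/-- The unit of the quotient is a monomorphism if `A` has an augmentation that vanishes on `V`. -/
theorem symQuot.mono_one {e : A ⟶ 𝟙_ C} [IsMonHom e] (he : v ≫ e = 0) :
    Mono (η : 𝟙_ C ⟶ symQuot.{w} v) := by
  have h : symRel.{w} v ≫ e = 0 := by
    refine symRel_ext fun n => ?_
    -- The quantum symmetrizer in degree zero is the identity, so no relation kills the unit.
    cases n with
    | zero =>
      have h1 := kernel.condition (sym V 0)
      rw [sym_zero, Category.comp_id] at h1
      rw [show kernel.ι (sym V 0) = 0 from h1, zero_comp]
    | succ n =>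
      rw [powHom_comp, he, powHom, tpowMap, MonoidalPreadditive.tensor_zero, zero_comp, comp_zero]
  have h1 : (η : 𝟙_ C ⟶ symQuot.{w} v) ≫ quot.desc _ e h = 𝟙 _ := by
    change (η ≫ quot.π _) ≫ _ = _
    rw [Category.assoc, quot.π_desc, IsMonHom.one_hom]
    rfl
  have : Mono ((η : 𝟙_ C ⟶ symQuot.{w} v) ≫ quot.desc _ e h) := by
    rw [h1]
    infer_instance
  exact mono_of_mono _ (quot.desc _ e h)

end Bialgebra

/-! ### Generation by a subobject -/

section Generation

variable {C : Type u} [Category.{v} C] [Abelian C]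

theorem exists_of_comp_cokernel {P X Y : C} (f : X ⟶ Y) [Mono f] (y : P ⟶ Y)
    (h : y ≫ cokernel.π f = 0) : ∃ t, y = t ≫ f :=
  ⟨(ShortComplex.exact_cokernel f).lift y h, ((ShortComplex.exact_cokernel f).lift_f y h).symm⟩

/-- Membership in a subobject may be checked after passing to a cover. -/
theorem factors_of_epi {P P' Y : C} (S : Subobject Y) (e : P' ⟶ P) [Epi e] (y : P ⟶ Y)
    (h : S.Factors (e ≫ y)) : S.Factors y := by
  obtain ⟨t, ht⟩ := exists_of_comp_cokernel S.arrow y (by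
    rw [← cancel_epi e, comp_zero, ← Category.assoc, ← S.factorThru_arrow _ h, Category.assoc,
      cokernel.condition, comp_zero])
  rw [ht]
  exact S.factors_comp_arrow t

variable [MonoidalCategory C] [BraidedCategory C] [HasColimitsOfSize.{w, w} C]
  [∀ X : C, PreservesColimitsOfSize.{w, w} (tensorLeft X)]
  [∀ X : C, PreservesFiniteColimits (tensorLeft X)]

theorem epi_tensorAlg_lift_comp {W L B : C} [MonObj B] (c : W ⟶ L) [Epi c] (f : L ⟶ B)
    [Epi (tensorAlg.lift.{w} f)] : Epi (tensorAlg.lift.{w} (c ≫ f)) where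
  left_cancellation g g' h := by
    rw [← cancel_epi (tensorAlg.lift.{w} f)]
    refine tensorAlg.hom_ext fun n => ?_
    have := epi_tpowMap c n
    have h1 := congrArg (tensorAlg.inc W n ≫ ·) h
    simp only [← Category.assoc, tensorAlg.inc_lift, tpowMap_comp] at h1 ⊢
    simp only [Category.assoc] at h1 ⊢
    exact (cancel_epi _).1 h1

/-- If elements of the subalgebra generated by `V` generate `B`, then so does `V`. -/
theorem epi_tensorAlg_lift_of_comp {V W B : C} [MonObj B] (f : V ⟶ B) (m : W ⟶ tensorAlg.{w} V)
    [Epi (tensorAlg.lift.{w} (m ≫ tensorAlg.lift.{w} f))] : Epi (tensorAlg.lift.{w} f) := by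
  refine epi_of_epi_fac (f := tensorAlg.lift.{w} m)
    (h := tensorAlg.lift.{w} (m ≫ tensorAlg.lift.{w} f)) ?_
  refine tensorAlg.monHom_ext ?_
  rw [← Category.assoc, tensorAlg.gen_lift, tensorAlg.gen_lift]

end Generation

section Wor

variable (k : Type w) [Field k] [CharZero k] {C : Type u} [Category.{v} C] [Abelian C]
  [Linear k C] [MonoidalCategory C] [MonoidalPreadditive C] [BraidedCategory C]

theorem wor_le_worStar (n : ℕ) : Wor k n ≤ WorStar k n := by
  rw [WorStar]
  split_ifs
  exacts [le_top, le_rfl]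

/-- A generalized element killed by the quantum symmetrizer is fixed by an element of the
Woronowicz operad. -/
theorem exists_comp_hatAct_eq {X : C} (hX : FinitelyBraided X) (n : ℕ) : ∃ x ∈ Wor k n,
    ∀ {P : C} (y : P ⟶ tpow X n), y ≫ sym X n = 0 → y ≫ hatAct k X n x = y := by
  obtain ⟨x, hx, t, ht⟩ := exists_hatAct_eq (k := k) hX n
  refine ⟨x, hx, fun {P} y hy => ?_⟩
  rw [ht, Preadditive.comp_sub, Category.comp_id, ← Category.assoc, hy, zero_comp, sub_zero]

variable [HasColimitsOfSize.{w, w} C]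

variable {k} in
/-- In an algebra over the Woronowicz operad, the kernels of the quantum symmetrizers become
operations: products killed by the quantum symmetrizers can be computed without the
multiplication. -/
theorem exists_comp_eq_symRel {V L : C} (hV : FinitelyBraided V) (hL : FinitelyBraided L)
    (op : Ops k L) (i : V ⟶ L) : ∃ R : symKer.{w} V ⟶ L, ∀ {B : C} [MonObj B] (f : L ⟶ B),
      IsWorHom op f → R ≫ f = symRel (i ≫ f) := by
  choose x hx hx' using exists_comp_hatAct_eq k hV
  refine ⟨symKer.desc fun n => kernel.ι (sym V n) ≫ tpowMap i n ≫
    op n ⟨x n, wor_le_worStar k n (hx n)⟩, fun {B} _ f hf => ?_⟩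
  refine symKer.hom_ext fun n => ?_
  rw [symKer.inc_symRel, ← Category.assoc, symKer.inc_desc, Category.assoc, Category.assoc, hf]
  dsimp only
  rw [← Category.assoc (tpowMap i n), ← hatAct_naturality hV hL, Category.assoc, ← Category.assoc,
    hx' n _ (kernel.condition _), powHom, tpowMap_comp, Category.assoc]

variable [∀ X : C, PreservesFiniteColimits (tensorLeft X)]

include k in
/-- Let `K` be a quotient of `V` which maps to `symQuot z`, compatibly with `V`. Although kernels of
quantum symmetrizers need not be preserved by epimorphisms, the kernel on `K^{⊗ n}` is the image of
an element of `𝔚(n)`, which also acts on `V^{⊗ n}`; so products of elements of `K` killed by the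
quantum symmetrizer vanish as well. -/
theorem comp_powHom_of_sym {V K Z : C} [MonObj Z] (hV : FinitelyBraided V) (p : V ⟶ K) [Epi p]
    (z : V ⟶ Z) (κ : K ⟶ symQuot.{w} z) (h : p ≫ κ = z ≫ symQuot.π z) (n : ℕ) {P : C}
    (y : P ⟶ tpow K n) (hy : y ≫ sym K n = 0) : y ≫ powHom κ n = 0 := by
  have hK := hV.of_epi p
  obtain ⟨x, hx, hx'⟩ := exists_comp_hatAct_eq k hK n
  have := epi_tpowMap p n
  obtain ⟨P', e, he, y', hy'⟩ := surjective_up_to_refinements_of_epi (tpowMap p n) y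
  rw [← hx' y hy, ← cancel_epi e, comp_zero, Category.assoc, reassoc_of% hy',
    ← Category.assoc (tpowMap p n), ← hatAct_naturality hV hK, Category.assoc, tpowMap_powHom, h,
    ← powHom_comp, ← Category.assoc (hatAct k V n x)]
  have h1 := comp_powHom_symQuot z _ (hatAct_comp_sym hV hx)
  rw [← Category.assoc] at h1
  rw [h1, comp_zero]

end Wor

/-! ### Generating primitives -/

section Primitives

variable {C : Type u} [Category.{v} C] [Abelian C] [MonoidalCategory C] [MonoidalPreadditive C]
  [BraidedCategory C] [HasColimitsOfSize.{w, w} C]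
  [∀ X : C, PreservesFiniteColimits (tensorLeft X)]

/-- The image of `V` in the quotient by the kernels of the quantum symmetrizers. -/
noncomputable def symImage {V A : C} [MonObj A] (v : V ⟶ A) : C := image (v ≫ symQuot.π.{w} v)

namespace symImage

/-- The projection of `V` to `symImage`. -/
noncomputable def p {V A : C} [MonObj A] (v : V ⟶ A) : V ⟶ symImage.{w} v :=
  factorThruImage (v ≫ symQuot.π.{w} v)

/-- The inclusion of `symImage` in the quotient. -/
noncomputable def κ {V A : C} [MonObj A] (v : V ⟶ A) : symImage.{w} v ⟶ symQuot.{w} v :=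
  image.ι (v ≫ symQuot.π.{w} v)

variable {V A : C} [MonObj A] (v : V ⟶ A)

instance : Epi (p.{w} v) := inferInstanceAs (Epi (factorThruImage (v ≫ symQuot.π.{w} v)))

instance : Mono (κ.{w} v) := inferInstanceAs (Mono (image.ι (v ≫ symQuot.π.{w} v)))

theorem p_κ : p.{w} v ≫ κ v = v ≫ symQuot.π v := image.fac _

end symImage

/-- The inverse image in `A` of the image of `V` in the quotient by the kernels of the quantum
symmetrizers. -/
noncomputable def symClosure {V A : C} [MonObj A] (v : V ⟶ A) : Subobject A :=
  kernelSubobject (symQuot.π.{w} v ≫ cokernel.π (symImage.κ v))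

theorem symClosure_factors_iff {V A P : C} [MonObj A] (v : V ⟶ A) (y : P ⟶ A) :
    (symClosure.{w} v).Factors y ↔ ∃ t, y ≫ symQuot.π.{w} v = t ≫ symImage.κ v := by
  rw [symClosure, kernelSubobject_factors_iff]
  constructor
  · intro h
    exact exists_of_comp_cokernel _ _ ((Category.assoc _ _ _).trans h)
  · rintro ⟨t, ht⟩
    rw [← Category.assoc, ht, Category.assoc, cokernel.condition, comp_zero]

theorem symClosure_arrow {V A : C} [MonObj A] (v : V ⟶ A) : ∃ s,
    (symClosure.{w} v).arrow ≫ symQuot.π.{w} v = s ≫ symImage.κ v :=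
  (symClosure_factors_iff v _).1 ((symClosure v).factors_self)

theorem symClosure_factors {V A : C} [MonObj A] (v : V ⟶ A) : (symClosure.{w} v).Factors v :=
  (symClosure_factors_iff v v).2 ⟨symImage.p v, (symImage.p_κ v).symm⟩

variable [∀ X : C, PreservesFiniteLimits (tensorLeft X)] 

section

variable {V A : C} [MonObj A] {d : A ⟶ A ⊗ A} [IsMonHom d] {v : V ⟶ A}
  (hv : v ≫ d = v ≫ inl A A + v ≫ inr A A)

include hv in
theorem symImage.primitive : symImage.κ.{w} v ≫ symQuot.comul.{w} hv =
    symImage.κ v ≫ inl _ _ + symImage.κ v ≫ inr _ _ := by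
  rw [← cancel_epi (symImage.p v), Preadditive.comp_add, ← Category.assoc, ← Category.assoc,
    ← Category.assoc, symImage.p_κ, symQuot.primitive]

end

variable (k : Type w) [Field k] [CharZero k] [Linear k C]

/-- The closure is closed under the operations of the Woronowicz operad: modulo the kernels of the
quantum symmetrizers, they vanish in degrees different from one. -/
theorem isClosedUnder_symClosure {V A : C} [MonObj A] (hA : FinitelyBraided A) (v : V ⟶ A)
    [Mono v] : IsClosedUnder (worOps k A) (symClosure.{w} v) := fun n x => by
  let S := symClosure.{w} v
  obtain ⟨s, hs⟩ : ∃ s, S.arrow ≫ symQuot.π.{w} v = s ≫ symImage.κ v := symClosure_arrow v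
  have hV := hA.of_mono v
  have hK := hV.of_epi (symImage.p.{w} v)
  have hS := hA.of_mono S.arrow
  have h1 : (tpowMap S.arrow n ≫ worOps k A n x) ≫ symQuot.π v =
      tpowMap s n ≫ hatAct k _ n x.1 ≫ powHom (symImage.κ v) n := by
    have h2 : worOps k A n x = hatAct k A n x.1 ≫ mulN A n := rfl
    rw [h2, Category.assoc, Category.assoc, mulN_naturality, ← Category.assoc,
      ← hatAct_naturality hS hA, Category.assoc, ← Category.assoc (tpowMap _ n) (tpowMap _ n),
      ← tpowMap_comp, hs, tpowMap_comp, Category.assoc, ← Category.assoc,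
      hatAct_naturality hS hK, Category.assoc]
    rfl
  rw [symClosure_factors_iff, h1]
  by_cases hn : n = 1
  · subst hn
    exact ⟨tpowMap s 1 ≫ hatAct k _ 1 x.1 ≫ (λ_ _).hom, by rw [powHom_one]; simp⟩
  · have hx : x.1 ∈ Wor k n := by simpa [WorStar, hn] using x.2
    exact ⟨0, by rw [comp_powHom_of_sym k hV (symImage.p v) v _ (symImage.p_κ v) n _
      (hatAct_comp_sym hK hx), comp_zero, zero_comp]⟩

variable [∀ X : C, PreservesColimitsOfSize.{w, w} (tensorLeft X)]

/-- Up to a cover, an element of the closure is the sum of an element of `V` and of an element in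
the image of the kernels of the quantum symmetrizers. -/
theorem exists_of_symClosure {V A P : C} [MonObj A] (v : V ⟶ A) [Epi (tensorAlg.lift.{w} v)]
    (y : P ⟶ A) (hy : (symClosure.{w} v).Factors y) : ∃ (P' : C) (e : P' ⟶ P) (_ : Epi e)
      (x : P' ⟶ V) (g : P' ⟶ symKer.{w} V), e ≫ y = x ≫ v + g ≫ symRel v := by
  obtain ⟨t, ht⟩ := (symClosure_factors_iff v y).1 hy
  obtain ⟨P', e, he, x, hx⟩ := surjective_up_to_refinements_of_epi (symImage.p v) t
  obtain ⟨P'', e', he', g, hg⟩ := exists_of_comp_symQuot v (e ≫ y - x ≫ v) (by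
    rw [Preadditive.sub_comp, Category.assoc, ht, reassoc_of% hx, Category.assoc, symImage.p_κ,
      sub_self])
  refine ⟨P'', e' ≫ e, epi_comp _ _, e' ≫ x, g, ?_⟩
  rw [← hg, Preadditive.comp_sub]
  simp

variable {k} in
/-- The closure of `V` is contained in every closed subobject that contains `V`. -/
theorem symClosure_le {V A : C} [MonObj A] (hA : FinitelyBraided A) (v : V ⟶ A) [Mono v]
    [Epi (tensorAlg.lift.{w} v)] {S : Subobject A} (hS : IsClosedUnder (worOps k A) S)
    (h : S.Factors v) : symClosure.{w} v ≤ S := by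
  obtain ⟨R, hR⟩ := exists_comp_eq_symRel (hA.of_mono v) (hA.of_mono S.arrow)
    (restrictOps (worOps k A) S hS) (S.factorThru v h)
  have hR := hR S.arrow (isWorHom_arrow hA S hS)
  rw [S.factorThru_arrow] at hR
  obtain ⟨P, e, he, x, g, hg⟩ := exists_of_symClosure v _ ((symClosure.{w} v).factors_self)
  have : S.Factors (symClosure.{w} v).arrow := by
    refine factors_of_epi S e _ ?_
    rw [hg, ← hR, ← S.factorThru_arrow v h, ← Category.assoc, ← Category.assoc,
      ← Preadditive.add_comp]
    exact Subobject.factors_of_factors_right _ S.factors_self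
  exact Subobject.le_of_comm (S.factorThru _ this) (S.factorThru_arrow _ this)

section Bialgebra

variable {V A : C} [MonObj A] {d : A ⟶ A ⊗ A} [IsMonHom d] {v : V ⟶ A} [Mono v]
  [Epi (tensorAlg.lift.{w} v)] (hA : FinitelyBraided A)
  (hv : v ≫ d = v ≫ inl A A + v ≫ inr A A) {e : A ⟶ 𝟙_ C} [IsMonHom e] (he : v ≫ e = 0)

include k hA hv he

/-- Relations between products of generating primitives hold, modulo the kernels of the quantum
symmetrizers, for degree reasons. -/
theorem comp_sym_of_sum_eq_zero_of_gen (p : ℕ) {P : C} (x : ∀ n, P ⟶ tpow V n)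
    (hx : ∑ n ∈ Finset.range p, x n ≫ powHom v n = 0) (n : ℕ) (hn : n < p) :
    (x n ≫ tpowMap (symImage.p.{w} v) n) ≫ sym _ n = 0 := by
  have := symQuot.mono_one.{w} he
  refine comp_sym_of_sum_eq_zero (symImage.primitive.{w} hv)
    (fun n P y hy => comp_powHom_of_sym k (hA.of_mono v) (symImage.p v) v _ (symImage.p_κ v) n y hy)
    p (fun n => x n ≫ tpowMap (symImage.p v) n) ?_ n hn
  have h := congrArg (· ≫ symQuot.π.{w} v) hx
  simp only [Preadditive.sum_comp, zero_comp] at h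
  rw [← h]
  refine Finset.sum_congr rfl fun n _ => ?_
  rw [Category.assoc, tpowMap_powHom, symImage.p_κ, Category.assoc, powHom_comp]

variable [AB5OfSize.{w, w} C]

/-- The closure contains all primitives. -/
theorem symClosure_factors_of_primitive {P : C} (z : P ⟶ A)
    (hz : z ≫ d = z ≫ inl A A + z ≫ inr A A) : (symClosure.{w} v).Factors z := by
  rw [symClosure, kernelSubobject_factors_iff]
  obtain ⟨P', c, hc, x, hx⟩ := surjective_up_to_refinements_of_epi (tensorAlg.lift.{w} v) z
  rw [← cancel_epi c, comp_zero]
  refine tensorAlg.eq_zero_of_finite x _ fun P'' t p y hy => ?_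
  have h1 : t ≫ c ≫ z = ∑ n ∈ Finset.range p, y n ≫ powHom v n := by
    rw [hx, ← Category.assoc, hy, Preadditive.sum_comp]
    refine Finset.sum_congr rfl fun n _ => ?_
    rw [Category.assoc, tensorAlg.inc_lift]
    rfl
  have := symQuot.mono_one.{w} he
  -- In the quotient, the primitive `z` is a finite sum of products of elements of the image of `V`,
  -- hence an element of the image of `V`.
  obtain ⟨s, hs⟩ := exists_eq_of_primitive (symImage.primitive.{w} hv)
    (fun n P y hy => comp_powHom_of_sym k (hA.of_mono v) (symImage.p v) v _ (symImage.p_κ v) n y hy)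
    p (fun n => y n ≫ tpowMap (symImage.p v) n) ((t ≫ c ≫ z) ≫ symQuot.π v) (by
      rw [h1, Preadditive.sum_comp]
      refine Finset.sum_congr rfl fun n _ => ?_
      rw [Category.assoc, Category.assoc, tpowMap_powHom, symImage.p_κ, powHom_comp]) (by
      simp only [Category.assoc]
      rw [symQuot.π_comul, reassoc_of% hz]
      simp only [Preadditive.add_comp, Preadditive.comp_add, Category.assoc, inl_naturality,
        inr_naturality])
  have h2 := congrArg (· ≫ cokernel.π (symImage.κ v)) hs
  simp only [Category.assoc, cokernel.condition, comp_zero] at h2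
  exact h2

end Bialgebra

end Primitives

/-! ### The enveloping algebra of the closure of a generating subobject -/

section EnvelopingClosure

variable {k : Type w} [Field k] [CharZero k] {C : Type u} [Category.{v} C] [Abelian C]
  [Linear k C] [MonoidalCategory C] [MonoidalPreadditive C] [BraidedCategory C]
  [HasColimitsOfSize.{w, w} C] [∀ X : C, PreservesColimitsOfSize.{w, w} (tensorLeft X)]
  [∀ X : C, PreservesFiniteColimits (tensorLeft X)]
  [∀ X : C, PreservesFiniteLimits (tensorLeft X)]

instance Env.epi_lift_incl {L : C} (op : Ops k L) : Epi (tensorAlg.lift.{w} (Env.incl op)) := by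
  have h : tensorAlg.lift.{w} (Env.incl op) = quot.π (envRel op) := by
    refine tensorAlg.monHom_ext ?_
    rw [tensorAlg.gen_lift]
    rfl
  rw [h]
  infer_instance

variable {V A : C} [MonObj A] {v : V ⟶ A} [Mono v] [Epi (tensorAlg.lift.{w} v)]
  (hA : FinitelyBraided A) (hS : IsClosedUnder (worOps k A) (symClosure.{w} v))

include hA in
/-- The relations between the inclusion `i` of `V` in its closure and the kernels of the quantum
symmetrizers: these kernels map to the closure by operations, compatibly with all morphisms to
monoids, and together with `V` they cover the closure. -/
theorem exists_symRel_closure : ∃ (i : V ⟶ (symClosure.{w} v : C))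
    (R : symKer.{w} V ⟶ (symClosure.{w} v : C)), i ≫ (symClosure.{w} v).arrow = v ∧
    (∀ {B : C} [MonObj B] (f : (symClosure.{w} v : C) ⟶ B),
      IsWorHom (restrictOps (worOps k A) _ hS) f → R ≫ f = symRel (i ≫ f)) ∧
    R ≫ (symClosure.{w} v).arrow = symRel v ∧
    ∃ (P : C) (e : P ⟶ (symClosure.{w} v : C)) (_ : Epi e) (x : P ⟶ V) (g : P ⟶ symKer.{w} V),
      e = x ≫ i + g ≫ R := by
  let S := symClosure.{w} v
  have hi := S.factorThru_arrow v (symClosure_factors v)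
  obtain ⟨R, hR⟩ := exists_comp_eq_symRel (hA.of_mono v) (hA.of_mono S.arrow)
    (restrictOps (worOps k A) S hS) (S.factorThru v (symClosure_factors v))
  have hR' := hR S.arrow (isWorHom_arrow hA S hS)
  rw [hi] at hR'
  refine ⟨_, R, hi, hR, hR', ?_⟩
  obtain ⟨P, e, he, x, g, hg⟩ := exists_of_symClosure v S.arrow S.factors_self
  refine ⟨P, e, he, x, g, ?_⟩
  rw [← cancel_mono S.arrow, hg, Preadditive.add_comp, Category.assoc, Category.assoc, hi, hR']

/-- The enveloping algebra of the closure of `V` is generated by `V`, as the rest of the closure is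
given by products of elements of `V`. -/
theorem epi_lift_comp_incl {i : V ⟶ (symClosure.{w} v : C)}
    {R : symKer.{w} V ⟶ (symClosure.{w} v : C)}
    (hR : ∀ {B : C} [MonObj B] (f : (symClosure.{w} v : C) ⟶ B),
      IsWorHom (restrictOps (worOps k A) _ hS) f → R ≫ f = symRel (i ≫ f))
    {P : C} (e : P ⟶ (symClosure.{w} v : C)) [Epi e] (x : P ⟶ V) (g : P ⟶ symKer.{w} V)
    (he : e = x ≫ i + g ≫ R) :
    Epi (tensorAlg.lift.{w} (i ≫ Env.incl (restrictOps (worOps k A) _ hS))) := by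
  set op := restrictOps (worOps k A) _ hS
  have h : e ≫ Env.incl op = (x ≫ tensorAlg.gen V + g ≫ symRel (tensorAlg.gen.{w} V)) ≫
      tensorAlg.lift (i ≫ Env.incl op) := by
    rw [he, Preadditive.add_comp, Preadditive.add_comp, Category.assoc, Category.assoc,
      Category.assoc, Category.assoc, tensorAlg.gen_lift, symRel_comp, tensorAlg.gen_lift,
      hR _ (Env.incl_isWorHom op)]
  have := epi_tensorAlg_lift_comp e (Env.incl op)
  rw [h] at this
  exact epi_tensorAlg_lift_of_comp _ (x ≫ tensorAlg.gen V + g ≫ symRel (tensorAlg.gen.{w} V))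

variable {d : A ⟶ A ⊗ A} [IsMonHom d] (hv : v ≫ d = v ≫ inl A A + v ≫ inr A A)
  {e : A ⟶ 𝟙_ C} [IsMonHom e] (he : v ≫ e = 0) [AB5OfSize.{w, w} C]

include hv he in
/-- A bialgebra generated by primitives `V` is the enveloping algebra of the closure of `V`. -/
theorem isIso_lift_arrow : IsIso (Env.lift _ _ (isWorHom_arrow hA _ hS)) := by
  obtain ⟨i, R, hi, hR, hR', Q, q, hq, x₀, g₀, hq'⟩ := exists_symRel_closure hA hS
  have hepi := epi_lift_comp_incl hS hR q x₀ g₀ hq'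
  let op := restrictOps (worOps k A) _ hS
  let m := Env.lift op _ (isWorHom_arrow hA _ hS)
  have hm : Env.incl op ≫ m = (symClosure.{w} v).arrow := Env.incl_lift _ _ _
  have h1 : (i ≫ Env.incl op) ≫ m = v := by rw [Category.assoc, hm, hi]
  have : Epi m := by
    refine epi_of_epi_fac (f := tensorAlg.lift.{w} (i ≫ Env.incl op))
      (h := tensorAlg.lift.{w} v) (tensorAlg.monHom_ext ?_)
    rw [← Category.assoc, tensorAlg.gen_lift, tensorAlg.gen_lift, h1]
  have hV := hA.of_mono v
  -- The map to `symQuot` of the enveloping algebra factors through `symImage v`.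
  obtain ⟨κ, hκ⟩ : ∃ κ, symImage.p.{w} v ≫ κ =
      (i ≫ Env.incl op) ≫ symQuot.π.{w} (i ≫ Env.incl op) := by
    have h : kernel.ι (symImage.p.{w} v) ≫
        (i ≫ Env.incl op) ≫ symQuot.π.{w} (i ≫ Env.incl op) = 0 := by
      obtain ⟨P, c, hc, g, hg⟩ := exists_of_comp_symQuot v (kernel.ι (symImage.p.{w} v) ≫ v) (by
        rw [Category.assoc, ← symImage.p_κ, kernel.condition_assoc, zero_comp])
      have h2 : c ≫ kernel.ι (symImage.p.{w} v) ≫ i = g ≫ R := by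
        rw [← cancel_mono (symClosure.{w} v).arrow]
        simp only [Category.assoc]
        rw [hi, hg, hR']
      rw [← cancel_epi c, comp_zero]
      simp only [Category.assoc]
      rw [← Category.assoc (kernel.ι _) i, ← Category.assoc c, h2, Category.assoc,
        ← Category.assoc R, hR _ (Env.incl_isWorHom op), quot.rel_π, comp_zero]
    exact ⟨Abelian.epiDesc _ _ h, Abelian.comp_epiDesc _ _ h⟩
  -- An element `y` of the kernel is a sum of products of elements of `V`. It dies in `symQuot`, so
  -- it is the value of relations, hence an element of the closure, on which `m` is a monomorphism.
  have : Mono m := by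
    refine Preadditive.mono_of_cancel_zero _ fun {P} y hy => ?_
    obtain ⟨P₁, c, hc, x, hx⟩ :=
      surjective_up_to_refinements_of_epi (tensorAlg.lift.{w} (i ≫ Env.incl op)) y
    rw [← cancel_epi c, comp_zero]
    refine tensorAlg.eq_zero_of_finite x _ fun P₂ t p z hz => ?_
    have h2 : t ≫ c ≫ y = ∑ n ∈ Finset.range p, z n ≫ powHom (i ≫ Env.incl op) n := by
      rw [hx, ← Category.assoc, hz, Preadditive.sum_comp]
      refine Finset.sum_congr rfl fun n _ => ?_
      rw [Category.assoc, tensorAlg.inc_lift]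
      rfl
    have h3 : ∑ n ∈ Finset.range p, z n ≫ powHom v n = 0 := by
      have h := congrArg (· ≫ m) h2
      simp only [Category.assoc, hy, comp_zero, Preadditive.sum_comp, powHom_comp] at h
      rw [← Category.assoc, h1] at h
      exact h.symm
    have h4 : (t ≫ c ≫ y) ≫ symQuot.π.{w} (i ≫ Env.incl op) = 0 := by
      rw [h2, Preadditive.sum_comp]
      refine Finset.sum_eq_zero fun n hn => ?_
      rw [Category.assoc, powHom_comp, ← hκ, ← tpowMap_powHom, ← Category.assoc]
      exact comp_powHom_of_sym k hV (symImage.p v) _ κ hκ n _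
        (comp_sym_of_sum_eq_zero_of_gen k hA hv he p z h3 n (Finset.mem_range.1 hn))
    obtain ⟨P₃, c', hc', g, hg⟩ := exists_of_comp_symQuot _ _ h4
    have h5 := hR _ (Env.incl_isWorHom op)
    rw [← h5] at hg
    have h6 : g ≫ R = 0 := by
      rw [← cancel_mono (symClosure.{w} v).arrow, zero_comp, ← hm]
      have h := congrArg (· ≫ m) hg
      simp only [Category.assoc, hy, comp_zero] at h
      simpa using h.symm
    rw [← Category.assoc g, h6, zero_comp] at hg
    rwa [← cancel_epi c', comp_zero]
  exact isIso_of_mono_of_epi m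

end EnvelopingClosure

/-! ### Subalgebras and generation -/

section Bimon

variable {C : Type u} [Category.{v} C] [MonoidalCategory C] [BraidedCategory C]

theorem isMonHom_comul (A : C) [BimonObj A] : IsMonHom Δ[A] where
  one_hom := BimonObj.one_comul A
  mul_hom := (BimonObj.mul_comul A).trans (by
    rw [MonObj.tensorObj.mul_def])

theorem isMonHom_counit (A : C) [BimonObj A] : IsMonHom ε[A] where
  one_hom := BimonObj.one_counit A
  mul_hom := BimonObj.mul_counit A

end Bimon

section Subalgebra

variable {C : Type u} [Category.{v} C] [Abelian C] [MonoidalCategory C] [BraidedCategory C]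

theorem factors_powHom {A V : C} [MonObj A] (S : Subobject A) (h1 : S.Factors η[A])
    (h2 : S.Factors ((S.arrow ⊗ₘ S.arrow) ≫ μ[A])) {v : V ⟶ A} (hv : S.Factors v) :
    ∀ n, S.Factors (powHom v n)
  | 0 => by rwa [powHom_zero]
  | n + 1 => by
    have ih := factors_powHom S h1 h2 hv n
    have h : powHom v (n + 1) = (S.factorThru _ ih ⊗ₘ S.factorThru _ hv) ≫
        (S.arrow ⊗ₘ S.arrow) ≫ μ := by
      rw [tensorHom_comp_tensorHom_assoc, S.factorThru_arrow, S.factorThru_arrow]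
      change (tpowMap v n ⊗ₘ v) ≫ mulN A n ▷ A ≫ μ = _
      rw [← tensorHom_id, tensorHom_comp_tensorHom_assoc, Category.comp_id]
      rfl
    rw [h]
    exact Subobject.factors_of_factors_right _ h2

variable [HasColimitsOfSize.{w, w} C] [∀ X : C, PreservesColimitsOfSize.{w, w} (tensorLeft X)]

/-- A subalgebra that contains a generating subobject is everything. -/
theorem eq_top_of_factors {A V : C} [MonObj A] (v : V ⟶ A) [Epi (tensorAlg.lift.{w} v)]
    (S : Subobject A) (h1 : S.Factors η[A]) (h2 : S.Factors ((S.arrow ⊗ₘ S.arrow) ≫ μ[A]))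
    (hv : S.Factors v) : S = ⊤ := by
  have h := factors_powHom S h1 h2 hv
  have : Epi S.arrow := by
    refine epi_of_epi_fac (f := tensorAlg.desc fun n => S.factorThru _ (h n))
      (h := tensorAlg.lift.{w} v) (tensorAlg.hom_ext fun n => ?_)
    rw [← Category.assoc, tensorAlg.inc_desc, S.factorThru_arrow, tensorAlg.inc_lift]
    rfl
  exact (Subobject.isIso_arrow_iff_eq_top S).1 (isIso_of_mono_of_epi _)

variable [∀ X : C, PreservesFiniteColimits (tensorLeft X)]

theorem factors_image_one {A V : C} [MonObj A] (v : V ⟶ A) :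
    (imageSubobject (tensorAlg.lift.{w} v)).Factors η[A] := by
  rw [← IsMonHom.one_hom (f := tensorAlg.lift.{w} v)]
  exact imageSubobject_factors_comp_self (f := tensorAlg.lift.{w} v) _

theorem factors_image_mul {A V : C} [MonObj A] (v : V ⟶ A) :
    (imageSubobject (tensorAlg.lift.{w} v)).Factors
      (((imageSubobject (tensorAlg.lift.{w} v)).arrow ⊗ₘ
        (imageSubobject (tensorAlg.lift.{w} v)).arrow) ≫ μ[A]) := by
  refine factors_of_epi _ (factorThruImageSubobject (tensorAlg.lift.{w} v) ⊗ₘ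
    factorThruImageSubobject (tensorAlg.lift.{w} v)) _ ?_
  rw [tensorHom_comp_tensorHom_assoc, imageSubobject_arrow_comp, ← IsMonHom.mul_hom]
  exact imageSubobject_factors_comp_self (f := tensorAlg.lift.{w} v) _

theorem factors_image {A V : C} [MonObj A] (v : V ⟶ A) :
    (imageSubobject (tensorAlg.lift.{w} v)).Factors v := by
  conv => arg 2; rw [← tensorAlg.gen_lift.{w} v]
  exact imageSubobject_factors_comp_self (f := tensorAlg.lift.{w} v) _

theorem epi_lift_of_image_eq_top {A V : C} [MonObj A] (v : V ⟶ A)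
    (h : imageSubobject (tensorAlg.lift.{w} v) = ⊤) : Epi (tensorAlg.lift.{w} v) := by
  have : IsIso (imageSubobject (tensorAlg.lift.{w} v)).arrow :=
    (Subobject.isIso_arrow_iff_eq_top _).2 h
  rw [← imageSubobject_arrow_comp (tensorAlg.lift.{w} v)]
  infer_instance

variable [MonoidalPreadditive C]

theorem primDefect_eq_zero_iff {P L U : C} [MonObj U] (i : L ⟶ U) (δ : L ⟶ U ⊗ U) (y : P ⟶ L) :
    y ≫ primDefect i δ = 0 ↔ y ≫ δ = (y ≫ i) ≫ inl U U + (y ≫ i) ≫ inr U U := by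
  rw [primDefect, Preadditive.comp_sub, Preadditive.comp_sub, sub_sub, sub_eq_zero, inl, inr,
    Category.assoc, Category.assoc]

theorem primitives_factors_iff {P A : C} [BimonObj A] (z : P ⟶ A) :
    (primitives A).Factors z ↔ z ≫ Δ[A] = z ≫ inl A A + z ≫ inr A A := by
  rw [primitives, kernelSubobject_factors_iff, primDefect_eq_zero_iff, Category.comp_id]

theorem primitives_arrow (A : C) [BimonObj A] : (primitives A).arrow ≫ Δ[A] =
    (primitives A).arrow ≫ inl A A + (primitives A).arrow ≫ inr A A :=
  (primitives_factors_iff _).1 (primitives A).factors_self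

/-- The counit vanishes on primitives. -/
theorem comp_counit_eq_zero {P A : C} [MonObj A] {d : A ⟶ A ⊗ A} {e : A ⟶ 𝟙_ C} [IsMonHom e]
    (hd : d ≫ e ▷ A = (λ_ A).inv) (z : P ⟶ A) (hz : z ≫ d = z ≫ inl A A + z ≫ inr A A) :
    z ≫ e = 0 := by
  have h := congrArg (· ≫ (e ⊗ₘ e)) hz
  have h1 : d ≫ (e ⊗ₘ e) = e ≫ inr (𝟙_ C) (𝟙_ C) := by
    rw [MonoidalCategory.tensorHom_def, reassoc_of% hd, ← leftUnitor_inv_naturality, inr]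
    congr 1
    exact (Category.comp_id _).symm.trans (congrArg _ (id_whiskerRight _ _).symm)
  simp only [Preadditive.add_comp, Category.assoc, h1, inl_naturality, inr_naturality] at h
  rw [right_eq_add, ← Category.assoc] at h
  have : Mono (inl (𝟙_ C) (𝟙_ C)) := by
    have h2 : inl (𝟙_ C) (𝟙_ C) = (ρ_ (𝟙_ C)).inv :=
      (congrArg _ (whiskerLeft_id _ _)).trans (Category.comp_id _)
    rw [h2]
    infer_instance
  rwa [← zero_comp (f := inl (𝟙_ C) (𝟙_ C)), cancel_mono] at h

/-- The image of the tensor algebra of the primitives is a subalgebra, hence everything. -/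
theorem PrimitivelyGenerated.epi_lift {A : C} [BimonObj A] (h : PrimitivelyGenerated A) :
    Epi (tensorAlg.lift.{w} (primitives A).arrow) := by
  refine epi_lift_of_image_eq_top _ (h _ (factors_image_one _) (factors_image_mul _) ?_)
  exact Subobject.le_of_comm _ (Subobject.factorThru_arrow _ _ (factors_image _))

theorem PrimitivelyGenerated.of_epi_lift {A V : C} [BimonObj A] (v : V ⟶ A)
    [Epi (tensorAlg.lift.{w} v)] (hv : v ≫ Δ[A] = v ≫ inl A A + v ≫ inr A A) :
    PrimitivelyGenerated A := fun S h1 h2 h3 =>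
  eq_top_of_factors v S h1 h2 (Subobject.factors_of_le _ h3 ((primitives_factors_iff v).2 hv))

end Subalgebra

/-! ### The Woronowicz algebra of a primitively generated Hopf algebra -/

section IsPW

variable (k : Type w) [Field k] [CharZero k] {C : Type u} [Category.{v} C] [Abelian C]
  [Linear k C] [MonoidalCategory C] [MonoidalPreadditive C] [BraidedCategory C]
  [HasColimitsOfSize.{w, w} C] [AB5OfSize.{w, w} C]
  [∀ X : C, PreservesColimitsOfSize.{w, w} (tensorLeft X)]
  [∀ X : C, PreservesFiniteColimits (tensorLeft X)]
  [∀ X : C, PreservesFiniteLimits (tensorLeft X)]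

/-- The closure of the primitives is the Woronowicz algebra. -/
theorem isPW_symClosure {A : C} [BimonObj A] (hA : FinitelyBraided A)
    (h : PrimitivelyGenerated A) : IsPW k A (symClosure.{w} (primitives A).arrow) := by
  have := h.epi_lift
  refine ⟨⟨isClosedUnder_symClosure k hA _, ?_⟩, fun S hS => symClosure_le hA _ hS.1 ?_⟩
  · exact Subobject.le_of_comm _ (Subobject.factorThru_arrow _ _ (symClosure_factors _))
  · exact Subobject.factors_of_le _ hS.2 (primitives A).factors_self

variable {k}

/-- A primitively generated, finitely braided bialgebra is the enveloping algebra of its Woronowicz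
algebra. -/
theorem IsPW.isIso_envMul {A : C} [BimonObj A] (hA : FinitelyBraided A)
    (h : PrimitivelyGenerated A) {S : Subobject A} (hS : IsPW k A S) :
    IsIso (envMul k A hA S hS.1.1) := by
  obtain rfl := hS.unique (isPW_symClosure k hA h)
  have := h.epi_lift
  have := isMonHom_comul A
  have := isMonHom_counit A
  exact isIso_lift_arrow hA hS.1.1 (primitives_arrow A)
    (comp_counit_eq_zero (e := ε[A]) (ComonObj.counit_comul A) _ (primitives_arrow A))

end IsPW

/-! ### The antipode -/

section Antipode

variable {C : Type u} [Category.{v} C] [Abelian C] [MonoidalCategory C] [MonoidalPreadditive C]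
  [BraidedCategory C]

theorem whiskerLeft_sub (X : C) {Y Z : C} (f g : Y ⟶ Z) : X ◁ (f - g) = X ◁ f - X ◁ g :=
  (tensorLeft X).map_sub

theorem sub_whiskerRight {X Y : C} (f g : X ⟶ Y) (Z : C) : (f - g) ▷ Z = f ▷ Z - g ▷ Z :=
  (tensorRight Z).map_sub

/-- The convolution powers of an endomorphism. -/
def convPow {A : C} [BimonObj A] (h : A ⟶ A) : ℕ → (A ⟶ A)
  | 0 => ε ≫ η
  | i + 1 => Δ ≫ convPow h i ▷ A ≫ A ◁ h ≫ μ

variable {V A : C} [BimonObj A] {v : V ⟶ A}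
  (hv : v ≫ Δ[A] = v ≫ inl A A + v ≫ inr A A)

include hv in
/-- Convolution powers of endomorphisms that kill the unit vanish on short products of
primitives. -/
theorem powHom_convPow {h : A ⟶ A} (hh : η ≫ h = 0) : ∀ {i n : ℕ}, n < i →
    powHom v n ≫ convPow h i = 0
  | i + 1, n, hn => by
    have := isMonHom_comul A
    have hq : ∀ n < i, powHom v n ≫ convPow h i = 0 := fun n hn => powHom_convPow hh hn
    rw [convPow]
    rcases Nat.lt_succ_iff_lt_or_eq.1 hn with hn | rfl
    · have h1 := powHom_comul_of_lt hv hq hn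
      rw [← Category.assoc, ← Category.assoc, Category.assoc (powHom v n), h1, zero_comp]
    · have h1 := powHom_comul_self hv hq
      have h2 : inl A A ≫ A ◁ h = 0 := by
        rw [inl, Category.assoc, ← whiskerLeft_comp, hh, MonoidalPreadditive.whiskerLeft_zero,
          comp_zero]
      rw [← Category.assoc, ← Category.assoc, Category.assoc (powHom v n), h1, Category.assoc,
        Category.assoc, ← Category.assoc (inl A A), h2, zero_comp, comp_zero, comp_zero]

variable [HasColimitsOfSize.{w, w} C] [AB5OfSize.{w, w} C]
  [∀ X : C, PreservesColimitsOfSize.{w, w} (tensorLeft X)] [Epi (tensorAlg.lift.{w} v)]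

omit hv [AB5OfSize.{w, w} C] in
theorem hom_ext_of_powHom {Z : C} {f g : A ⟶ Z}
    (h : ∀ n, powHom v n ≫ f = powHom v n ≫ g) : f = g := by
  rw [← cancel_epi (tensorAlg.lift.{w} v)]
  refine tensorAlg.hom_ext fun n => ?_
  rw [← Category.assoc, ← Category.assoc, tensorAlg.inc_lift]
  exact h n

omit hv in
/-- A sequence of morphisms which on each product of elements of `V` is eventually zero has a
sum. -/
theorem exists_sum (P : ℕ → (A ⟶ A)) (hP : ∀ n i, n < i → powHom v n ≫ P i = 0) :
    ∃ f : A ⟶ A, ∀ n, powHom v n ≫ f = ∑ i ∈ Finset.range (n + 1), powHom v n ≫ P i := by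
  let F : tensorAlg.{w} V ⟶ A :=
    tensorAlg.desc fun n => ∑ i ∈ Finset.range (n + 1), powHom v n ≫ P i
  have hF : kernel.ι (tensorAlg.lift.{w} v) ≫ F = 0 := by
    refine tensorAlg.eq_zero_of_finite (kernel.ι (tensorAlg.lift.{w} v)) _ fun P' t p y hy => ?_
    have h1 : t ≫ kernel.ι (tensorAlg.lift.{w} v) ≫ F =
        ∑ n ∈ Finset.range p, y n ≫ powHom v n ≫ (∑ i ∈ Finset.range p, P i : A ⟶ A) := by
      rw [← Category.assoc, hy, Preadditive.sum_comp]
      refine Finset.sum_congr rfl fun n hn => ?_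
      rw [Category.assoc, tensorAlg.inc_desc]
      refine (congrArg (y n ≫ ·) (Finset.sum_subset (Finset.range_mono (Finset.mem_range.1 hn))
        fun i _ hi => hP n i (by simpa using hi))).trans ?_
      exact congrArg (y n ≫ ·) (Preadditive.comp_sum _ _ _).symm
    have h2 : ∑ n ∈ Finset.range p, y n ≫ powHom v n = 0 := by
      have h := congrArg (· ≫ tensorAlg.lift.{w} v) hy
      simp only [Category.assoc, kernel.condition, comp_zero, Preadditive.sum_comp,
        tensorAlg.inc_lift] at h
      exact h.symm
    rw [h1]
    simp only [← Category.assoc]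
    rw [← Preadditive.sum_comp, h2, zero_comp]
  refine ⟨Abelian.epiDesc (tensorAlg.lift.{w} v) F hF, fun n => ?_⟩
  rw [← tensorAlg.inc_desc.{w} (fun n => ∑ i ∈ Finset.range (n + 1), powHom v n ≫ P i) n]
  have h1 := congrArg (tensorAlg.inc V n ≫ ·) (Abelian.comp_epiDesc (tensorAlg.lift.{w} v) F hF)
  simp only [← Category.assoc, tensorAlg.inc_lift] at h1
  exact h1

include hv

/-- In a bialgebra generated by primitives, an endomorphism that preserves the unit has a left
inverse for the convolution product, given by the geometric series. -/
theorem exists_conv_left_inv (g : A ⟶ A) (hg : η ≫ g = η) :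
    ∃ f : A ⟶ A, η ≫ f = η ∧ Δ ≫ f ▷ A ≫ A ◁ g ≫ μ = ε ≫ η := by
  have := isMonHom_comul A
  have hu : η[A] ≫ ε[A] ≫ η[A] = η := by
    rw [← Category.assoc, BimonObj.one_counit, Category.id_comp]
  let P := convPow (ε ≫ η - g)
  have hP : ∀ n i, n < i → powHom v n ≫ P i = 0 := fun n i h =>
    powHom_convPow hv (by rw [Preadditive.comp_sub, hg, hu, sub_self]) h
  obtain ⟨f, hf⟩ := exists_sum.{w} P hP
  refine ⟨f, ?_, ?_⟩
  · rw [← powHom_zero v, hf 0, Finset.sum_range_one, powHom_zero]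
    exact hu
  · refine hom_ext_of_powHom.{w} (v := v) fun n => ?_
    -- On products of at most `n` elements, the series agrees with its partial sum `Q`.
    set Q := ∑ i ∈ Finset.range (n + 1), P i with hQ
    have h1 : ∀ m < n + 1, powHom v m ≫ (f - Q) = 0 := fun m hm => by
      rw [Preadditive.comp_sub, hf, hQ, Preadditive.comp_sum, sub_eq_zero]
      refine Finset.sum_subset (Finset.range_mono (by omega)) fun i _ hi => ?_
      exact hP m i (by simpa using hi)
    have h2 := powHom_comul_of_lt hv h1 (Nat.lt_succ_self n)
    rw [sub_whiskerRight, Preadditive.comp_sub, Preadditive.comp_sub,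
      sub_eq_zero] at h2
    -- Convolution with `g = ε η - (ε η - g)` telescopes on the geometric series.
    have h3 : ∀ i, Δ ≫ P i ▷ A ≫ A ◁ g ≫ μ = P i - P (i + 1) := fun i => by
      have h4 : g = ε ≫ η - (ε ≫ η - g) := by abel
      have h5 : Δ ≫ P i ▷ A ≫ A ◁ (ε ≫ η) ≫ μ = P i := mul_one (M := Conv A A) (P i)
      conv_lhs => rw [h4]
      rw [whiskerLeft_sub, Preadditive.sub_comp, Preadditive.comp_sub,
        Preadditive.comp_sub, h5]
      rfl
    have h6 : Δ ≫ Q ▷ A ≫ A ◁ g ≫ μ = P 0 - P (n + 1) := by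
      rw [hQ, sum_whiskerRight, Preadditive.sum_comp, Preadditive.comp_sum,
        Finset.sum_congr rfl fun i _ => h3 i, Finset.sum_range_sub']
    rw [← Category.assoc, ← Category.assoc, Category.assoc (powHom v n), h2, Category.assoc,
      Category.assoc, h6, Preadditive.comp_sub, hP n (n + 1) (Nat.lt_succ_self n), sub_zero]
    rfl

/-- A bialgebra generated by primitives has an antipode. -/
theorem exists_antipode : ∃ f : A ⟶ A, Δ ≫ f ▷ A ≫ μ = ε ≫ η ∧ Δ ≫ A ◁ f ≫ μ = ε ≫ η := by
  obtain ⟨f, hf, h1⟩ := exists_conv_left_inv.{w} hv (𝟙 A) (Category.comp_id _)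
  -- The left inverse `f` of the identity has a left inverse as well, so it is a two-sided inverse.
  obtain ⟨f', -, h2⟩ := exists_conv_left_inv.{w} hv f hf
  have e : 𝟙 A = f' := (left_inv_eq_right_inv (M := Conv A A) (a := f) h2 h1).symm
  refine ⟨f, ?_, ?_⟩
  · rw [whiskerLeft_id, Category.id_comp] at h1
    exact h1
  · rw [← e, id_whiskerRight, Category.id_comp] at h2
    exact h2

/-- A bialgebra generated by primitives is a Hopf algebra. -/
noncomputable abbrev hopfObjOfEpi : HopfObj A where
  antipode := (exists_antipode.{w} hv).choose
  antipode_left := (exists_antipode.{w} hv).choose_spec.1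
  antipode_right := (exists_antipode.{w} hv).choose_spec.2

end Antipode

/-! ### Closed subobjects -/

section Closed

variable {k : Type w} [Field k] {C : Type u} [Category.{v} C] [Abelian C] [Linear k C]
  [MonoidalCategory C] [BraidedCategory C]

/-- A morphism compatible with the multiplication of `B` is a morphism of `𝔚_*`-algebras for the
operations on the underlying object of `B`. -/
theorem IsWorHom.map_op {L B : C} [MonObj B] {op : Ops k L} {f : L ⟶ B} (hf : IsWorHom op f)
    (hL : FinitelyBraided L) (hB : FinitelyBraided B) (n : ℕ) (x : WorStar k n) :
    op n x ≫ f = tpowMap f n ≫ worOps k B n x := by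
  rw [hf, ← Category.assoc, hatAct_naturality hL hB, Category.assoc]
  rfl

theorem restrictOps_arrow {X : C} {op : Ops k X} {S : Subobject X} (h : IsClosedUnder op S)
    (n : ℕ) (x : WorStar k n) : restrictOps op S h n x ≫ S.arrow = tpowMap S.arrow n ≫ op n x :=
  S.factorThru_arrow _ (h n x)

/-- The image of a monomorphism of `𝔚_*`-algebras is closed. -/
theorem isClosedUnder_mk {X Y : C} {op : Ops k X} {op' : Ops k Y} (f : X ⟶ Y) [Mono f]
    (hf : ∀ n (x : WorStar k n), op n x ≫ f = tpowMap f n ≫ op' n x) :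
    IsClosedUnder op' (Subobject.mk f) := fun n x => by
  rw [← Subobject.underlyingIso_hom_comp_eq_mk, tpowMap_comp, Category.assoc, ← hf,
    ← Category.assoc]
  refine Subobject.factors_of_factors_right _ ?_
  rw [Subobject.mk_factors_iff]
  exact ⟨𝟙 X, Category.id_comp f⟩

theorem IsClosedUnder.pullback {X Y : C} {op : Ops k X} {op' : Ops k Y} {f : X ⟶ Y}
    (hf : ∀ n (x : WorStar k n), op n x ≫ f = tpowMap f n ≫ op' n x) {S : Subobject Y}
    (hS : IsClosedUnder op' S) : IsClosedUnder op ((Subobject.pullback f).obj S) := fun n x => by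
  rw [pullback_factors_iff, Category.assoc, hf, ← Category.assoc, ← tpowMap_comp]
  have h : S.Factors (((Subobject.pullback f).obj S).arrow ≫ f) :=
    (pullback_factors_iff _ _ _).1 (Subobject.factors_self _)
  rw [← S.factorThru_arrow _ h, tpowMap_comp, Category.assoc]
  exact Subobject.factors_of_factors_right _ (hS n x)

/-- A subalgebra of a finitely braided monoid is closed under the operations. -/
theorem isClosedUnder_of_subalgebra [∀ X : C, PreservesFiniteLimits (tensorLeft X)] {A : C}
    [MonObj A] (hA : FinitelyBraided A) (S : Subobject A) (h1 : S.Factors η[A])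
    (h2 : S.Factors ((S.arrow ⊗ₘ S.arrow) ≫ μ[A])) : IsClosedUnder (worOps k A) S :=
  fun n x => by
    have h : tpowMap S.arrow n ≫ worOps k A n x = hatAct k (S : C) n x.1 ≫ powHom S.arrow n := by
      change tpowMap S.arrow n ≫ hatAct k A n x.1 ≫ mulN A n = _
      rw [← Category.assoc, ← hatAct_naturality (hA.of_mono S.arrow) hA, Category.assoc]
      rfl
    rw [h]
    exact Subobject.factors_of_factors_right _ (factors_powHom S h1 h2 S.factors_self n)

variable [MonoidalPreadditive C]

theorem IsPW.closed {A : C} [BimonObj A] {S : Subobject A} (hS : IsPW k A S) :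
    IsClosedUnder (worOps k A) S := hS.1.1

theorem IsPW.le {A : C} [BimonObj A] {S : Subobject A} (hS : IsPW k A S) : primitives A ≤ S :=
  hS.1.2

theorem IsPW.le_of_closed {A : C} [BimonObj A] {S : Subobject A} (hS : IsPW k A S)
    {T : Subobject A} (hT : IsClosedUnder (worOps k A) T) (h : primitives A ≤ T) : S ≤ T :=
  hS.2 ⟨hT, h⟩

/-- A closed subobject of the Woronowicz algebra that contains all primitives is everything. -/
theorem IsPW.eq_top {A : C} [BimonObj A] {S : Subobject A} (hS : IsPW k A S)
    {T : Subobject (S : C)} (hT : IsClosedUnder (restrictOps (worOps k A) S hS.closed) T)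
    {i : (primitives A : C) ⟶ (S : C)} (hi : i ≫ S.arrow = (primitives A).arrow)
    (h : T.Factors i) : T = ⊤ := by
  have h1 : S ≤ Subobject.mk (T.arrow ≫ S.arrow) := by
    refine hS.le_of_closed (isClosedUnder_mk (op := restrictOps _ T hT) _ fun n x => ?_) ?_
    · rw [← Category.assoc, restrictOps_arrow, Category.assoc, restrictOps_arrow, tpowMap_comp,
        Category.assoc]
    · refine Subobject.le_mk_of_comm (T.factorThru _ h) ?_
      rw [← Category.assoc, T.factorThru_arrow, hi]
  have h2 : Subobject.ofLEMk S (T.arrow ≫ S.arrow) h1 ≫ T.arrow = 𝟙 _ := by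
    rw [← cancel_mono S.arrow, Category.assoc, Subobject.ofLEMk_comp, Category.id_comp]
  have : Epi (Subobject.ofLEMk S (T.arrow ≫ S.arrow) h1 ≫ T.arrow) := by
    rw [h2]
    infer_instance
  have : Epi T.arrow := epi_of_epi (Subobject.ofLEMk S (T.arrow ≫ S.arrow) h1) _
  exact (Subobject.isIso_arrow_iff_eq_top T).1 (isIso_of_mono_of_epi _)

variable [HasColimitsOfSize.{w, w} C] [∀ X : C, PreservesColimitsOfSize.{w, w} (tensorLeft X)]
  [∀ X : C, PreservesFiniteColimits (tensorLeft X)]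

/-- The kernel of a morphism to the unit object is closed. -/
theorem isClosedUnder_kernel [∀ X : C, PreservesFiniteLimits (tensorLeft X)] {L : C}
    (hL : FinitelyBraided L) {op : Ops k L} {f : L ⟶ 𝟙_ C} (hf : IsWorHom op f) :
    IsClosedUnder op (kernelSubobject f) := fun n x => by
  rw [kernelSubobject_factors_iff, Category.assoc, hf, ← Category.assoc,
    ← hatAct_naturality (hL.of_mono (kernelSubobject f).arrow) hL, Category.assoc,
    ← Category.assoc (tpowMap _ n), ← tpowMap_comp, kernelSubobject_arrow_comp]
  have h := isWorHom_zero (0 : Ops k (kernelSubobject f : C)) n x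
  rw [← h, comp_zero]

end Closed

/-! ### The Hopf `𝔚_*`-algebra of a primitively generated Hopf algebra -/

section OfHopf

/-- Transport of coassociativity along an isomorphism. -/
theorem coassoc_of_iso {C : Type u} [Category.{v} C] [MonoidalCategory C] {U A : C} (m : U ≅ A)
    {d : A ⟶ A ⊗ A} {d' : U ⟶ U ⊗ U} (h : d' ≫ (m.hom ⊗ₘ m.hom) = m.hom ≫ d)
    (hd : d ≫ d ▷ A ≫ (α_ A A A).hom = d ≫ A ◁ d) :
    d' ≫ d' ▷ U ≫ (α_ U U U).hom = d' ≫ U ◁ d' := by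
  rw [← cancel_mono (m.hom ⊗ₘ (m.hom ⊗ₘ m.hom))]
  have h1 : d' ▷ U ≫ ((m.hom ⊗ₘ m.hom) ⊗ₘ m.hom) = (m.hom ⊗ₘ m.hom) ≫ d ▷ A := by
    rw [← tensorHom_id, ← tensorHom_id, tensorHom_comp_tensorHom, tensorHom_comp_tensorHom, h,
      Category.id_comp, Category.comp_id]
  have h2 : U ◁ d' ≫ (m.hom ⊗ₘ (m.hom ⊗ₘ m.hom)) = (m.hom ⊗ₘ m.hom) ≫ A ◁ d := by
    rw [← id_tensorHom, ← id_tensorHom, tensorHom_comp_tensorHom, tensorHom_comp_tensorHom, h,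
      Category.id_comp, Category.comp_id]
  rw [Category.assoc, Category.assoc, Category.assoc, ← associator_naturality, h2, reassoc_of% h1,
    reassoc_of% h, reassoc_of% h, hd]

variable (k : Type w) [Field k] [CharZero k] {C : Type u} [Category.{v} C] [Abelian C]
  [Linear k C] [MonoidalCategory C] [MonoidalPreadditive C] [MonoidalLinear k C]
  [BraidedCategory C] [HasColimitsOfSize.{w, w} C] [AB5OfSize.{w, w} C]
  [∀ X : C, PreservesColimitsOfSize.{w, w} (tensorLeft X)]
  [∀ X : C, PreservesFiniteColimits (tensorLeft X)]
  [∀ X : C, PreservesFiniteLimits (tensorLeft X)]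

namespace PGHopf

/-- The Woronowicz algebra of a primitively generated Hopf algebra, as a subobject. -/
noncomputable def pw (A : PGHopf C) : Subobject A.X := symClosure.{w} (primitives A.X).arrow

/-- The inclusion of the primitives. -/
noncomputable def pwPrim (A : PGHopf C) : (primitives A.X : C) ⟶ (pw.{w} A : C) :=
  (pw.{w} A).factorThru _ (symClosure_factors _)

theorem pwPrim_arrow (A : PGHopf C) : pwPrim.{w} A ≫ (pw.{w} A).arrow = (primitives A.X).arrow :=
  (pw.{w} A).factorThru_arrow _ _

theorem isPW_pw (A : PGHopf C) : IsPW k A.X (pw.{w} A) :=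
  isPW_symClosure k A.finitelyBraided A.primitivelyGenerated

/-- The operations on the Woronowicz algebra. -/
noncomputable def pwOps (A : PGHopf C) : Ops k (pw.{w} A : C) :=
  restrictOps (worOps k A.X) (pw.{w} A) (isPW_pw k A).closed

theorem arrow_isWorHom (A : PGHopf C) : IsWorHom (pwOps k A) (pw.{w} A).arrow :=
  isWorHom_arrow A.finitelyBraided _ (isPW_pw k A).closed

/-- The morphism of monoids from the enveloping algebra of the Woronowicz algebra. -/
noncomputable def envHom (A : PGHopf C) : Env (pwOps k A) ⟶ A.X :=
  Env.lift _ _ (arrow_isWorHom k A)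

instance (A : PGHopf C) : IsMonHom (envHom k A) :=
  Env.lift_isMonHom _ _ (arrow_isWorHom k A)

instance (A : PGHopf C) : IsIso (envHom k A) :=
  (isPW_pw k A).isIso_envMul A.finitelyBraided A.primitivelyGenerated

/-- The isomorphism of monoids from the enveloping algebra of the Woronowicz algebra. -/
noncomputable def envIso (A : PGHopf C) : Env (pwOps k A) ≅ A.X := asIso (envHom k A)

instance (A : PGHopf C) : IsMonHom (envIso k A).hom := inferInstanceAs (IsMonHom (envHom k A))

theorem incl_envIso (A : PGHopf C) :
    Env.incl (pwOps k A) ≫ (envIso k A).hom = (pw.{w} A).arrow :=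
  Env.incl_lift _ _ (arrow_isWorHom k A)

theorem arrow_envIso_inv (A : PGHopf C) :
    (pw.{w} A).arrow ≫ (envIso k A).inv = Env.incl (pwOps k A) := by
  rw [← incl_envIso k, Category.assoc, Iso.hom_inv_id, Category.comp_id]

/-- The comultiplication of `A`, transported to the enveloping algebra. -/
noncomputable def envComul (A : PGHopf C) : Env (pwOps k A) ⟶ Env (pwOps k A) ⊗ Env (pwOps k A) :=
  (envIso k A).hom ≫ Δ[A.X] ≫ ((envIso k A).inv ⊗ₘ (envIso k A).inv)

instance (A : PGHopf C) : IsMonHom (envComul k A) := by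
  have := isMonHom_comul A.X
  rw [envComul]
  infer_instance

theorem envComul_envIso (A : PGHopf C) :
    envComul k A ≫ ((envIso k A).hom ⊗ₘ (envIso k A).hom) = (envIso k A).hom ≫ Δ[A.X] := by
  rw [envComul, Category.assoc, Category.assoc, tensorHom_comp_tensorHom, Iso.inv_hom_id,
    id_tensorHom_id, Category.comp_id]

/-- The diagonal of the Woronowicz algebra. -/
noncomputable def pwδ (A : PGHopf C) : (pw.{w} A : C) ⟶ Env (pwOps k A) ⊗ Env (pwOps k A) :=
  Env.incl (pwOps k A) ≫ envComul k A

theorem pwδ_isWorHom (A : PGHopf C) : IsWorHom (pwOps k A) (pwδ k A) :=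
  (Env.incl_isWorHom _).comp _

theorem lift_pwδ (A : PGHopf C) : Env.lift _ _ (pwδ_isWorHom k A) = envComul k A :=
  Env.hom_ext _ (Env.incl_lift _ _ _)

theorem pwδ_envIso (A : PGHopf C) :
    pwδ k A ≫ ((envIso k A).hom ⊗ₘ (envIso k A).hom) = (pw.{w} A).arrow ≫ Δ[A.X] := by
  rw [pwδ, Category.assoc, envComul_envIso, ← Category.assoc, incl_envIso]

theorem pw_finitelyBraided (A : PGHopf C) : FinitelyBraided (pw.{w} A : C) :=
  A.finitelyBraided.of_mono (pw.{w} A).arrow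

theorem env_finitelyBraided (A : PGHopf C) : FinitelyBraided (Env (pwOps k A)) :=
  A.finitelyBraided.of_mono (envIso k A).hom

theorem pw_eq_top (A : PGHopf C) {T : Subobject (pw.{w} A : C)}
    (hT : IsClosedUnder (pwOps k A) T)
    (h : T.Factors (pwPrim A)) : T = ⊤ :=
  (isPW_pw k A).eq_top hT (pwPrim_arrow A) h

include k in
theorem arrow_counit (A : PGHopf C) : (pw.{w} A).arrow ≫ ε[A.X] = 0 := by
  have := isMonHom_counit A.X
  have h := pw_eq_top k A
    (isClosedUnder_kernel (pw_finitelyBraided A) ((arrow_isWorHom k A).comp ε[A.X])) (by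
      rw [kernelSubobject_factors_iff, ← Category.assoc, pwPrim_arrow]
      exact comp_counit_eq_zero (ComonObj.counit_comul A.X) _ (primitives_arrow A.X))
  have := (Subobject.isIso_arrow_iff_eq_top _).2 h
  rw [← cancel_epi (kernelSubobject ((pw.{w} A).arrow ≫ ε[A.X])).arrow,
    kernelSubobject_arrow_comp, comp_zero]

theorem aug_eq (A : PGHopf C) : Env.aug (pwOps k A) = (envIso k A).hom ≫ ε[A.X] := by
  have := isMonHom_counit A.X
  have h : IsMonHom (Env.aug (pwOps k A)) := Env.lift_isMonHom _ _ _
  refine Env.hom_ext _ ?_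
  rw [Env.aug, Env.incl_lift, ← Category.assoc, incl_envIso, arrow_counit k]

theorem pwPrim_pwδ (A : PGHopf C) : pwPrim A ≫ pwδ k A =
    pwPrim A ≫ Env.incl (pwOps k A) ≫ inl _ _ +
      pwPrim A ≫ Env.incl (pwOps k A) ≫ inr _ _ := by
  have h : (primitives A.X).arrow ≫ (envIso k A).inv = pwPrim A ≫ Env.incl (pwOps k A) := by
    rw [← pwPrim_arrow, Category.assoc, arrow_envIso_inv]
  rw [pwδ, envComul, ← Category.assoc (Env.incl _), incl_envIso, ← Category.assoc, pwPrim_arrow,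
    ← Category.assoc, primitives_arrow, Preadditive.add_comp, Category.assoc, Category.assoc,
    inl_naturality, inr_naturality, ← Category.assoc, ← Category.assoc, h, Category.assoc,
    Category.assoc]

/-- The Hopf `𝔚_*`-algebra of a primitively generated, finitely braided Hopf algebra. -/
noncomputable abbrev toWorHopf (A : PGHopf C) : WorHopf k C where
  L := pw.{w} A
  op := pwOps k A
  finitelyBraided := pw_finitelyBraided A
  isWorAlg := (isWorAlg_worOps A.finitelyBraided).of_mono (pw.{w} A).arrow fun n x =>
    restrictOps_arrow _ n x
  env_finitelyBraided := env_finitelyBraided k A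
  faithful := by
    have : Mono (Env.incl (pwOps k A) ≫ (envIso k A).hom) := by
      rw [incl_envIso]
      infer_instance
    exact mono_of_mono _ (envIso k A).hom
  δ := pwδ k A
  δ_isWorHom := pwδ_isWorHom k A
  δ_mem := fun S hS h1 h2 => by
    have h := pw_eq_top k A (hS.pullback ((pwδ_isWorHom k A).map_op (pw_finitelyBraided A)
      (env_finitelyBraided k A).tensor)) (by
        rw [pullback_factors_iff, pwPrim_pwδ]
        exact Subobject.factors_add _ _ (Subobject.factors_of_factors_right _ h1)
          (Subobject.factors_of_factors_right _ h2))
    have h3 : ((Subobject.pullback (pwδ k A)).obj S).Factors (𝟙 _) := by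
      rw [h]
      exact Subobject.top_factors _
    rwa [pullback_factors_iff, Category.id_comp] at h3
  coassoc := by
    have h := coassoc_of_iso (envIso k A) (envComul_envIso k A) (ComonObj.comul_assoc A.X).symm
    rw [lift_pwδ, pwδ, Category.assoc, Category.assoc, h]
  counit_left := by
    rw [aug_eq, ← cancel_mono (𝟙_ C ◁ (envIso k A).hom), Category.assoc, comp_whiskerRight,
      Category.assoc, ← whisker_exchange, ← MonoidalCategory.tensorHom_def_assoc, ← Category.assoc,
      pwδ_envIso, Category.assoc, ComonObj.counit_comul, Category.assoc,
      ← leftUnitor_inv_naturality, ← Category.assoc, incl_envIso]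
  counit_right := by
    rw [aug_eq, ← cancel_mono ((envIso k A).hom ▷ 𝟙_ C), Category.assoc, whiskerLeft_comp,
      Category.assoc, whisker_exchange, ← MonoidalCategory.tensorHom_def'_assoc, ← Category.assoc,
      pwδ_envIso, Category.assoc, ComonObj.comul_counit, Category.assoc,
      ← rightUnitor_inv_naturality, ← Category.assoc, incl_envIso]
  primitivelyGenerated := fun S hS h => by
    refine pw_eq_top k A hS (Subobject.factors_of_le _ h ?_)
    rw [kernelSubobject_factors_iff, primDefect_eq_zero_iff, pwPrim_pwδ, Category.assoc,
      Category.assoc]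

end PGHopf

end OfHopf

/-! ### Functoriality of the Woronowicz algebra -/

section Functor

variable (k : Type w) [Field k] [CharZero k] {C : Type u} [Category.{v} C] [Abelian C]
  [Linear k C] [MonoidalCategory C] [MonoidalPreadditive C] [MonoidalLinear k C]
  [BraidedCategory C] [HasColimitsOfSize.{w, w} C] [AB5OfSize.{w, w} C]
  [∀ X : C, PreservesColimitsOfSize.{w, w} (tensorLeft X)]
  [∀ X : C, PreservesFiniteColimits (tensorLeft X)]
  [∀ X : C, PreservesFiniteLimits (tensorLeft X)]

theorem worOps_naturality {k : Type w} [Field k] {C : Type u} [Category.{v} C] [Preadditive C]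
    [Linear k C] [MonoidalCategory C] [BraidedCategory C] {A B : C} [MonObj A] [MonObj B]
    (hA : FinitelyBraided A) (hB : FinitelyBraided B) (f : A ⟶ B) [IsMonHom f] (n : ℕ)
    (x : WorStar k n) : worOps k A n x ≫ f = tpowMap f n ≫ worOps k B n x := by
  change (hatAct k A n x.1 ≫ mulN A n) ≫ f = tpowMap f n ≫ hatAct k B n x.1 ≫ mulN B n
  rw [Category.assoc, mulN_naturality, ← Category.assoc, hatAct_naturality hA hB, Category.assoc]

namespace PGHopf

include k in
/-- A morphism of Hopf algebras maps the Woronowicz algebra to the Woronowicz algebra, as it maps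
primitives to primitives. -/
theorem pw_factors (A B : PGHopf C) (f : A ⟶ B) :
    (pw.{w} B).Factors ((pw.{w} A).arrow ≫ f.hom) := by
  have h := (isPW_pw k A).le_of_closed (T := (Subobject.pullback f.hom).obj (pw.{w} B))
    ((isPW_pw k B).closed.pullback
      (worOps_naturality A.finitelyBraided B.finitelyBraided f.hom)) ?_
  · exact (pullback_factors_iff _ _ _).1 (Subobject.factors_of_le _ h (Subobject.factors_self _))
  · refine Subobject.le_of_comm (Subobject.factorThru _ (primitives A.X).arrow ?_)
      (Subobject.factorThru_arrow _ _ _)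
    rw [pullback_factors_iff]
    refine Subobject.factors_of_le _ (isPW_pw k B).le ?_
    rw [primitives_factors_iff, Category.assoc, IsComonHom.hom_comul, ← Category.assoc,
      primitives_arrow, Preadditive.add_comp, Category.assoc, Category.assoc, inl_naturality,
      inr_naturality, Category.assoc, Category.assoc]

/-- The restriction of a morphism of Hopf algebras to the Woronowicz algebras. -/
noncomputable def pwMap {A B : PGHopf C} (f : A ⟶ B) : (pw.{w} A : C) ⟶ (pw.{w} B : C) :=
  (pw.{w} B).factorThru _ (pw_factors k A B f)

theorem pwMap_arrow {A B : PGHopf C} (f : A ⟶ B) :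
    pwMap k f ≫ (pw.{w} B).arrow = (pw.{w} A).arrow ≫ f.hom :=
  (pw.{w} B).factorThru_arrow _ _

theorem pwMap_op {A B : PGHopf C} (f : A ⟶ B) (n : ℕ) (x : WorStar k n) :
    pwOps k A n x ≫ pwMap k f = tpowMap (pwMap k f) n ≫ pwOps k B n x := by
  rw [← cancel_mono (pw.{w} B).arrow, Category.assoc, Category.assoc, pwMap_arrow,
    pwOps, pwOps, restrictOps_arrow, ← Category.assoc, restrictOps_arrow, Category.assoc,
    worOps_naturality A.finitelyBraided B.finitelyBraided f.hom, ← Category.assoc,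
    ← Category.assoc, ← tpowMap_comp, ← tpowMap_comp, pwMap_arrow]

theorem map_pwMap_envIso {A B : PGHopf C} (f : A ⟶ B) :
    WorHopf.map (L := toWorHopf k A) (M := toWorHopf k B) (pwMap k f) (pwMap_op k f) ≫
      (envIso k B).hom = (envIso k A).hom ≫ f.hom := by
  have h : IsMonHom (WorHopf.map (L := toWorHopf k A) (M := toWorHopf k B) (pwMap k f)
    (pwMap_op k f)) := Env.lift_isMonHom _ _ _
  refine Env.hom_ext _ ?_
  rw [WorHopf.map, ← Category.assoc, Env.incl_lift, Category.assoc, incl_envIso, pwMap_arrow,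
    ← Category.assoc, incl_envIso]

/-- The functor from primitively generated Hopf algebras to Hopf `𝔚_*`-algebras. -/
noncomputable def pwFunctor : PGHopf C ⥤ WorHopf k C where
  obj A := toWorHopf k A
  map {A B} f :=
    { hom := pwMap k f
      map_op := pwMap_op k f
      map_δ := by
        change pwδ k A ≫ _ = pwMap k f ≫ pwδ k B
        rw [← cancel_mono ((envIso k B).hom ⊗ₘ (envIso k B).hom), Category.assoc,
          tensorHom_comp_tensorHom, map_pwMap_envIso, ← tensorHom_comp_tensorHom,
          ← Category.assoc, pwδ_envIso, Category.assoc, Category.assoc, pwδ_envIso,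
          ← Category.assoc (pwMap k f), pwMap_arrow, Category.assoc, IsComonHom.hom_comul] }
  map_id A := by
    refine WorHopf.Hom.ext ?_
    change pwMap k (𝟙 A) = 𝟙 _
    rw [← cancel_mono (pw.{w} A).arrow, pwMap_arrow, Category.id_comp]
    exact Category.comp_id _
  map_comp {A B D} f g := by
    refine WorHopf.Hom.ext ?_
    change pwMap k (f ≫ g) = pwMap k f ≫ pwMap k g
    rw [← cancel_mono (pw.{w} D).arrow, pwMap_arrow, Category.assoc, pwMap_arrow,
      ← Category.assoc, pwMap_arrow, Category.assoc]
    rfl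

end PGHopf

end Functor

/-! ### The Hopf algebra of a primitively generated Hopf `𝔚_*`-algebra -/

section OfWorHopf

variable {k : Type w} [Field k] {C : Type u} [Category.{v} C] [Abelian C]
  [Linear k C] [MonoidalCategory C] [MonoidalPreadditive C]
  [BraidedCategory C] [HasColimitsOfSize.{w, w} C]
  [∀ X : C, PreservesColimitsOfSize.{w, w} (tensorLeft X)]
  [∀ X : C, PreservesFiniteColimits (tensorLeft X)]

namespace WorHopf

variable (L : WorHopf k C)

instance comul_isMonHom : IsMonHom L.comul := Env.lift_isMonHom _ _ L.δ_isWorHom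

instance aug_isMonHom : IsMonHom (Env.aug L.op) := Env.lift_isMonHom _ _ (isWorHom_zero L.op)

theorem incl_comul : Env.incl L.op ≫ L.comul = L.δ := Env.incl_lift _ _ L.δ_isWorHom

theorem incl_aug : Env.incl L.op ≫ Env.aug L.op = 0 := Env.incl_lift _ _ (isWorHom_zero L.op)

theorem counit_comul : L.comul ≫ Env.aug L.op ▷ L.U = (λ_ L.U).inv :=
  Env.hom_ext _ (by rw [← Category.assoc, incl_comul, L.counit_left])

theorem comul_counit : L.comul ≫ L.U ◁ Env.aug L.op = (ρ_ L.U).inv :=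
  Env.hom_ext _ (by rw [← Category.assoc, incl_comul, L.counit_right])

theorem comul_assoc : L.comul ≫ L.comul ▷ L.U ≫ (α_ _ _ _).hom = L.comul ≫ L.U ◁ L.comul :=
  Env.hom_ext _ (by
    rw [← Category.assoc, incl_comul, ← Category.assoc (Env.incl L.op), incl_comul]
    exact L.coassoc)

/-- The bialgebra structure on the enveloping algebra. -/
noncomputable abbrev bimonObj : BimonObj L.U where
  counit := Env.aug L.op
  comul := L.comul
  counit_comul := L.counit_comul
  comul_counit := L.comul_counit
  comul_assoc := L.comul_assoc.symm
  mul_comul := (IsMonHom.mul_hom (f := L.comul)).trans (by rw [MonObj.tensorObj.mul_def])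
  one_comul := IsMonHom.one_hom (f := L.comul)
  mul_counit := IsMonHom.mul_hom (f := Env.aug L.op)
  one_counit := IsMonHom.one_hom (f := Env.aug L.op)

/-- The primitives of `L`. -/
noncomputable def prim : Subobject L.L := kernelSubobject (primDefect (Env.incl L.op) L.δ)

/-- The inclusion of the primitives of `L` in the enveloping algebra. -/
noncomputable def primIncl : (L.prim : C) ⟶ L.U := L.prim.arrow ≫ Env.incl L.op

instance : Mono L.primIncl := mono_comp _ _

theorem primIncl_comul : L.primIncl ≫ L.comul = L.primIncl ≫ inl _ _ + L.primIncl ≫ inr _ _ := by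
  rw [primIncl, Category.assoc, incl_comul]
  exact (primDefect_eq_zero_iff _ _ _).1 (kernelSubobject_arrow_comp _)

theorem primIncl_aug : L.primIncl ≫ Env.aug L.op = 0 := by
  rw [primIncl, Category.assoc, incl_aug, comp_zero]

theorem op_incl (n : ℕ) (x : WorStar k n) :
    L.op n x ≫ Env.incl L.op = tpowMap (Env.incl L.op) n ≫ worOps k L.U n x :=
  (Env.incl_isWorHom L.op).map_op L.finitelyBraided L.env_finitelyBraided n x

/-- A closed subobject of the enveloping algebra that contains the primitives of `L` contains
`L`. -/
theorem factors_incl {S : Subobject L.U} (hS : IsClosedUnder (worOps k L.U) S)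
    (h : S.Factors L.primIncl) : S.Factors (Env.incl L.op) := by
  have h1 := L.primitivelyGenerated ((Subobject.pullback (Env.incl L.op)).obj S)
    (hS.pullback L.op_incl) (Subobject.le_of_comm (Subobject.factorThru _ L.prim.arrow
      ((pullback_factors_iff _ _ _).2 h)) (Subobject.factorThru_arrow _ _ _))
  have h2 : ((Subobject.pullback (Env.incl L.op)).obj S).Factors (𝟙 _) := by
    rw [h1]
    exact Subobject.top_factors _
  rwa [pullback_factors_iff, Category.id_comp] at h2

variable [∀ X : C, PreservesFiniteLimits (tensorLeft X)]

/-- The enveloping algebra is generated by the primitives of `L`: the subalgebra they generate is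
closed, so it contains `L`. -/
instance epi_lift_primIncl : Epi (tensorAlg.lift.{w} L.primIncl) := by
  refine epi_lift_of_image_eq_top _ (eq_top_of_factors.{w} (Env.incl L.op) _ (factors_image_one _)
    (factors_image_mul _) (L.factors_incl ?_ (factors_image _)))
  exact isClosedUnder_of_subalgebra L.env_finitelyBraided _ (factors_image_one _)
    (factors_image_mul _)

variable [AB5OfSize.{w, w} C]

/-- The Hopf algebra structure on the enveloping algebra. -/
noncomputable abbrev hopfObj : HopfObj L.U :=
  letI := L.bimonObj
  hopfObjOfEpi.{w} (v := L.primIncl) L.primIncl_comul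

/-- The primitively generated Hopf algebra of a primitively generated Hopf `𝔚_*`-algebra. -/
noncomputable def toPGHopf : PGHopf C :=
  letI := L.bimonObj
  { X := L.U
    hopf := L.hopfObj
    finitelyBraided := L.env_finitelyBraided
    primitivelyGenerated := PrimitivelyGenerated.of_epi_lift.{w} L.primIncl L.primIncl_comul }

variable {L} in
theorem isWorHom_hom_incl {M : WorHopf k C} (f : L ⟶ M) :
    IsWorHom L.op (f.hom ≫ Env.incl M.op) :=
  (Env.incl_isWorHom M.op).precomp L.finitelyBraided M.finitelyBraided f.hom f.map_op

variable {L} in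
theorem isMonHom_envMap {M : WorHopf k C} (f : L ⟶ M) : IsMonHom (envMap f) :=
  Env.lift_isMonHom _ _ (isWorHom_hom_incl f)

variable {L} in
theorem incl_envMap {M : WorHopf k C} (f : L ⟶ M) :
    Env.incl L.op ≫ envMap f = f.hom ≫ Env.incl M.op :=
  Env.incl_lift _ _ (isWorHom_hom_incl f)

variable {L} in
theorem envMap_comul {M : WorHopf k C} (f : L ⟶ M) :
    envMap f ≫ M.comul = L.comul ≫ (envMap f ⊗ₘ envMap f) := by
  have := isMonHom_envMap f
  refine Env.hom_ext _ ?_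
  rw [← Category.assoc, incl_envMap, ← Category.assoc, incl_comul, Category.assoc, incl_comul]
  exact f.map_δ.symm

variable {L} in
theorem envMap_aug {M : WorHopf k C} (f : L ⟶ M) : envMap f ≫ Env.aug M.op = Env.aug L.op := by
  have := isMonHom_envMap f
  refine Env.hom_ext _ ?_
  rw [← Category.assoc, incl_envMap, Category.assoc, incl_aug, incl_aug, comp_zero]

variable {L} in
/-- The morphism of Hopf algebras induced by a morphism of Hopf `𝔚_*`-algebras. -/
noncomputable def toPGHopfMap {M : WorHopf k C} (f : L ⟶ M) : L.toPGHopf ⟶ M.toPGHopf where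
  hom := envMap f
  isBimonHom :=
    { toIsMonHom := isMonHom_envMap f
      hom_counit := envMap_aug f
      hom_comul := envMap_comul f }

/-- The functor from primitively generated Hopf `𝔚_*`-algebras to Hopf algebras. -/
noncomputable def envFunctor : WorHopf k C ⥤ PGHopf C where
  obj L := L.toPGHopf
  map f := toPGHopfMap f
  map_id L := PGHopf.Hom.ext (map_id L (Hom.map_op (𝟙 L)))
  map_comp f g := PGHopf.Hom.ext (map_comp _ _ f.map_op g.map_op (Hom.map_op (f ≫ g)))

end WorHopf

end OfWorHopf

/-! ### The equivalence -/

section Equivalence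

variable (k : Type w) [Field k] [CharZero k] {C : Type u} [Category.{v} C] [Abelian C]
  [Linear k C] [MonoidalCategory C] [MonoidalPreadditive C] [MonoidalLinear k C]
  [BraidedCategory C] [HasColimitsOfSize.{w, w} C] [AB5OfSize.{w, w} C]
  [∀ X : C, PreservesColimitsOfSize.{w, w} (tensorLeft X)]
  [∀ X : C, PreservesFiniteColimits (tensorLeft X)]
  [∀ X : C, PreservesFiniteLimits (tensorLeft X)]

namespace WorHopf

/-- The morphism of Hopf algebras from the enveloping algebra of the Woronowicz algebra of `A`
to `A`. -/
noncomputable def unitInv (A : PGHopf C) : (PGHopf.toWorHopf k A).toPGHopf ⟶ A where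
  hom := (A.envIso k).hom
  isBimonHom :=
    { toIsMonHom := inferInstanceAs (IsMonHom (A.envIso k).hom)
      hom_counit := (A.aug_eq k).symm
      hom_comul := by
        refine (A.envComul_envIso k).symm.trans ?_
        rw [← PGHopf.lift_pwδ]
        rfl }

theorem comul_toWorHopf (A : PGHopf C) : (PGHopf.toWorHopf k A).comul = A.envComul k :=
  A.lift_pwδ k

/-- The inverse of `unitInv`. -/
noncomputable def unitHom (A : PGHopf C) : A ⟶ (PGHopf.toWorHopf k A).toPGHopf where
  hom := (A.envIso k).inv
  isBimonHom :=
    { toIsMonHom := inferInstanceAs (IsMonHom (A.envIso k).inv)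
      hom_counit := (Iso.inv_comp_eq _).2 (A.aug_eq k)
      hom_comul := by
        refine (Iso.inv_comp_eq (A.envIso k)).2 ?_
        exact comul_toWorHopf k A }

/-- The unit of the equivalence. -/
noncomputable def unitIso :
    𝟭 (PGHopf C) ≅ PGHopf.pwFunctor k ⋙ envFunctor (k := k) (C := C) :=
  NatIso.ofComponents (fun A =>
    { hom := unitHom k A
      inv := unitInv k A
      hom_inv_id := PGHopf.Hom.ext (A.envIso k).inv_hom_id
      inv_hom_id := PGHopf.Hom.ext (A.envIso k).hom_inv_id }) fun {A B} f => by
    refine PGHopf.Hom.ext ?_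
    change f.hom ≫ (B.envIso k).inv =
      (A.envIso k).inv ≫ map (L := PGHopf.toWorHopf k A) (M := PGHopf.toWorHopf k B)
        (PGHopf.pwMap k f) (PGHopf.pwMap_op k f)
    rw [Iso.comp_inv_eq, Category.assoc, PGHopf.map_pwMap_envIso, Iso.inv_hom_id_assoc]

variable {k}

/-- `L` is the Woronowicz algebra of its enveloping algebra: all primitives of the latter
lie in the closure of the primitives of `L`, which is contained in `L`. -/
theorem isPW_incl (L : WorHopf k C) :
    let _ := L.bimonObj
    IsPW k L.U (Subobject.mk (Env.incl L.op)) := by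
  let _ := L.bimonObj
  have := isMonHom_comul L.U
  have hcl : IsClosedUnder (worOps k L.U) (Subobject.mk (Env.incl L.op)) :=
    isClosedUnder_mk _ L.op_incl
  have hf : (Subobject.mk (Env.incl L.op)).Factors L.primIncl :=
    (Subobject.mk_factors_iff _ _).2 ⟨L.prim.arrow, rfl⟩
  refine ⟨⟨hcl, ?_⟩, fun S hS => ?_⟩
  · refine le_trans ?_ (symClosure_le.{w} L.env_finitelyBraided L.primIncl hcl hf)
    exact Subobject.le_of_comm _ (Subobject.factorThru_arrow _ _
      (symClosure_factors_of_primitive k L.env_finitelyBraided L.primIncl_comul L.primIncl_aug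
        (primitives L.U).arrow (primitives_arrow L.U)))
  · have h := L.factors_incl hS.1 (Subobject.factors_of_le _ hS.2
      ((primitives_factors_iff (A := L.U) _).2 L.primIncl_comul))
    exact Subobject.mk_le_of_comm (S.factorThru _ h) (S.factorThru_arrow _ h)

/-- The inclusion of `L` in its enveloping Hopf algebra. -/
noncomputable def inclHopf (L : WorHopf k C) : L.L ⟶ L.toPGHopf.X := Env.incl L.op

instance (L : WorHopf k C) : Mono L.inclHopf := inferInstanceAs (Mono (Env.incl L.op))

theorem inclHopf_comul (L : WorHopf k C) : L.inclHopf ≫ Δ[L.toPGHopf.X] = L.δ := L.incl_comul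

theorem mk_inclHopf (L : WorHopf k C) : Subobject.mk L.inclHopf = PGHopf.pw.{w} L.toPGHopf :=
  (isPW_incl L).unique (PGHopf.isPW_pw k L.toPGHopf)

/-- `L` is the Woronowicz algebra of its enveloping algebra. -/
noncomputable def pwIso (L : WorHopf k C) : L.L ≅ (PGHopf.pw.{w} L.toPGHopf : C) :=
  Subobject.isoOfMkEq L.inclHopf _ L.mk_inclHopf

theorem pwIso_arrow (L : WorHopf k C) :
    (pwIso L).hom ≫ (PGHopf.pw.{w} L.toPGHopf).arrow = L.inclHopf :=
  Subobject.ofMkLE_arrow _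

theorem pwIso_op (L : WorHopf k C) (n : ℕ) (x : WorStar k n) :
    L.op n x ≫ (pwIso L).hom = tpowMap (pwIso L).hom n ≫ PGHopf.pwOps k L.toPGHopf n x := by
  rw [← cancel_mono (PGHopf.pw.{w} L.toPGHopf).arrow, Category.assoc, pwIso_arrow, Category.assoc,
    PGHopf.pwOps, restrictOps_arrow, ← Category.assoc, ← tpowMap_comp, pwIso_arrow]
  exact L.op_incl n x

/-- The morphism of enveloping algebras induced by `pwIso`. -/
noncomputable def mapPwIso (L : WorHopf k C) : L.U ⟶ Env (PGHopf.pwOps k L.toPGHopf) :=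
  map (M := PGHopf.toWorHopf k L.toPGHopf) (pwIso L).hom (pwIso_op L)

theorem incl_mapPwIso (L : WorHopf k C) : Env.incl L.op ≫ mapPwIso L =
    (pwIso L).hom ≫ Env.incl (PGHopf.pwOps k L.toPGHopf) :=
  Env.incl_lift _ _ ((Env.incl_isWorHom _).precomp L.finitelyBraided
    (PGHopf.pw_finitelyBraided _) _ (pwIso_op L))

theorem eq_id_of_incl (L : WorHopf k C) (g : L.U ⟶ L.U) (_ : IsMonHom g)
    (h : Env.incl L.op ≫ g = Env.incl L.op) : g = 𝟙 L.U :=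
  Env.hom_ext L.op (h.trans (Category.comp_id _).symm)

theorem mapPwIso_envIso (L : WorHopf k C) : mapPwIso L ≫ (L.toPGHopf.envIso k).hom = 𝟙 L.U := by
  have h : IsMonHom (mapPwIso L) := Env.lift_isMonHom _ _ ((Env.incl_isWorHom _).precomp
    L.finitelyBraided (PGHopf.pw_finitelyBraided _) _ (pwIso_op L))
  have h' : IsMonHom (M := Env (PGHopf.pwOps k L.toPGHopf)) (N := L.U)
    (L.toPGHopf.envIso k).hom := inferInstanceAs (IsMonHom (PGHopf.envHom k L.toPGHopf))
  have h1 : IsMonHom (M := L.U) (N := L.U) (mapPwIso L ≫ (L.toPGHopf.envIso k).hom) :=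
    @instIsMonHomComp _ _ _ _ _ L.U _ _ _ _ _ h h'
  refine L.eq_id_of_incl _ h1 ?_
  refine (Category.assoc _ _ _).symm.trans
    ((congrArg (· ≫ (L.toPGHopf.envIso k).hom) (incl_mapPwIso L)).trans ?_)
  refine (Category.assoc _ _ _).trans ?_
  exact (congrArg ((pwIso L).hom ≫ ·) (L.toPGHopf.incl_envIso k)).trans (pwIso_arrow L)

/-- The morphism from `L` to the Woronowicz algebra of its enveloping algebra. -/
noncomputable def counitInv (L : WorHopf k C) : L ⟶ PGHopf.toWorHopf k L.toPGHopf where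
  hom := (pwIso L).hom
  map_op := pwIso_op L
  map_δ := by
    change L.δ ≫ (mapPwIso L ⊗ₘ mapPwIso L) = (pwIso L).hom ≫ PGHopf.pwδ k L.toPGHopf
    rw [← cancel_mono ((L.toPGHopf.envIso k).hom ⊗ₘ (L.toPGHopf.envIso k).hom), Category.assoc,
      Category.assoc, PGHopf.pwδ_envIso, ← Category.assoc (pwIso L).hom, pwIso_arrow,
      inclHopf_comul, tensorHom_comp_tensorHom, mapPwIso_envIso]
    exact (congrArg _ (id_tensorHom_id _ _)).trans (Category.comp_id _)

/-- A morphism of Hopf `𝔚_*`-algebras is an isomorphism if the underlying morphism is. -/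
noncomputable def isoOfIso {L M : WorHopf k C} (f : L ⟶ M) (g : M.L ⟶ L.L)
    (h : f.hom ≫ g = 𝟙 _) (h' : g ≫ f.hom = 𝟙 _) : L ≅ M :=
  have hg : ∀ n (x : WorStar k n), M.op n x ≫ g = tpowMap g n ≫ L.op n x := fun n x => by
    have h1 : tpowMap g n ≫ tpowMap f.hom n = 𝟙 _ := by rw [← tpowMap_comp, h', tpowMap_id]
    rw [← Category.id_comp (M.op n x), ← h1, Category.assoc, Category.assoc, ← Category.assoc _ _ g,
      ← f.map_op, Category.assoc, h, Category.comp_id]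
  have hfg : envMap f ≫ map g hg = 𝟙 L.U := by
    refine (map_comp f.hom g f.map_op hg fun n x => ?_).symm.trans ?_
    · rw [h, Category.comp_id, tpowMap_id, Category.id_comp]
    · simp only [h]
      exact map_id L _
  { hom := f
    inv :=
      { hom := g
        map_op := hg
        map_δ := by
          have : IsSplitEpi f.hom := ⟨⟨g, h'⟩⟩
          rw [← cancel_epi f.hom, ← Category.assoc, ← f.map_δ, Category.assoc]
          change L.δ ≫ (envMap f ⊗ₘ envMap f) ≫ _ = _
          rw [tensorHom_comp_tensorHom, hfg, id_tensorHom_id, Category.comp_id, ← Category.assoc,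
            h, Category.id_comp] }
    hom_inv_id := Hom.ext h
    inv_hom_id := Hom.ext h' }

/-- The counit of the equivalence. -/
noncomputable def counitIso :
    envFunctor (k := k) (C := C) ⋙ PGHopf.pwFunctor k ≅ 𝟭 (WorHopf k C) :=
  NatIso.ofComponents (fun L => (isoOfIso (counitInv L) (pwIso L).inv (pwIso L).hom_inv_id
    (pwIso L).inv_hom_id).symm) fun {L M} f => by
    refine Hom.ext ?_
    change PGHopf.pwMap k (toPGHopfMap f) ≫ (pwIso M).inv = (pwIso L).inv ≫ f.hom
    rw [Iso.comp_inv_eq, Category.assoc, Iso.eq_inv_comp,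
      ← cancel_mono (PGHopf.pw.{w} M.toPGHopf).arrow, Category.assoc, Category.assoc, pwIso_arrow,
      PGHopf.pwMap_arrow, ← Category.assoc, pwIso_arrow]
    exact incl_envMap f

variable (k C)

/-- The enveloping algebra and the Woronowicz algebra are mutually inverse equivalences. -/
noncomputable def equivalence : PGHopf C ≌ WorHopf k C where
  functor := PGHopf.pwFunctor k
  inverse := envFunctor
  unitIso := unitIso k
  counitIso := counitIso
  functor_unitIso_comp A := by
    refine Hom.ext ?_
    change PGHopf.pwMap k (unitHom k A) ≫ (pwIso (PGHopf.toWorHopf k A)).inv = 𝟙 _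
    rw [Iso.comp_inv_eq, Category.id_comp,
      ← cancel_mono (PGHopf.pw.{w} (PGHopf.toWorHopf k A).toPGHopf).arrow, pwIso_arrow,
      PGHopf.pwMap_arrow]
    exact A.arrow_envIso_inv k

end WorHopf

end Equivalence

end BraidedHopf

theorem theorem1 {k : Type w} [Field k] [CharZero k] {C : Type u} [Category.{v} C]
    [Abelian C] [Linear k C] [MonoidalCategory C] [MonoidalPreadditive C] [MonoidalLinear k C]
    [BraidedCategory C] [HasColimitsOfSize.{w, w} C] [AB5OfSize.{w, w} C]
    [∀ X : C, PreservesColimitsOfSize.{w, w} (tensorLeft X)]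
    [∀ X : C, PreservesFiniteColimits (tensorLeft X)]
    [∀ X : C, PreservesFiniteLimits (tensorLeft X)] :
    (∀ (A : C) [HopfObj A] (hA : BraidedHopf.FinitelyBraided A),
      BraidedHopf.PrimitivelyGenerated A →
        ∃ (S : Subobject A) (hS : BraidedHopf.IsPW k A S),
          IsMonHom (BraidedHopf.envMul k A hA S hS.1.1) ∧
            IsIso (BraidedHopf.envMul k A hA S hS.1.1)) ∧
    ∃ (e : BraidedHopf.PGHopf C ≌ BraidedHopf.WorHopf k C)
      (i : ∀ A : BraidedHopf.PGHopf C, (e.functor.obj A).L ⟶ A.X)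
      (hi : ∀ A : BraidedHopf.PGHopf C, BraidedHopf.IsWorHom (e.functor.obj A).op (i A))
      (j : ∀ L : BraidedHopf.WorHopf k C, L.U ≅ (e.inverse.obj L).X),
      (∀ A, ∃ _ : Mono (i A), BraidedHopf.IsPW k A.X (Subobject.mk (i A))) ∧
      (∀ {A B : BraidedHopf.PGHopf C} (f : A ⟶ B),
        (e.functor.map f).hom ≫ i B = i A ≫ f.hom) ∧
      (∀ A, (e.functor.obj A).δ ≫ (BraidedHopf.Env.lift _ (i A) (hi A) ⊗ₘ
        BraidedHopf.Env.lift _ (i A) (hi A)) = i A ≫ Δ[A.X]) ∧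
      (∀ L, IsMonHom (j L).hom ∧
        (j L).hom ≫ Δ[(e.inverse.obj L).X] = L.comul ≫ ((j L).hom ⊗ₘ (j L).hom) ∧
        (j L).hom ≫ ε[(e.inverse.obj L).X] = BraidedHopf.Env.aug L.op) ∧
      (∀ {L M : BraidedHopf.WorHopf k C} (f : L ⟶ M),
        BraidedHopf.WorHopf.envMap f ≫ (j M).hom = (j L).hom ≫ (e.inverse.map f).hom) ∧
      (∀ A, (j (e.functor.obj A)).hom ≫ (e.unitIso.inv.app A).hom =
        BraidedHopf.Env.lift _ (i A) (hi A)) ∧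
      (∀ L, (e.counitIso.inv.app L).hom ≫ i (e.inverse.obj L) =
        BraidedHopf.Env.incl L.op ≫ (j L).hom) := by
  open BraidedHopf in
  -- `i A` is the inclusion of the Woronowicz algebra; `j L` is the identity, as the inverse functor
  -- sends `L` to a Hopf algebra structure on `L.U` itself.
  refine ⟨fun A _ hA h => ⟨_, isPW_symClosure k hA h, Env.lift_isMonHom _ _ _,
    (isPW_symClosure k hA h).isIso_envMul hA h⟩, WorHopf.equivalence k C,
    fun A => (PGHopf.pw.{w} A).arrow, PGHopf.arrow_isWorHom k, fun L => Iso.refl L.U,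
    fun A => ⟨inferInstanceAs (Mono (PGHopf.pw.{w} A).arrow), ?_⟩, PGHopf.pwMap_arrow k,
    PGHopf.pwδ_envIso k, fun L => ⟨?_, ?_, ?_⟩,
    fun f => ?_, fun A => ?_, fun L => ?_⟩
  · exact (Subobject.mk_arrow (PGHopf.pw.{w} A)).symm ▸ PGHopf.isPW_pw k A
  · exact inferInstanceAs (IsMonHom (𝟙 L.U))
  · refine (Category.id_comp _).trans ((Category.comp_id _).symm.trans ?_)
    exact congrArg (L.comul ≫ ·) (id_tensorHom_id _ _).symm
  · exact Category.id_comp _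
  · exact (Category.comp_id _).trans (Category.id_comp _).symm
  · exact Category.id_comp _
  · exact (WorHopf.pwIso_arrow L).trans (Category.comp_id _).symm
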